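/- Let $\sigma$ be the round metric of the unit sphere $S^2\subset\mathbb R^3$, let $N=[1,\infty)\times S^2$ and fix $0<m<1$. Call a Riemannian metric $\overline g$ on $N$ a *Ricci flow extension of $\sigma$ with data $(\overline R,H)$* if - $\overline g=\dfrac{u^2}{1+t^2}\,dt^2+t^2g(t)$ on $N$ with $u\in C^\infty(N)$, $u>0$, where $g(t)$, $1\le t<\infty$, is a smooth solution of Hamilton's modified Ricci flow $\partial_t g_{ij}=(r-R)g_{ij}+2D_iD_jf=2M_{ij}$, $g(1)=\sigma$; here $R$ is the scalar curvature of $g(t)$, $r$ is its mean value over $(S^2,g(t))$, and $f(t,\cdot)$ satisfies $\Delta_{g(t)} f=R-r$; - the scalar curvature of $\overline g$ is $\overline R$, and the mean curvature of $\{1\}\times S^2$ in direction $\partial_t$ is $H$. Take $\overline R\equiv-6$ and the constant $H\equiv\sqrt{8(1-m)}$. Then: 1. The data are admissible for the construction: for every solution $(g,f)$ of the flow with $g(1)=\sigma$, $$K=\sup_{t\ge1}\Big\{-\int_1^t\tfrac14\inf_{S^2}\big(R_{g(s)}-s^2\overline R\big)\exp\Big(\int_1^s\tfrac{\tau}{2}\big(\sup_{S^2}|M|_{g(\tau)}\big)^2d\tau\Big)ds\Big\}<\infty\quad\text{and}\quad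 H>2\sqrt{2K}.$$ 2. The anti-de Sitter Riemannian Schwarzschild metric of mass $m$, $$\Big(1+t^2-\frac{2m}{t}\Big)^{-1}dt^2+t^2\sigma ,$$ is a Ricci flow extension of $\sigma$ with data $(-6,\sqrt{8(1-m)})$, and it is asymptotically hyperbolic: outside a compact set, $N$ is diffeomorphic to the exterior of a geodesic sphere in hyperbolic space $\mathbb H^3$ with metric $dr^2+\sinh^2 r\,\sigma$ such that, in the frames $\varepsilon_0=\partial_r$, $\varepsilon_\alpha=f_\alpha/\sinh r$ ($f_\alpha$ a smooth local orthonormal frame of $(S^2,\sigma)$), the components $g_{ij}$ of the metric satisfy $|g_{ij}-\delta_{ij}|,\ |\varepsilon_k(g_{ij})|,\ |\varepsilon_k(\varepsilon_l(g_{ij}))|=O(e^{-\tau r})$ for some $\tau>\tfrac32$. 3. It is the only one: every Ricci flow extension of $\sigma$ with data $(-6,\sqrt{8(1-m)})$ equals this metric on $N$. -/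

import Mathlib

open Set Metric MeasureTheory Module
open scoped Manifold ContDiff Topology

noncomputable section

namespace RicciFoliation

/-! ### Riemannian geometry in coordinates

`E` is the model vector space with a basis `b`, `S ⊆ E` is the domain of the coordinates (with
boundary allowed: derivatives are taken within `S`), and `G : E → Matrix ι ι ℝ` is the matrix
`g_{ij}` of a metric in these coordinates. -/

section Coordinates

variable {E : Type*} [NormedAddCommGroup E] [NormedSpace ℝ E]
variable {ι : Type*} [Fintype ι] [DecidableEq ι]

/-- The partial derivative `∂_i F` at `y`, taken within `S`. -/
def pd (b : Basis ι ℝ E) (S : Set E) (i : ι) (F : E → ℝ) (y : E) : ℝ :=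
  fderivWithin ℝ F S y (b i)

/-- The Christoffel symbol
`Γ^k_{ij} = (1/2) g^{kl} (∂_i g_{jl} + ∂_j g_{il} - ∂_l g_{ij})`. -/
def christoffel (b : Basis ι ℝ E) (S : Set E) (G : E → Matrix ι ι ℝ) (k i j : ι) (y : E) : ℝ :=
  1 / 2 * ∑ l, (G y)⁻¹ k l *
    (pd b S i (fun z => G z j l) y + pd b S j (fun z => G z i l) y - pd b S l (fun z => G z i j) y)

/-- The Ricci tensor
`R_{ij} = ∂_k Γ^k_{ij} - ∂_j Γ^k_{ik} + Γ^k_{kl} Γ^l_{ij} - Γ^k_{jl} Γ^l_{ik}`. -/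
def ricci (b : Basis ι ℝ E) (S : Set E) (G : E → Matrix ι ι ℝ) (i j : ι) (y : E) : ℝ :=
  (∑ k, (pd b S k (christoffel b S G k i j) y - pd b S j (christoffel b S G k i k) y)) +
    ∑ k, ∑ l, (christoffel b S G k k l y * christoffel b S G l i j y -
      christoffel b S G k j l y * christoffel b S G l i k y)

/-- The scalar curvature `g^{ij} R_{ij}`. -/
def scal (b : Basis ι ℝ E) (S : Set E) (G : E → Matrix ι ι ℝ) (y : E) : ℝ :=
  ∑ i, ∑ j, (G y)⁻¹ i j * ricci b S G i j y

/-- The Hessian `D_i D_j F = ∂_i ∂_j F - Γ^k_{ij} ∂_k F`. -/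
def hess (b : Basis ι ℝ E) (S : Set E) (G : E → Matrix ι ι ℝ) (F : E → ℝ) (i j : ι) (y : E) : ℝ :=
  pd b S i (pd b S j F) y - ∑ k, christoffel b S G k i j y * pd b S k F y

/-- The Laplacian `Δ F = g^{ij} D_i D_j F`. -/
def lap (b : Basis ι ℝ E) (S : Set E) (G : E → Matrix ι ι ℝ) (F : E → ℝ) (y : E) : ℝ :=
  ∑ i, ∑ j, (G y)⁻¹ i j * hess b S G F i j y

end Coordinates

/-! ### Tensor fields on manifolds and their coordinate expressions -/

section Manifolds

variable {E : Type*} [NormedAddCommGroup E] [NormedSpace ℝ E]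
variable {H : Type*} [TopologicalSpace H] (I : ModelWithCorners ℝ E H)
variable {M : Type*} [TopologicalSpace M] [ChartedSpace H M]
variable {ι : Type*}

/-- A (0,2)-tensor field: a bilinear form on each tangent space. -/
abbrev Tensor2 (M : Type*) [TopologicalSpace M] [ChartedSpace H M] :=
  ∀ x : M, LinearMap.BilinForm ℝ (TangentSpace I x)

/-- The part of the target of the chart around `p` that corresponds to points of `D ⊆ M`. -/
def chartDomain (D : Set M) (p : M) : Set E :=
  (extChartAt I p).target ∩ (extChartAt I p).symm ⁻¹' D

/-- The `i`-th coordinate vector field of the chart around `p`, at the point with coordinates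
`y`. -/
def coordVec (b : Basis ι ℝ E) (p : M) (y : E) (i : ι) :
    TangentSpace I ((extChartAt I p).symm y) :=
  mfderivWithin 𝓘(ℝ, E) I (extChartAt I p).symm (range I) y (b i)

/-- The matrix `g_{ij}` of a (0,2)-tensor field in the chart around `p`. -/
def coordMatrix (b : Basis ι ℝ E) (g : Tensor2 I M) (p : M) (y : E) : Matrix ι ι ℝ :=
  Matrix.of fun i j =>
    g ((extChartAt I p).symm y) (coordVec I b p y i) (coordVec I b p y j)

variable [Fintype ι] [DecidableEq ι]

/-- The scalar curvature at the point `p` of a metric given on the region `D ⊆ M`, computed in the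
chart around `p`. -/
def scalarCurvature (b : Basis ι ℝ E) (D : Set M) (g : Tensor2 I M) (p : M) : ℝ :=
  scal b (chartDomain I D p) (coordMatrix I b g p) (extChartAt I p p)

end Manifolds

/-! ### The sphere `Σ = S²` -/

/-- The unit sphere in `ℝ³`. -/
abbrev S2 : Type := sphere (0 : EuclideanSpace ℝ (Fin 3)) 1

/-- The model plane for surfaces. -/
abbrev E2 : Type := EuclideanSpace ℝ (Fin 2)

/-- The standard basis of the plane. -/
def b2 : Basis (Fin 2) ℝ E2 := (EuclideanSpace.basisFun (Fin 2) ℝ).toBasis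

/-- The derivative of the inclusion `S² ⊆ ℝ³`. -/
def inclDeriv (x : S2) : TangentSpace (𝓡 2) x →ₗ[ℝ] EuclideanSpace ℝ (Fin 3) :=
  (mfderiv (𝓡 2) 𝓘(ℝ, EuclideanSpace ℝ (Fin 3))
    (Subtype.val : S2 → EuclideanSpace ℝ (Fin 3)) x).toLinearMap

/-- The standard round metric `σ` of the unit sphere, induced from `ℝ³`. -/
def roundMetric : Tensor2 (𝓡 2) S2 := fun x =>
  (innerₗ (EuclideanSpace ℝ (Fin 3))).compl₁₂ (inclDeriv x) (inclDeriv x)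

/-- The scalar curvature function of a metric on `S²`. -/
def scalarS2 (g : Tensor2 (𝓡 2) S2) (x : S2) : ℝ := scalarCurvature (𝓡 2) b2 univ g x

/-- The area measure of a metric `g` on `S²`: its density with respect to the area measure of the
round metric is `√(det g / det σ)`. -/
def areaMeasure (g : Tensor2 (𝓡 2) S2) : Measure S2 :=
  (volume : Measure (EuclideanSpace ℝ (Fin 3))).toSphere.withDensity fun x =>
    ENNReal.ofReal (√((coordMatrix (𝓡 2) b2 g x (extChartAt (𝓡 2) x x)).det /
      (coordMatrix (𝓡 2) b2 roundMetric x (extChartAt (𝓡 2) x x)).det))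

/-- The mean value `r` of the scalar curvature. -/
def meanScalar (g : Tensor2 (𝓡 2) S2) : ℝ := ⨍ x, scalarS2 g x ∂(areaMeasure g)

/-- The components `M_{ij}` of the tensor `M = ((r - R) g + 2 D D f) / 2`, in the chart
around `p`. -/
def flowTensor (g : Tensor2 (𝓡 2) S2) (f : S2 → ℝ) (p : S2) (y : E2) : Matrix (Fin 2) (Fin 2) ℝ :=
  Matrix.of fun i j =>
    ((meanScalar g - scal b2 (chartDomain (𝓡 2) univ p) (coordMatrix (𝓡 2) b2 g p) y) *
        coordMatrix (𝓡 2) b2 g p y i j +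
      2 * hess b2 (chartDomain (𝓡 2) univ p) (coordMatrix (𝓡 2) b2 g p)
        (f ∘ (extChartAt (𝓡 2) p).symm) i j y) / 2

/-- The norm `|M|_g = √(g^{ik} g^{jl} M_{ij} M_{kl})` at the point `x`. -/
def flowTensorNorm (g : Tensor2 (𝓡 2) S2) (f : S2 → ℝ) (x : S2) : ℝ :=
  √(∑ i, ∑ j, ∑ k, ∑ l,
    (coordMatrix (𝓡 2) b2 g x (extChartAt (𝓡 2) x x))⁻¹ i k *
    (coordMatrix (𝓡 2) b2 g x (extChartAt (𝓡 2) x x))⁻¹ j l *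
    flowTensor g f x (extChartAt (𝓡 2) x x) i j * flowTensor g f x (extChartAt (𝓡 2) x x) k l)

/-- Hamilton's modified Ricci flow `∂_t g = (r - R) g + 2 D D f = 2 M`, `Δ f = R - r`, for
`1 ≤ t < ∞`: a family `g t` of Riemannian metrics on `S²`, smooth in `(t, x)`, with Ricci
potential `f t`. -/
structure IsModifiedRicciFlow (g : ℝ → Tensor2 (𝓡 2) S2) (f : ℝ → S2 → ℝ) : Prop where
  symm : ∀ t, 1 ≤ t → ∀ x v w, g t x v w = g t x w v
  pos : ∀ t, 1 ≤ t → ∀ x v, v ≠ 0 → 0 < g t x v v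
  smooth : ∀ p i j, ContDiffOn ℝ ∞
    (fun z : ℝ × E2 => coordMatrix (𝓡 2) b2 (g z.1) p z.2 i j)
    (Ici 1 ×ˢ (extChartAt (𝓡 2) p).target)
  smooth_potential : ∀ t, 1 ≤ t → ContMDiff (𝓡 2) 𝓘(ℝ, ℝ) ∞ (f t)
  potential : ∀ t, 1 ≤ t → ∀ p, ∀ y ∈ (extChartAt (𝓡 2) p).target,
    lap b2 (chartDomain (𝓡 2) univ p) (coordMatrix (𝓡 2) b2 (g t) p)
        (f t ∘ (extChartAt (𝓡 2) p).symm) y =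
      scal b2 (chartDomain (𝓡 2) univ p) (coordMatrix (𝓡 2) b2 (g t) p) y - meanScalar (g t)
  evolution : ∀ t, 1 ≤ t → ∀ p, ∀ y ∈ (extChartAt (𝓡 2) p).target, ∀ i j,
    HasDerivWithinAt (fun s => coordMatrix (𝓡 2) b2 (g s) p y i j)
      (2 * flowTensor (g t) (f t) p y i j) (Ici 1) t

/-! ### The manifold `N = [1, ∞) × S²` -/

/-- The model with corners of `ℝ × S²`. -/
abbrev IN : ModelWithCorners ℝ (ℝ × E2) (ModelProd ℝ E2) := (𝓘(ℝ, ℝ)).prod (𝓡 2)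

/-- `N = [1, ∞) × S²`, as a region (with boundary) in `ℝ × S²`. -/
def N : Set (ℝ × S2) := Ici 1 ×ˢ univ

/-- The basis of `ℝ × ℝ²`: the vector `∂_t` and the standard basis of the plane. -/
def bN : Basis (Unit ⊕ Fin 2) ℝ (ℝ × E2) := (Basis.singleton Unit ℝ).prod b2

/-- The `dt`-component of a tangent vector of `ℝ × S²`. -/
def dt (p : ℝ × S2) : TangentSpace IN p →ₗ[ℝ] ℝ := LinearMap.fst ℝ ℝ E2

/-- The `S²`-component of a tangent vector of `ℝ × S²`. -/
def dx (p : ℝ × S2) : TangentSpace IN p →ₗ[ℝ] TangentSpace (𝓡 2) p.2 := LinearMap.snd ℝ ℝ E2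

/-- The metric `a(t, x) dt² + t² g(t)` on `ℝ × S²`. -/
def foliatedMetric (a : ℝ × S2 → ℝ) (g : ℝ → Tensor2 (𝓡 2) S2) : Tensor2 IN (ℝ × S2) := fun p =>
  a p • (LinearMap.mul ℝ ℝ).compl₁₂ (dt p) (dt p) +
    p.1 ^ 2 • (g p.1 p.2).compl₁₂ (dx p) (dx p)

/-- The mean curvature, in direction `∂_t`, of the slice `{t} × S²` through `p`, for a metric `G`
on `N`. The unit normal is `ν = grad t / |grad t|`, the second fundamental form is
`h_{ij} = -G(∇_{∂_i} ∂_j, ν) = -Γ^t_{ij} / √(G^{tt})`, and the mean curvature is its trace with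
respect to the induced metric. -/
def meanCurvature (G : Tensor2 IN (ℝ × S2)) (p : ℝ × S2) : ℝ :=
  ∑ i : Fin 2, ∑ j : Fin 2,
    (coordMatrix IN bN G p (extChartAt IN p p)).toBlocks₂₂⁻¹ i j *
      (-christoffel bN (chartDomain IN N p) (coordMatrix IN bN G p) (Sum.inl ()) (Sum.inr i)
          (Sum.inr j) (extChartAt IN p p) /
        √((coordMatrix IN bN G p (extChartAt IN p p))⁻¹ (Sum.inl ()) (Sum.inl ())))

/-- `G` is a metric on `N` of the form `u² / (1 + t²) dt² + t² g(t)` with `u` smooth and positive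
and `g(t)` the modified Ricci flow with `g(1) = g₁`, whose scalar curvature is `Rbar` and for which
`{1} × S²` has mean curvature `H` in direction `∂_t`. -/
def IsRicciFlowExtension (g₁ : Tensor2 (𝓡 2) S2) (Rbar : ℝ × S2 → ℝ) (H : S2 → ℝ)
    (G : Tensor2 IN (ℝ × S2)) : Prop :=
  ∃ (g : ℝ → Tensor2 (𝓡 2) S2) (f : ℝ → S2 → ℝ) (u : ℝ × S2 → ℝ),
    IsModifiedRicciFlow g f ∧ g 1 = g₁ ∧
    ContMDiffOn IN 𝓘(ℝ, ℝ) ∞ u N ∧ (∀ p ∈ N, 0 < u p) ∧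
    (∀ p ∈ N, G p = foliatedMetric (fun q => u q ^ 2 / (1 + q.1 ^ 2)) g p) ∧
    (∀ p ∈ N, scalarCurvature IN bN N G p = Rbar p) ∧
    (∀ x, meanCurvature G (1, x) = H x)

/-- The set of numbers
`-∫_1^t (R_{g(s)} - s² Rbar)_* / 4 * exp (∫_1^s τ (|M|^*)² / 2 dτ) ds`, `1 ≤ t`, where `_*` and `^*`
are the infimum and the supremum over `S²`. -/
def KSet (g : ℝ → Tensor2 (𝓡 2) S2) (f : ℝ → S2 → ℝ) (Rbar : ℝ × S2 → ℝ) : Set ℝ :=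
  (fun t : ℝ => -∫ s in (1 : ℝ)..t,
    (⨅ x, (scalarS2 (g s) x - s ^ 2 * Rbar (s, x))) / 4 *
      Real.exp (∫ τ in (1 : ℝ)..s, τ * (⨆ x, flowTensorNorm (g τ) (f τ) x) ^ 2 / 2)) '' Ici 1

/-- The condition `K < ∞`, `H > 2 √(2 K)`, with `K` the supremum of `KSet`, on the boundary
mean curvature `H`. -/
def IsAdmissible (g : ℝ → Tensor2 (𝓡 2) S2) (f : ℝ → S2 → ℝ) (Rbar : ℝ × S2 → ℝ) (H : S2 → ℝ) :
    Prop :=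
  BddAbove (KSet g f Rbar) ∧ ∀ x, 2 * √(2 * sSup (KSet g f Rbar)) < H x

/-! ### Asymptotically hyperbolic metrics on `N`

Hyperbolic space minus a point is `(0, ∞) × S²` with the metric `dr² + sinh² r σ`, and the exterior
of the geodesic sphere `S_{r₀}` is `(r₀, ∞) × S²`. -/

/-- `(f₀, f₁)` is a smooth local orthonormal frame of the round sphere on the open set `U`. -/
structure IsLocalOrthonormalFrame (f : Fin 2 → ∀ x : S2, TangentSpace (𝓡 2) x) (U : Set S2) :
    Prop where
  isOpen : IsOpen U
  smooth : ∀ i, ContMDiffOn (𝓡 2) (𝓡 2).tangent ∞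
    (fun x => (⟨x, f i x⟩ : TangentBundle (𝓡 2) S2)) U
  orthonormal : ∀ x ∈ U, ∀ i j, roundMetric x (f i x) (f j x) = if i = j then 1 else 0

/-- The frame `ε_0 = ∂_r`, `ε_α = f_α / sinh r` of hyperbolic space. -/
def hypFrame (f : Fin 2 → ∀ x : S2, TangentSpace (𝓡 2) x) :
    Unit ⊕ Fin 2 → ∀ q : ℝ × S2, TangentSpace IN q
  | Sum.inl _, _ => ((1, 0) : ℝ × E2)
  | Sum.inr α, q => ((0, (Real.sinh q.1)⁻¹ • f α q.2) : ℝ × E2)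

/-- The derivative of the function `F` in the direction of the vector field `X`. -/
def dirDeriv (X : ∀ q : ℝ × S2, TangentSpace IN q) (F : ℝ × S2 → ℝ) (q : ℝ × S2) : ℝ :=
  mfderiv IN 𝓘(ℝ, ℝ) F q (X q)

/-- The pullback `Φ^* G`. -/
def pullbackTensor (Φ : ℝ × S2 → ℝ × S2) (G : Tensor2 IN (ℝ × S2)) : Tensor2 IN (ℝ × S2) :=
  fun q => (G (Φ q)).compl₁₂ (mfderiv IN IN Φ q).toLinearMap (mfderiv IN IN Φ q).toLinearMap

/-- The metric `G` on `N` is asymptotically hyperbolic: there are `τ > 3/2`, a compact `C ⊆ N`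
and a diffeomorphism `Φ` from the exterior `(r₀, ∞) × S²` of a geodesic sphere of hyperbolic space
to `N ∖ C` such that the components `g_{ij} = G(ε_i, ε_j)` in the orthonormal frames above satisfy
`|g_{ij} - δ_{ij}|, |ε_k(g_{ij})|, |ε_k(ε_l(g_{ij}))| = O(e^{-τ r})` as `r → ∞`, uniformly on
compact subsets of the domain of the frame `f_α`. -/
def IsAsymptoticallyHyperbolic (G : Tensor2 IN (ℝ × S2)) : Prop :=
  ∃ (τ r₀ : ℝ) (C : Set (ℝ × S2)) (Φ : OpenPartialHomeomorph (ℝ × S2) (ℝ × S2)),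
    3 / 2 < τ ∧ 0 < r₀ ∧ IsCompact C ∧ C ⊆ N ∧
    Φ.source = Ioi r₀ ×ˢ univ ∧ Φ.target = N \ C ∧
    ContMDiffOn IN IN ∞ Φ Φ.source ∧ ContMDiffOn IN IN ∞ Φ.symm Φ.target ∧
    ∀ (f : Fin 2 → ∀ x : S2, TangentSpace (𝓡 2) x) (U : Set S2), IsLocalOrthonormalFrame f U →
      ∀ K ⊆ U, IsCompact K → ∃ A r₁ : ℝ, r₀ < r₁ ∧ ∀ r, r₁ ≤ r → ∀ x ∈ K,
        ∀ i j : Unit ⊕ Fin 2,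
          let F : ℝ × S2 → ℝ := fun q => pullbackTensor Φ G q (hypFrame f i q) (hypFrame f j q)
          |F (r, x) - if i = j then 1 else 0| ≤ A * Real.exp (-τ * r) ∧
          (∀ k, |dirDeriv (hypFrame f k) F (r, x)| ≤ A * Real.exp (-τ * r)) ∧
          (∀ k l, |dirDeriv (hypFrame f k) (dirDeriv (hypFrame f l) F) (r, x)| ≤
            A * Real.exp (-τ * r))

/-- The anti-de Sitter Riemannian Schwarzschild metric `(1 + t² - 2m/t)⁻¹ dt² + t² σ` of
mass `m`. -/
def adsSchwarzschild (m : ℝ) : Tensor2 IN (ℝ × S2) :=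
  foliatedMetric (fun p => (1 + p.1 ^ 2 - 2 * m / p.1)⁻¹) (fun _ => roundMetric)

end RicciFoliation

end

/-! The flow starting at the round metric cannot move, so every extension has the form `a dt² + t²
σ`, and the curvature equation then becomes a scalar comparison problem for `a`.

Rigidity of the flow. Since `Δf = R - r`, the velocity `2M` is trace-free. Hence the area form is
preserved, and `r` is the average of `R` against a fixed measure. The curvature satisfies `∂_t R =
ΔR + R (R - r) + ⟨∇R, ∇f⟩` (`hasDerivAt_scal`). The nonlocal term is harmless because `|r - 2| ≤ sup
|R - 2|`. Comparing `±(R - 2)` with `ε exp(L (t - 1))` and letting `ε → 0` gives `R = 2` for all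
times. Then `f` is harmonic, and Bochner's formula at a maximum of `|∇f|²` gives `∇f = 0`. So `M =
0` and `g(t) = σ` (`IsModifiedRicciFlow.eq_roundMetric`).

Consequences. The integrand defining `K` is nonnegative because `R - s² Rbar = 2 + 6 s²`, so `K ≤ 0`
and any positive `H` is admissible. For `a = a(t)` the equation of scalar curvature `-6` reads `(t /
a)' = 1 + 3 t²`. Its solutions are `t / a = t + t³ - const`, and the boundary mean curvature `2 /
√a(1)` fixes the constant as `2m`. This is the Schwarzschild metric. For general `a` the equation
has additional tangential terms, whose sign is known at the extrema of `a(t, ·)`. The maximum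
principle, applied with both signs to `t / a - (t + t³ - 2m)`, gives uniqueness (`mul_sub_nonpos`,
`eq_adsSchwarzschild`).

Asymptotics. With `t = sinh r` the spherical part agrees exactly with that of hyperbolic space. The
radial component is `1 + 2m / (sinh r cosh² r - 2m)`, which together with two derivatives differs
from `1` by `O(e^{-3r})`.

The tensor identities are polynomial identities in the jets of the metric. They are proved in a
commutative algebra of smooth functions with the partial derivatives as commuting derivations, where
the Leibniz rule and `ring` suffice, and are then evaluated at points. -/

noncomputable section

namespace RicciFoliation

/-! ### The algebra of smooth functions on a closed domain -/

section SmoothAlgebra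

variable {E : Type*} [NormedAddCommGroup E] [NormedSpace ℝ E]

/-- A closed domain, with enough interior for the usual calculus of derivatives within it. -/
structure IsRegularDomain (S : Set E) : Prop where
  uniqueDiffOn : UniqueDiffOn ℝ S
  isClosed : IsClosed S
  subset_closure_interior : S ⊆ closure (interior S)

theorem isRegularDomain_univ : IsRegularDomain (univ : Set E) :=
  ⟨uniqueDiffOn_univ, isClosed_univ, by simp⟩

/-- The functions that are smooth on `S`. -/
def smoothOn (S : Set E) : Subalgebra ℝ (E → ℝ) where
  carrier := {F | ContDiffOn ℝ ∞ F S}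
  mul_mem' := fun ha hb => ContDiffOn.mul ha hb
  add_mem' := fun ha hb => ContDiffOn.add ha hb
  algebraMap_mem' := fun _ => contDiffOn_const

/-- The function `F`, as an element of the algebra of functions that are smooth on `S`. -/
def smoothOn.of {S : Set E} (F : E → ℝ) (hF : ContDiffOn ℝ ∞ F S) : smoothOn S := ⟨F, hF⟩

@[simp] theorem smoothOn.coe_of {S : Set E} (F : E → ℝ) (hF : ContDiffOn ℝ ∞ F S) :
    (smoothOn.of F hF : E → ℝ) = F := rfl

theorem contDiffOn_coe {S : Set E} (F : smoothOn S) : ContDiffOn ℝ ∞ (F : E → ℝ) S := F.2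

theorem differentiableWithinAt_coe {S : Set E} (F : smoothOn S) {y : E} (hy : y ∈ S) :
    DifferentiableWithinAt ℝ (F : E → ℝ) S y :=
  (contDiffOn_coe F y hy).differentiableWithinAt (by simp)

variable {ι : Type*} (b : Basis ι ℝ E)

/-- The default value of `fderivWithin` off the closure. It makes `∂_i` a derivation on functions
defined on all of `E`, with no quotient by functions vanishing on `S`. -/
theorem pd_of_notMem {S : Set E} (hS : IsClosed S) {y : E} (hy : y ∉ S) (i : ι) (F : E → ℝ) :
    pd b S i F y = 0 := by
  have : y ∉ closure S := by rwa [hS.closure_eq]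
  rw [pd, fderivWithin_zero_of_notMem_closure this]
  rfl

theorem pd_congr {S : Set E} {F F' : E → ℝ} (h : EqOn F F' S) (i : ι) {y : E} (hy : y ∈ S) :
    pd b S i F y = pd b S i F' y := by
  rw [pd, pd, fderivWithin_congr h (h hy)]

theorem contDiffOn_pd {S : Set E} (hS : IsRegularDomain S) {F : E → ℝ}
    (hF : ContDiffOn ℝ ∞ F S) (i : ι) : ContDiffOn ℝ ∞ (pd b S i F) S := by
  have := hF.fderivWithin (m := ∞) hS.uniqueDiffOn (by simp)
  exact this.clm_apply contDiffOn_const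

theorem pd_add {S : Set E} (hS : IsRegularDomain S) {F G : E → ℝ} {y : E} (hy : y ∈ S)
    (hF : DifferentiableWithinAt ℝ F S y) (hG : DifferentiableWithinAt ℝ G S y) (i : ι) :
    pd b S i (F + G) y = pd b S i F y + pd b S i G y := by
  simp only [pd]
  rw [fderivWithin_add (hS.uniqueDiffOn y hy) hF hG]
  rfl

theorem pd_mul {S : Set E} (hS : IsRegularDomain S) {F G : E → ℝ} {y : E} (hy : y ∈ S)
    (hF : DifferentiableWithinAt ℝ F S y) (hG : DifferentiableWithinAt ℝ G S y) (i : ι) :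
    pd b S i (F * G) y = F y * pd b S i G y + G y * pd b S i F y := by
  simp only [pd]
  rw [fderivWithin_mul (hS.uniqueDiffOn y hy) hF hG]
  simp

theorem pd_const_smul {S : Set E} (hS : IsRegularDomain S) (c : ℝ) {F : E → ℝ} {y : E} (hy : y ∈ S)
    (hF : DifferentiableWithinAt ℝ F S y) (i : ι) :
    pd b S i (c • F) y = c * pd b S i F y := by
  simp only [pd]
  rw [fderivWithin_const_smul (hS.uniqueDiffOn y hy) hF]
  rfl

/-- The partial derivative `∂_i`, as a derivation of the algebra of smooth functions on `S`. -/
def pdDeriv {S : Set E} (hS : IsRegularDomain S) (i : ι) :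
    Derivation ℝ (smoothOn S) (smoothOn S) :=
  Derivation.mk'
    { toFun := fun F => ⟨pd b S i F, contDiffOn_pd b hS F.2 i⟩
      map_add' := fun F G => by
        apply Subtype.ext
        funext y
        by_cases hy : y ∈ S
        · exact pd_add b hS hy (differentiableWithinAt_coe F hy) (differentiableWithinAt_coe G hy) i
        · simp [pd_of_notMem b hS.isClosed hy]
      map_smul' := fun c F => by
        apply Subtype.ext
        funext y
        by_cases hy : y ∈ S
        · exact pd_const_smul b hS c hy (differentiableWithinAt_coe F hy) i
        · simp [pd_of_notMem b hS.isClosed hy] }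
    (fun F G => by
      apply Subtype.ext
      funext y
      by_cases hy : y ∈ S
      · exact pd_mul b hS hy (differentiableWithinAt_coe F hy) (differentiableWithinAt_coe G hy) i
      · simp [pd_of_notMem b hS.isClosed hy])

@[simp] theorem coe_pdDeriv {S : Set E} (hS : IsRegularDomain S) (i : ι) (F : smoothOn S) :
    ((pdDeriv b hS i F : smoothOn S) : E → ℝ) = pd b S i F := rfl

/-- At boundary points the symmetry of the second derivative within `S` comes from interior points
nearby; hence the condition `S ⊆ closure (interior S)`. -/
theorem pdDeriv_comm {S : Set E} (hS : IsRegularDomain S) (i j : ι) (F : smoothOn S) :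
    pdDeriv b hS i (pdDeriv b hS j F) = pdDeriv b hS j (pdDeriv b hS i F) := by
  apply Subtype.ext
  funext y
  by_cases hy : y ∈ S
  · have hd : DifferentiableWithinAt ℝ (fderivWithin ℝ (F : E → ℝ) S) S y :=
      (((contDiffOn_coe F).fderivWithin (m := ∞) hS.uniqueDiffOn (by simp)) y hy).differentiableWithinAt
        (by simp)
    have key : ∀ k l, pd b S k (pd b S l F) y =
        fderivWithin ℝ (fderivWithin ℝ (F : E → ℝ) S) S y (b k) (b l) := by
      intro k l
      change fderivWithin ℝ (fun z => fderivWithin ℝ (F : E → ℝ) S z (b l)) S y (b k) = _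
      rw [fderivWithin_clm_apply (hS.uniqueDiffOn y hy) hd (differentiableWithinAt_const _)]
      simp
    have hs : IsSymmSndFDerivWithinAt ℝ (F : E → ℝ) S y :=
      (contDiffOn_coe F y hy).isSymmSndFDerivWithinAt (by
        rw [minSmoothness_of_isRCLikeNormedField]
        exact WithTop.coe_le_coe.2 (le_top (a := (2 : ℕ∞)))) hS.uniqueDiffOn
        (hS.subset_closure_interior hy) hy
    simp only [coe_pdDeriv, key]
    exact hs (b i) (b j)
  · simp [pd_of_notMem b hS.isClosed hy]

/-- Evaluation at a point. -/
def smoothOn.eval {S : Set E} (y : E) : smoothOn S →ₐ[ℝ] ℝ :=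
  (Pi.evalAlgHom ℝ (fun _ : E => ℝ) y).comp (smoothOn S).val

theorem smoothOn.eval_apply {S : Set E} (y : E) (F : smoothOn S) :
    smoothOn.eval y F = (F : E → ℝ) y := rfl

end SmoothAlgebra

/-! ### Curvature in an algebra with derivations -/

section Algebraic

variable {ι : Type*} [Fintype ι] {A : Type*} [CommRing A] [Algebra ℝ A]
  (D : ι → Derivation ℝ A A) (g gi : ι → ι → A)

/-- The formulas of Riemannian geometry over an arbitrary algebra with derivations. Here `g` and
`gi` are independent families; that they are inverse to each other enters only through later
hypotheses. -/
def algChristoffel (k i j : ι) : A :=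
  (1 / 2 : ℝ) • ∑ l, gi k l * (D i (g j l) + D j (g i l) - D l (g i j))

def algRicci (i j : ι) : A :=
  (∑ k, (D k (algChristoffel D g gi k i j) - D j (algChristoffel D g gi k i k))) +
    ∑ k, ∑ l, (algChristoffel D g gi k k l * algChristoffel D g gi l i j -
      algChristoffel D g gi k j l * algChristoffel D g gi l i k)

def algScal : A := ∑ i, ∑ j, gi i j * algRicci D g gi i j

def algHess (f : A) (i j : ι) : A :=
  D i (D j f) - ∑ k, algChristoffel D g gi k i j * D k f

def algLap (f : A) : A := ∑ i, ∑ j, gi i j * algHess D g gi f i j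

end Algebraic

/-! ### Metrics as matrices over the algebra of smooth functions -/

section Coordinates

variable {E : Type*} [NormedAddCommGroup E] [NormedSpace ℝ E]
variable {ι : Type*} [Fintype ι] [DecidableEq ι] (b : Basis ι ℝ E)

theorem coe_sum_smoothOn {S : Set E} {κ : Type*} (s : Finset κ) (F : κ → smoothOn S) :
    ((∑ k ∈ s, F k : smoothOn S) : E → ℝ) = ∑ k ∈ s, (F k : E → ℝ) :=
  map_sum (smoothOn S).val F s

/-- `g` and `gi` are the entries of the matrix `G` and of its inverse. -/
structure Represents {S : Set E} (G : E → Matrix ι ι ℝ) (g gi : ι → ι → smoothOn S) : Prop where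
  coe_eq : ∀ i j y, (g i j : E → ℝ) y = G y i j
  coe_inv_eq : ∀ i j y, (gi i j : E → ℝ) y = (G y)⁻¹ i j
  isUnit : ∀ y ∈ S, IsUnit (G y).det

/-- Cramer's rule: adjugate and determinant are polynomials in the entries. -/
theorem contDiffOn_inv_entry {S : Set E} {G : E → Matrix ι ι ℝ}
    (hG : ∀ i j, ContDiffOn ℝ ∞ (fun y => G y i j) S) (hu : ∀ y ∈ S, IsUnit (G y).det) (i j : ι) :
    ContDiffOn ℝ ∞ (fun y => (G y)⁻¹ i j) S := by
  have hdet : ∀ (P : E → Matrix ι ι ℝ), (∀ i j, ContDiffOn ℝ ∞ (fun y => P y i j) S) →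
      ContDiffOn ℝ ∞ (fun y => (P y).det) S := by
    intro P hP
    simp only [Matrix.det_apply]
    refine ContDiffOn.sum fun s _ => ?_
    refine ContDiffOn.const_smul _ ?_
    exact contDiffOn_prod fun k _ => hP _ _
  have : ∀ y, (G y)⁻¹ i j = ((G y).det)⁻¹ * (G y).adjugate i j := by
    intro y
    rw [Matrix.inv_def, Matrix.smul_apply, Ring.inverse_eq_inv', smul_eq_mul]
  simp only [this]
  refine ContDiffOn.mul (ContDiffOn.inv (hdet G hG) fun y hy => (hu y hy).ne_zero) ?_
  simp only [Matrix.adjugate_apply]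
  refine hdet _ fun k l => ?_
  by_cases hk : k = j
  · subst hk
    simp only [Matrix.updateRow_self]
    exact contDiffOn_const
  · simp only [Matrix.updateRow_ne hk]
    exact hG k l

theorem exists_represents {S : Set E} {G : E → Matrix ι ι ℝ}
    (hG : ∀ i j, ContDiffOn ℝ ∞ (fun y => G y i j) S) (hu : ∀ y ∈ S, IsUnit (G y).det) :
    ∃ g gi : ι → ι → smoothOn S, Represents G g gi :=
  ⟨fun i j => ⟨_, hG i j⟩, fun i j => ⟨_, contDiffOn_inv_entry hG hu i j⟩,
    fun _ _ _ => rfl, fun _ _ _ => rfl, hu⟩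

variable {S : Set E} (hS : IsRegularDomain S) {G : E → Matrix ι ι ℝ} {g gi : ι → ι → smoothOn S}

theorem Represents.coe_eq' (h : Represents G g gi) (i j : ι) :
    (g i j : E → ℝ) = fun y => G y i j := funext (h.coe_eq i j)

/-- An equality of functions on all of `E`, not only on `S`, so it can be rewritten inside a further
derivative. -/
theorem Represents.coe_christoffel (h : Represents G g gi) (k i j : ι) :
    ((algChristoffel (pdDeriv b hS) g gi k i j : smoothOn S) : E → ℝ) = christoffel b S G k i j := by
  funext y
  simp only [algChristoffel, christoffel]
  change (1 / 2 : ℝ) * ((∑ l, _ : smoothOn S) : E → ℝ) y = _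
  rw [coe_sum_smoothOn, Finset.sum_apply]
  congr 1
  refine Finset.sum_congr rfl fun l _ => ?_
  change (gi k l : E → ℝ) y * (pd b S i (g j l) y + pd b S j (g i l) y - pd b S l (g i j) y) = _
  rw [h.coe_inv_eq, h.coe_eq', h.coe_eq', h.coe_eq']

theorem Represents.coe_ricci (h : Represents G g gi) (i j : ι) :
    ((algRicci (pdDeriv b hS) g gi i j : smoothOn S) : E → ℝ) = ricci b S G i j := by
  funext y
  simp only [algRicci, ricci, Subalgebra.coe_add, Pi.add_apply, coe_sum_smoothOn,
    Finset.sum_apply, Subalgebra.coe_sub, Subalgebra.coe_mul, Pi.sub_apply, Pi.mul_apply,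
    coe_pdDeriv, h.coe_christoffel]

theorem Represents.coe_scal (h : Represents G g gi) :
    ((algScal (pdDeriv b hS) g gi : smoothOn S) : E → ℝ) = scal b S G := by
  funext y
  simp only [algScal, scal, coe_sum_smoothOn, Finset.sum_apply, Subalgebra.coe_mul, Pi.mul_apply,
    h.coe_ricci, h.coe_inv_eq]

theorem Represents.coe_hess (h : Represents G g gi) (f : smoothOn S) (i j : ι) :
    ((algHess (pdDeriv b hS) g gi f i j : smoothOn S) : E → ℝ) = hess b S G f i j := by
  funext y
  simp only [algHess, hess, coe_sum_smoothOn, Finset.sum_apply, Subalgebra.coe_sub, Pi.sub_apply,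
    Subalgebra.coe_mul, Pi.mul_apply, coe_pdDeriv, h.coe_christoffel]

theorem Represents.coe_lap (h : Represents G g gi) (f : smoothOn S) :
    ((algLap (pdDeriv b hS) g gi f : smoothOn S) : E → ℝ) = lap b S G f := by
  funext y
  simp only [algLap, lap, coe_sum_smoothOn, Finset.sum_apply, Subalgebra.coe_mul, Pi.mul_apply,
    h.coe_hess, h.coe_inv_eq]

theorem Represents.sum_inv_mul (h : Represents G g gi) {y : E} (hy : y ∈ S) (i j : ι) :
    ∑ l, (gi i l : E → ℝ) y * (g l j : E → ℝ) y = if i = j then 1 else 0 := by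
  simp only [h.coe_eq, h.coe_inv_eq]
  rw [← Matrix.mul_apply, Matrix.nonsing_inv_mul _ (h.isUnit y hy), Matrix.one_apply]

theorem Represents.sum_mul_inv (h : Represents G g gi) {y : E} (hy : y ∈ S) (i j : ι) :
    ∑ l, (g i l : E → ℝ) y * (gi l j : E → ℝ) y = if i = j then 1 else 0 := by
  simp only [h.coe_eq, h.coe_inv_eq]
  rw [← Matrix.mul_apply, Matrix.mul_nonsing_inv _ (h.isUnit y hy), Matrix.one_apply]

/-- Differentiate `g⁻¹ g = 1` and multiply by `g⁻¹`. The relation `g⁻¹ g = 1` is available only on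
`S`, so the argument is pointwise; off `S` all derivatives vanish. -/
theorem Represents.pdDeriv_inv (h : Represents G g gi) (m k l : ι) :
    pdDeriv b hS m (gi k l) = -∑ p, ∑ q, gi k p * pdDeriv b hS m (g p q) * gi q l := by
  apply Subtype.ext
  funext y
  by_cases hy : y ∈ S
  · have h1 : ∀ p q, ∑ r, (gi p r * pdDeriv b hS m (g r q) + g r q * pdDeriv b hS m (gi p r) :
        smoothOn S).1 y = 0 := by
      intro p q
      have h2 : ∑ r, (gi p r * pdDeriv b hS m (g r q) + g r q * pdDeriv b hS m (gi p r)) =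
          pdDeriv b hS m (∑ r, gi p r * g r q) := by
        rw [map_sum]
        refine Finset.sum_congr rfl fun r _ => ?_
        rw [Derivation.leibniz, smul_eq_mul, smul_eq_mul]
      have h3 := congrArg (fun F : smoothOn S => (F : E → ℝ) y) h2
      simp only [coe_sum_smoothOn, Finset.sum_apply] at h3
      refine h3.trans ?_
      rw [coe_pdDeriv]
      have h4 : EqOn ((∑ r, gi p r * g r q : smoothOn S) : E → ℝ)
          (fun _ => if p = q then 1 else 0) S := by
        intro z hz
        rw [coe_sum_smoothOn, Finset.sum_apply]
        exact h.sum_inv_mul hz p q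
      rw [pd_congr b h4 m hy, pd]
      simp
    have h5 : ∀ q, ∑ r, (g r q : E → ℝ) y * (pdDeriv b hS m (gi k r) : E → ℝ) y =
        -∑ r, (gi k r : E → ℝ) y * (pdDeriv b hS m (g r q) : E → ℝ) y := by
      intro q
      have := h1 k q
      simp only [Subalgebra.coe_add, Subalgebra.coe_mul, Pi.add_apply, Pi.mul_apply,
        Finset.sum_add_distrib] at this
      linarith
    have h6 : (pdDeriv b hS m (gi k l) : E → ℝ) y =
        ∑ q, (∑ r, (g r q : E → ℝ) y * (pdDeriv b hS m (gi k r) : E → ℝ) y) *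
          (gi q l : E → ℝ) y := by
      simp only [Finset.sum_mul]
      rw [Finset.sum_comm]
      have : ∀ r, ∑ q, (g r q : E → ℝ) y * (pdDeriv b hS m (gi k r) : E → ℝ) y *
          (gi q l : E → ℝ) y = (pdDeriv b hS m (gi k r) : E → ℝ) y * if r = l then 1 else 0 := by
        intro r
        rw [← h.sum_mul_inv hy r l, Finset.mul_sum]
        exact Finset.sum_congr rfl fun q _ => by ring
      simp only [this]
      simp
    rw [h6]
    simp only [h5, Subalgebra.coe_neg, Pi.neg_apply, coe_sum_smoothOn, Finset.sum_apply,
      Subalgebra.coe_mul, Pi.mul_apply, neg_mul, Finset.sum_neg_distrib, Finset.sum_mul]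
    rw [Finset.sum_comm]
  · have h0 : ∀ (i : ι) (F : smoothOn S), (pdDeriv b hS i F : E → ℝ) y = 0 :=
      fun i F => pd_of_notMem b hS.isClosed hy i _
    simp only [Subalgebra.coe_neg, Pi.neg_apply, coe_sum_smoothOn, Finset.sum_apply,
      Subalgebra.coe_mul, Pi.mul_apply, h0]
    simp

end Coordinates

/-! ### Identities for surfaces -/

section Surface

/-- The scalar curvature of a surface, as a function of the entries `a, b, c` of the inverse of the
metric and of the derivatives `x, y, z` of `g_{00}, g_{01}, g_{11}`. -/
def scalJet (a b c x0 x1 y0 y1 z0 z1 x11 y01 z00 : ℝ) : ℝ :=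
  2 * (a * c - b ^ 2) * (-(x11 + z00 - 2 * y01) / 2 +
    a * ((x1 / 2) ^ 2 - x0 / 2 * (y1 - z0 / 2)) +
    b * (2 * (x1 / 2) * (z0 / 2) - x0 / 2 * (z1 / 2) - (y0 - x1 / 2) * (y1 - z0 / 2)) +
    c * ((z0 / 2) ^ 2 - (y0 - x1 / 2) * (z1 / 2)))

/-- The derivative of `scalJet` in the direction of the primed arguments. -/
def scalJetDeriv (a b c x0 x1 y0 y1 z0 z1 x11 y01 z00
    a' b' c' x0' x1' y0' y1' z0' z1' x11' y01' z00' : ℝ) : ℝ :=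
  2 * (a' * c + a * c' - 2 * b * b') * (-(x11 + z00 - 2 * y01) / 2 +
    a * ((x1 / 2) ^ 2 - x0 / 2 * (y1 - z0 / 2)) +
    b * (2 * (x1 / 2) * (z0 / 2) - x0 / 2 * (z1 / 2) - (y0 - x1 / 2) * (y1 - z0 / 2)) +
    c * ((z0 / 2) ^ 2 - (y0 - x1 / 2) * (z1 / 2))) +
  2 * (a * c - b ^ 2) * (-(x11' + z00' - 2 * y01') / 2 +
    a' * ((x1 / 2) ^ 2 - x0 / 2 * (y1 - z0 / 2)) +
    b' * (2 * (x1 / 2) * (z0 / 2) - x0 / 2 * (z1 / 2) - (y0 - x1 / 2) * (y1 - z0 / 2)) +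
    c' * ((z0 / 2) ^ 2 - (y0 - x1 / 2) * (z1 / 2)) +
    a * (x1 * x1' / 2 - x0' / 2 * (y1 - z0 / 2) - x0 / 2 * (y1' - z0' / 2)) +
    b * (x1' * z0 / 2 + x1 * z0' / 2 - x0' * z1 / 4 - x0 * z1' / 4 -
      (y0' - x1' / 2) * (y1 - z0 / 2) - (y0 - x1 / 2) * (y1' - z0' / 2)) +
    c * (z0 * z0' / 2 - (y0' - x1' / 2) * (z1 / 2) - (y0 - x1 / 2) * (z1' / 2)))

/-- With `R` a polynomial in twelve jet coordinates, `∂_t R` reduces to the chain rule, once time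
derivatives are interchanged with spatial ones. -/
theorem hasDerivAt_scalJet {a b c x0 x1 y0 y1 z0 z1 x11 y01 z00 : ℝ → ℝ}
    {a' b' c' x0' x1' y0' y1' z0' z1' x11' y01' z00' t : ℝ}
    (ha : HasDerivAt a a' t) (hb : HasDerivAt b b' t) (hc : HasDerivAt c c' t)
    (hx0 : HasDerivAt x0 x0' t) (hx1 : HasDerivAt x1 x1' t)
    (hy0 : HasDerivAt y0 y0' t) (hy1 : HasDerivAt y1 y1' t)
    (hz0 : HasDerivAt z0 z0' t) (hz1 : HasDerivAt z1 z1' t)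
    (hx11 : HasDerivAt x11 x11' t) (hy01 : HasDerivAt y01 y01' t) (hz00 : HasDerivAt z00 z00' t) :
    HasDerivAt (fun s => scalJet (a s) (b s) (c s) (x0 s) (x1 s) (y0 s) (y1 s) (z0 s) (z1 s)
      (x11 s) (y01 s) (z00 s))
      (scalJetDeriv (a t) (b t) (c t) (x0 t) (x1 t) (y0 t) (y1 t) (z0 t) (z1 t)
        (x11 t) (y01 t) (z00 t) a' b' c' x0' x1' y0' y1' z0' z1' x11' y01' z00') t := by
  have h01 := (hy0.sub (hx1.div_const 2))
  have h10 := (hy1.sub (hz0.div_const 2))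
  have hq := (((((hx11.add hz00).sub (hy01.const_mul 2)).neg.div_const 2).add
    (ha.mul (((hx1.div_const 2).pow 2).sub ((hx0.div_const 2).mul h10)))).add
    (hb.mul (((((hx1.div_const 2).const_mul 2).mul (hz0.div_const 2)).sub
      ((hx0.div_const 2).mul (hz1.div_const 2))).sub (h01.mul h10)))).add
    (hc.mul (((hz0.div_const 2).pow 2).sub (h01.mul (hz1.div_const 2))))
  have := (((ha.mul hc).sub (hb.pow 2)).const_mul 2).mul hq
  refine HasDerivAt.congr_deriv (f := fun s => scalJet (a s) (b s) (c s) (x0 s) (x1 s) (y0 s)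
    (y1 s) (z0 s) (z1 s) (x11 s) (y01 s) (z00 s)) this ?_
  simp only [scalJetDeriv, Pi.add_apply, Pi.sub_apply, Pi.mul_apply, Pi.neg_apply, Pi.pow_apply]
  push_cast
  ring

theorem continuousOn_scalJet {X : Type*} [TopologicalSpace X] {s : Set X}
    {a b c x0 x1 y0 y1 z0 z1 x11 y01 z00 : X → ℝ}
    (ha : ContinuousOn a s) (hb : ContinuousOn b s) (hc : ContinuousOn c s)
    (hx0 : ContinuousOn x0 s) (hx1 : ContinuousOn x1 s)
    (hy0 : ContinuousOn y0 s) (hy1 : ContinuousOn y1 s)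
    (hz0 : ContinuousOn z0 s) (hz1 : ContinuousOn z1 s)
    (hx11 : ContinuousOn x11 s) (hy01 : ContinuousOn y01 s) (hz00 : ContinuousOn z00 s) :
    ContinuousOn (fun s => scalJet (a s) (b s) (c s) (x0 s) (x1 s) (y0 s) (y1 s) (z0 s) (z1 s)
      (x11 s) (y01 s) (z00 s)) s := by
  simp only [scalJet]
  fun_prop

variable {A : Type*} [CommRing A] [Algebra ℝ A]

/-- A symmetric metric with its inverse in an algebra with two commuting derivations. -/
structure IsMetricPair (D : Fin 2 → Derivation ℝ A A) (g gi : Fin 2 → Fin 2 → A) : Prop where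
  comm : ∀ F, D 1 (D 0 F) = D 0 (D 1 F)
  symm : g 1 0 = g 0 1
  inv_symm : gi 1 0 = gi 0 1
  deriv_inv : ∀ m k l, D m (gi k l) = -∑ p, ∑ q, gi k p * D m (g p q) * gi q l

variable {D : Fin 2 → Derivation ℝ A A} {g gi : Fin 2 → Fin 2 → A} (ev : A →ₐ[ℝ] ℝ)

/-- The fields of `IsMetricPair` act as rewriting rules that leave no derivative of `gi` and a fixed
order of derivatives. What remains is a polynomial identity, valid without `gi g = 1`. -/
theorem IsMetricPair.eval_scal (h : IsMetricPair D g gi) :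
    ev (algScal D g gi) = scalJet (ev (gi 0 0)) (ev (gi 0 1)) (ev (gi 1 1))
      (ev (D 0 (g 0 0))) (ev (D 1 (g 0 0))) (ev (D 0 (g 0 1))) (ev (D 1 (g 0 1)))
      (ev (D 0 (g 1 1))) (ev (D 1 (g 1 1)))
      (ev (D 1 (D 1 (g 0 0)))) (ev (D 0 (D 1 (g 0 1)))) (ev (D 0 (D 0 (g 1 1)))) := by
  simp only [algScal, algRicci, algChristoffel, Fin.sum_univ_two, map_add, map_sub, map_neg,
    Derivation.leibniz, Derivation.map_smul, map_mul, map_smul, smul_eq_mul, h.deriv_inv, h.symm,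
    h.inv_symm, h.comm, scalJet]
  ring

variable (D g gi)

/-- The divergence `D^i h_{ij}` of a symmetric tensor. -/
def algDiv (h : Fin 2 → Fin 2 → A) (j : Fin 2) : A :=
  ∑ i, ∑ k, gi i k * (D k (h i j) - (∑ l, algChristoffel D g gi l k i * h l j) -
    ∑ l, algChristoffel D g gi l k j * h i l)

/-- The divergence `D^j V_j` of a one-form. -/
def algDivForm (V : Fin 2 → A) : A :=
  ∑ j, ∑ k, gi j k * (D k (V j) - ∑ l, algChristoffel D g gi l j k * V l)

/-- The trace `g^{ij} h_{ij}`. -/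
def algTrace (h : Fin 2 → Fin 2 → A) : A := ∑ i, ∑ j, gi i j * h i j

/-- The inner product `⟨∇F, ∇f⟩`. -/
def algGrad (F f : A) : A := ∑ i, ∑ j, gi i j * (D i F * D j f)

variable {D g gi}

/-- The first variation `div div h - Δ tr h - ⟨Ric, h⟩` of the scalar curvature, with `Ric = (R / 2)
g` on a surface. -/
theorem IsMetricPair.eval_scalJetDeriv (hg : IsMetricPair D g gi) {h : Fin 2 → Fin 2 → A}
    (hh : h 1 0 = h 0 1) :
    scalJetDeriv (ev (gi 0 0)) (ev (gi 0 1)) (ev (gi 1 1))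
      (ev (D 0 (g 0 0))) (ev (D 1 (g 0 0))) (ev (D 0 (g 0 1))) (ev (D 1 (g 0 1)))
      (ev (D 0 (g 1 1))) (ev (D 1 (g 1 1)))
      (ev (D 1 (D 1 (g 0 0)))) (ev (D 0 (D 1 (g 0 1)))) (ev (D 0 (D 0 (g 1 1))))
      (ev (-∑ p, ∑ q, gi 0 p * h p q * gi q 0)) (ev (-∑ p, ∑ q, gi 0 p * h p q * gi q 1))
      (ev (-∑ p, ∑ q, gi 1 p * h p q * gi q 1))
      (ev (D 0 (h 0 0))) (ev (D 1 (h 0 0))) (ev (D 0 (h 0 1))) (ev (D 1 (h 0 1)))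
      (ev (D 0 (h 1 1))) (ev (D 1 (h 1 1)))
      (ev (D 1 (D 1 (h 0 0)))) (ev (D 0 (D 1 (h 0 1)))) (ev (D 0 (D 0 (h 1 1)))) =
    ev (algDivForm D g gi (algDiv D g gi h)) - ev (algLap D g gi (algTrace gi h)) -
      ev (algScal D g gi) * ev (algTrace gi h) / 2 := by
  rw [hg.eval_scal]
  simp only [algDivForm, algDiv, algLap, algHess, algTrace, algChristoffel, Fin.sum_univ_two,
    map_add, map_sub, map_neg,
    Derivation.leibniz, Derivation.map_smul, map_mul, map_smul, smul_eq_mul, hg.deriv_inv, hg.symm,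
    hg.inv_symm, hg.comm, scalJet, scalJetDeriv, hh]
  ring

/-- Commuting covariant derivatives: `div ∇²f = ∇Δf + Ric(∇f)`, with `Ric = (R / 2) g`. -/
theorem IsMetricPair.eval_algDiv_hess (hg : IsMetricPair D g gi) (f : A) (j : Fin 2) :
    ev (algDiv D g gi (algHess D g gi f) j) =
      ev (D j (algLap D g gi f)) + ev (algScal D g gi) * ev (D j f) / 2 := by
  rw [hg.eval_scal]
  fin_cases j <;>
  simp only [algDiv, algLap, algHess, algChristoffel, Fin.sum_univ_two,
    map_add, map_sub, map_neg, Fin.zero_eta, Fin.mk_one,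
    Derivation.leibniz, Derivation.map_smul, map_mul, map_smul, smul_eq_mul, hg.deriv_inv, hg.symm,
    hg.inv_symm, hg.comm, scalJet] <;>
  ring

/-- Bochner's formula, where `2 Ric(∇f, ∇f) = R |∇f|²` on a surface. -/
theorem IsMetricPair.eval_lap_grad (hg : IsMetricPair D g gi) (f : A) :
    ev (algLap D g gi (algGrad D gi f f)) =
      2 * (∑ i, ∑ j, ∑ k, ∑ l, ev (gi i k) * ev (gi j l) * ev (algHess D g gi f i j) *
        ev (algHess D g gi f k l)) + 2 * ev (algGrad D gi f (algLap D g gi f)) +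
      ev (algScal D g gi) * ev (algGrad D gi f f) := by
  rw [hg.eval_scal]
  simp only [algGrad, algLap, algHess, algChristoffel, Fin.sum_univ_two,
    map_add, map_sub, map_neg,
    Derivation.leibniz, Derivation.map_smul, map_mul, map_smul, smul_eq_mul, hg.deriv_inv, hg.symm,
    hg.inv_symm, hg.comm, scalJet]
  ring

theorem IsMetricPair.algDivForm_grad (hg : IsMetricPair D g gi) (R f : A) :
    algDivForm D g gi (fun j => D j R + R * D j f) =
      algLap D g gi R + R * algLap D g gi f + algGrad D gi R f := by
  simp only [algDivForm, algLap, algHess, algGrad, Fin.sum_univ_two, map_add, Derivation.leibniz,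
    smul_eq_mul, hg.comm, hg.inv_symm]
  ring

/-- Lowering the upper index does need `gi g = 1`, assumed only after evaluation. -/
theorem IsMetricPair.eval_christoffel_lower (hg : IsMetricPair D g gi)
    (hδ : ∀ i j, ∑ l, ev (gi i l) * ev (g l j) = if i = j then 1 else 0) (k i j : Fin 2) :
    ∑ l, ev (algChristoffel D g gi l k i) * ev (g l j) =
      (ev (D k (g i j)) + ev (D i (g k j)) - ev (D j (g k i))) / 2 := by
  have h0 := hδ 0 j
  have h1 := hδ 1 j
  simp only [algChristoffel, Fin.sum_univ_two, map_add, map_sub, map_mul, map_smul, smul_eq_mul,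
    hg.inv_symm] at h0 h1 ⊢
  fin_cases j <;> simp [hg.symm] at h0 h1 ⊢ <;>
  linear_combination
    (ev (D k (g i 0)) + ev (D i (g k 0)) - ev (D 0 (g k i))) / 2 * h0 +
    (ev (D k (g i 1)) + ev (D i (g k 1)) - ev (D 1 (g k i))) / 2 * h1

/-- The metric is parallel, so only the derivative of `φ` survives in the divergence of `φ g`. -/
theorem IsMetricPair.eval_algDiv_smul_metric (hg : IsMetricPair D g gi)
    (hδ : ∀ i j, ∑ l, ev (gi i l) * ev (g l j) = if i = j then 1 else 0) (φ : A) (j : Fin 2) :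
    ev (algDiv D g gi (fun i j => φ * g i j) j) = ev (D j φ) := by
  have hs : ∀ i l, g i l = g l i := by
    intro i l
    fin_cases i <;> fin_cases l <;> simp [hg.symm]
  have hsi : ∀ i l, gi i l = gi l i := by
    intro i l
    fin_cases i <;> fin_cases l <;> simp [hg.inv_symm]
  have key : ∀ i k, ev (D k (φ * g i j) - (∑ l, algChristoffel D g gi l k i * (φ * g l j)) -
      ∑ l, algChristoffel D g gi l k j * (φ * g i l)) = ev (g i j) * ev (D k φ) := by
    intro i k
    have h1 := hg.eval_christoffel_lower ev hδ k i j
    have h2 := hg.eval_christoffel_lower ev hδ k j i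
    simp only [hs j i] at h1 h2
    simp only [Derivation.leibniz, smul_eq_mul, map_sub, map_add, map_mul, map_sum]
    have e1 : ∑ l, ev (algChristoffel D g gi l k i) * (ev φ * ev (g l j)) =
        ev φ * ∑ l, ev (algChristoffel D g gi l k i) * ev (g l j) := by
      rw [Finset.mul_sum]
      exact Finset.sum_congr rfl fun l _ => by ring
    have e2 : ∑ l, ev (algChristoffel D g gi l k j) * (ev φ * ev (g i l)) =
        ev φ * ∑ l, ev (algChristoffel D g gi l k j) * ev (g l i) := by
      rw [Finset.mul_sum]
      exact Finset.sum_congr rfl fun l _ => by rw [hs i l]; ring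
    rw [e1, e2, h1, h2, hs i j]
    ring
  simp only [algDiv, map_sum, map_mul ev (gi _ _), key]
  rw [Finset.sum_comm]
  have : ∀ k, ∑ i, ev (gi i k) * (ev (g i j) * ev (D k φ)) =
      (if k = j then 1 else 0) * ev (D k φ) := by
    intro k
    rw [← hδ k j, Finset.sum_mul]
    exact Finset.sum_congr rfl fun i _ => by rw [hsi i k]; ring
  simp [this]

theorem algDiv_sub (h h' : Fin 2 → Fin 2 → A) (j : Fin 2) :
    algDiv D g gi (fun i j => h i j - h' i j) j = algDiv D g gi h j - algDiv D g gi h' j := by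
  simp only [algDiv, Fin.sum_univ_two, map_sub]
  ring

theorem algDiv_two_mul (h : Fin 2 → Fin 2 → A) (j : Fin 2) :
    algDiv D g gi (fun i j => 2 * h i j) j = 2 * algDiv D g gi h j := by
  have h2 : ∀ (k : Fin 2) (F : A), D k (2 * F) = 2 * D k F := by
    intro k F
    rw [two_mul, map_add, two_mul]
  simp only [algDiv, Fin.sum_univ_two, h2]
  ring

theorem IsMetricPair.hess_symm (hg : IsMetricPair D g gi) (f : A) :
    algHess D g gi f 1 0 = algHess D g gi f 0 1 := by
  simp only [algHess, algChristoffel, Fin.sum_univ_two, hg.comm, hg.symm]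
  congr 5 <;> ring

end Surface

/-! ### Surfaces in coordinates -/

section SurfaceCoordinates

theorem Represents.isMetricPair {G : E2 → Matrix (Fin 2) (Fin 2) ℝ}
    {g gi : Fin 2 → Fin 2 → smoothOn (univ : Set E2)} (h : Represents G g gi)
    (hs : ∀ y, (G y).IsSymm) : IsMetricPair (pdDeriv b2 isRegularDomain_univ) g gi where
  comm F := pdDeriv_comm b2 _ 1 0 F
  symm := by
    apply Subtype.ext
    funext y
    rw [h.coe_eq, h.coe_eq]
    exact (hs y).apply 0 1
  inv_symm := by
    apply Subtype.ext
    funext y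
    rw [h.coe_inv_eq, h.coe_inv_eq]
    have : ((G y)⁻¹).IsSymm := by
      rw [Matrix.IsSymm, Matrix.transpose_nonsing_inv, (hs y).eq]
    exact this.apply 0 1
  deriv_inv m k l := h.pdDeriv_inv b2 _ m k l

/-- The formula for the scalar curvature in terms of the inverse matrix and of the derivatives
of the metric. -/
theorem scal_eq_scalJet {G : E2 → Matrix (Fin 2) (Fin 2) ℝ}
    (hG : ∀ i j, ContDiff ℝ ∞ (fun y => G y i j)) (hs : ∀ y, (G y).IsSymm)
    (hu : ∀ y, IsUnit (G y).det) (y : E2) :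
    scal b2 univ G y = scalJet ((G y)⁻¹ 0 0) ((G y)⁻¹ 0 1) ((G y)⁻¹ 1 1)
      (pd b2 univ 0 (fun z => G z 0 0) y) (pd b2 univ 1 (fun z => G z 0 0) y)
      (pd b2 univ 0 (fun z => G z 0 1) y) (pd b2 univ 1 (fun z => G z 0 1) y)
      (pd b2 univ 0 (fun z => G z 1 1) y) (pd b2 univ 1 (fun z => G z 1 1) y)
      (pd b2 univ 1 (pd b2 univ 1 (fun z => G z 0 0)) y)
      (pd b2 univ 0 (pd b2 univ 1 (fun z => G z 0 1)) y)
      (pd b2 univ 0 (pd b2 univ 0 (fun z => G z 1 1)) y) := by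
  obtain ⟨g, gi, h⟩ := exists_represents (S := univ) (fun i j => (hG i j).contDiffOn)
    (fun y _ => hu y)
  have := (h.isMetricPair hs).eval_scal (smoothOn.eval y)
  simp only [smoothOn.eval_apply, h.coe_scal, coe_pdDeriv, h.coe_eq', h.coe_inv_eq] at this
  exact this

theorem contDiff_pd_univ {F : E2 → ℝ} (hF : ContDiff ℝ ∞ F) (i : Fin 2) :
    ContDiff ℝ ∞ (pd b2 univ i F) :=
  contDiffOn_univ.1 (contDiffOn_pd b2 isRegularDomain_univ hF.contDiffOn i)

theorem contDiff_scal {G : E2 → Matrix (Fin 2) (Fin 2) ℝ}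
    (hG : ∀ i j, ContDiff ℝ ∞ (fun y => G y i j))
    (hu : ∀ y, IsUnit (G y).det) : ContDiff ℝ ∞ (scal b2 univ G) := by
  obtain ⟨g, gi, h⟩ := exists_represents (S := univ) (fun i j => (hG i j).contDiffOn)
    (fun y _ => hu y)
  rw [← h.coe_scal b2 isRegularDomain_univ, ← contDiffOn_univ]
  exact contDiffOn_coe _

/-- Derivatives in time of spatial derivatives. -/
theorem hasDerivAt_pd {Q : ℝ → E2 → ℝ} {T : Set ℝ} (hT : IsOpen T)
    (hQ : ContDiffOn ℝ ∞ (fun z : ℝ × E2 => Q z.1 z.2) (T ×ˢ univ)) {t : ℝ} (ht : t ∈ T)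
    {h : E2 → ℝ} (hh : ∀ y, HasDerivAt (fun s => Q s y) (h y) t) (k : Fin 2) (y : E2) :
    HasDerivAt (fun s => pd b2 univ k (Q s) y) (pd b2 univ k h y) t := by
  set q : ℝ × E2 → ℝ := fun z => Q z.1 z.2 with hq
  have hO : IsOpen (T ×ˢ (univ : Set E2)) := hT.prod isOpen_univ
  have hd : ∀ s ∈ T, ∀ z, ContDiffAt ℝ ∞ q (s, z) := fun s hs z =>
    hQ.contDiffAt (hO.mem_nhds ⟨hs, mem_univ _⟩)
  have hx : ∀ s ∈ T, ∀ z, pd b2 univ k (Q s) z = fderiv ℝ q (s, z) (0, b2 k) := by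
    intro s hs z
    have h1 : HasFDerivAt (Q s) ((fderiv ℝ q (s, z)).comp (ContinuousLinearMap.inr ℝ ℝ E2)) z :=
      ((hd s hs z).differentiableAt (by simp)).hasFDerivAt.comp z (hasFDerivAt_prodMk_right s z)
    rw [pd, fderivWithin_univ, h1.fderiv]
    simp
  have ht' : ∀ z, h z = fderiv ℝ q (t, z) (1, 0) := by
    intro z
    have h1 : HasFDerivAt (fun s => Q s z)
        ((fderiv ℝ q (t, z)).comp (ContinuousLinearMap.inl ℝ ℝ E2)) t :=
      HasFDerivAt.comp (f := fun s => (s, z)) t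
        ((hd t ht z).differentiableAt (by simp)).hasFDerivAt (hasFDerivAt_prodMk_left t z)
    have h2 := h1.hasDerivAt.unique (hh z)
    simpa using h2.symm
  have hdd : DifferentiableAt ℝ (fderiv ℝ q) (t, y) :=
    ((hd t ht y).fderiv_right (m := ∞) (by simp)).differentiableAt (by simp)
  -- Both iterated derivatives are values of the second derivative of `q` on the vectors `∂_t` and
  -- `∂_k`, so its symmetry interchanges them.
  have hsymm : IsSymmSndFDerivAt ℝ q (t, y) := (hd t ht y).isSymmSndFDerivAt
    (by rw [minSmoothness_of_isRCLikeNormedField]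
        exact WithTop.coe_le_coe.2 (le_top (a := (2 : ℕ∞))))
  have h1 : HasFDerivAt (fun s => fderiv ℝ q (s, y))
      ((fderiv ℝ (fderiv ℝ q) (t, y)).comp (ContinuousLinearMap.inl ℝ ℝ E2)) t :=
    HasFDerivAt.comp (f := fun s => (s, y)) t hdd.hasFDerivAt (hasFDerivAt_prodMk_left t y)
  have h2 : HasFDerivAt (fun z => fderiv ℝ q (t, z))
      ((fderiv ℝ (fderiv ℝ q) (t, y)).comp (ContinuousLinearMap.inr ℝ ℝ E2)) y :=
    HasFDerivAt.comp (f := fun z => (t, z)) y hdd.hasFDerivAt (hasFDerivAt_prodMk_right t y)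
  have h3 := (h1.clm_apply (hasFDerivAt_const ((0, b2 k) : ℝ × E2) t)).hasDerivAt
  have h4 := h2.clm_apply (hasFDerivAt_const ((1, 0) : ℝ × E2) y)
  have h5 : pd b2 univ k h y = fderiv ℝ (fderiv ℝ q) (t, y) (0, b2 k) (1, 0) := by
    rw [pd, fderivWithin_univ, funext ht', h4.fderiv]
    simp
  rw [h5, ← hsymm.eq]
  refine (h3.congr_of_eventuallyEq ?_).congr_deriv (by simp)
  filter_upwards [hT.mem_nhds ht] with s hs
  exact hx s hs y

/-- Stated for sets of times with unique derivatives rather than open ones, so that it reaches the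
initial time of `[1, ∞)`. -/
theorem contDiffOn_pd_param {Q : ℝ → E2 → ℝ} {T : Set ℝ} (hT : UniqueDiffOn ℝ T)
    (hQ : ContDiffOn ℝ ∞ (fun z : ℝ × E2 => Q z.1 z.2) (T ×ˢ univ)) (k : Fin 2) :
    ContDiffOn ℝ ∞ (fun z : ℝ × E2 => pd b2 univ k (Q z.1) z.2) (T ×ˢ univ) := by
  have hO : UniqueDiffOn ℝ (T ×ˢ (univ : Set E2)) := hT.prod uniqueDiffOn_univ
  have h1 : ContDiffOn ℝ ∞
      (fun z => fderivWithin ℝ (fun z : ℝ × E2 => Q z.1 z.2) (T ×ˢ univ) z (0, b2 k))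
      (T ×ˢ univ) :=
    (hQ.fderivWithin hO (m := ∞) (by simp)).clm_apply contDiffOn_const
  refine h1.congr fun z hz => ?_
  have h2 : HasFDerivWithinAt (Q z.1)
      ((fderivWithin ℝ (fun z : ℝ × E2 => Q z.1 z.2) (T ×ˢ univ) z).comp
        (ContinuousLinearMap.inr ℝ ℝ E2)) univ z.2 :=
    HasFDerivWithinAt.comp (f := fun y => (z.1, y)) z.2
      ((hQ z hz).differentiableWithinAt (by simp)).hasFDerivWithinAt
      (hasFDerivAt_prodMk_right z.1 z.2).hasFDerivWithinAt fun y _ => ⟨hz.1, mem_univ y⟩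
  rw [pd, h2.fderivWithin uniqueDiffWithinAt_univ]
  simp

theorem inv_fin_two_apply (P : Matrix (Fin 2) (Fin 2) ℝ) :
    P⁻¹ 0 0 = P 1 1 / P.det ∧ P⁻¹ 0 1 = -P 0 1 / P.det ∧ P⁻¹ 1 0 = -P 1 0 / P.det ∧
      P⁻¹ 1 1 = P 0 0 / P.det := by
  rw [Matrix.inv_def, Matrix.adjugate_fin_two, Ring.inverse_eq_inv']
  refine ⟨?_, ?_, ?_, ?_⟩ <;> simp <;> ring

theorem hasDerivAt_inv_entry {P : ℝ → Matrix (Fin 2) (Fin 2) ℝ} {h : Fin 2 → Fin 2 → ℝ} {t : ℝ}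
    (hP : ∀ i j, HasDerivAt (fun s => P s i j) (h i j) t) (hu : (P t).det ≠ 0) (i j : Fin 2) :
    HasDerivAt (fun s => (P s)⁻¹ i j)
      (-∑ p, ∑ q, (P t)⁻¹ i p * h p q * (P t)⁻¹ q j) t := by
  have hdet : HasDerivAt (fun s => (P s).det)
      (h 0 0 * P t 1 1 + P t 0 0 * h 1 1 - (h 0 1 * P t 1 0 + P t 0 1 * h 1 0)) t := by
    simp only [Matrix.det_fin_two]
    exact ((hP 0 0).mul (hP 1 1)).sub ((hP 0 1).mul (hP 1 0))
  obtain ⟨e00, e01, e10, e11⟩ := inv_fin_two_apply (P t)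
  have hu' := hu
  rw [Matrix.det_fin_two] at hu'
  fin_cases i <;> fin_cases j <;>
    simp only [Fin.zero_eta, Fin.mk_one, Fin.sum_univ_two, e00, e01, e10, e11]
  · simp only [(inv_fin_two_apply (P _)).1]
    refine ((hP 1 1).div hdet hu).congr_deriv ?_
    rw [Matrix.det_fin_two]
    field_simp
    ring
  · simp only [(inv_fin_two_apply (P _)).2.1]
    refine ((hP 0 1).neg.div hdet hu).congr_deriv ?_
    rw [Matrix.det_fin_two, Pi.neg_apply]
    field_simp
    ring
  · simp only [(inv_fin_two_apply (P _)).2.2.1]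
    refine ((hP 1 0).neg.div hdet hu).congr_deriv ?_
    rw [Matrix.det_fin_two, Pi.neg_apply]
    field_simp
    ring
  · simp only [(inv_fin_two_apply (P _)).2.2.2]
    refine ((hP 0 0).div hdet hu).congr_deriv ?_
    rw [Matrix.det_fin_two]
    field_simp
    ring

/-- The evolution equation `∂_t R = Δ R + R (R - r) + ⟨∇R, ∇f⟩` of the scalar curvature under the
modified Ricci flow. -/
theorem hasDerivAt_scal {Q : ℝ → E2 → Matrix (Fin 2) (Fin 2) ℝ} {T : Set ℝ} (hT : IsOpen T)
    (hQ : ∀ i j, ContDiffOn ℝ ∞ (fun z : ℝ × E2 => Q z.1 z.2 i j) (T ×ˢ univ))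
    (hs : ∀ t ∈ T, ∀ y, (Q t y).IsSymm) (hu : ∀ t ∈ T, ∀ y, IsUnit (Q t y).det)
    {t : ℝ} (ht : t ∈ T) {f : E2 → ℝ} (hf : ContDiff ℝ ∞ f) (r : ℝ)
    (hpot : ∀ y, lap b2 univ (Q t) f y = scal b2 univ (Q t) y - r)
    (hev : ∀ y i j, HasDerivAt (fun s => Q s y i j)
      ((r - scal b2 univ (Q t) y) * Q t y i j + 2 * hess b2 univ (Q t) f i j y) t) (y : E2) :
    HasDerivAt (fun s => scal b2 univ (Q s) y)
      (lap b2 univ (Q t) (scal b2 univ (Q t)) y +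
        scal b2 univ (Q t) y * (scal b2 univ (Q t) y - r) +
        ∑ i, ∑ j, (Q t y)⁻¹ i j * (pd b2 univ i (scal b2 univ (Q t)) y * pd b2 univ j f y)) t := by
  have hQs : ∀ s ∈ T, ∀ i j, ContDiff ℝ ∞ (fun y => Q s y i j) := fun s hs i j => by
    rw [← contDiffOn_univ]
    exact (hQ i j).comp (contDiff_prodMk_right s).contDiffOn fun y _ => ⟨hs, mem_univ y⟩
  obtain ⟨g, gi, hr⟩ := exists_represents (S := univ) (fun i j => (hQs t ht i j).contDiffOn)
    (fun y _ => hu t ht y)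
  have hm := hr.isMetricPair (hs t ht)
  set D := pdDeriv b2 (isRegularDomain_univ (E := E2)) with hD
  set φ : smoothOn (univ : Set E2) := smoothOn.of f hf.contDiffOn with hφ
  have hlap : algLap D g gi φ = algScal D g gi - algebraMap ℝ _ r := by
    apply Subtype.ext
    funext z
    rw [hr.coe_lap, Subalgebra.coe_sub, Pi.sub_apply, hr.coe_scal]
    exact hpot z
  have hDlap : ∀ j, D j (algLap D g gi φ) = D j (algScal D g gi) := by
    intro j
    rw [hlap, map_sub, Derivation.map_algebraMap, sub_zero]
  have hδ : ∀ z i j, ∑ l, smoothOn.eval z (gi i l) * smoothOn.eval z (g l j) =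
      if i = j then 1 else 0 := fun z i j => hr.sum_inv_mul (mem_univ z) i j
  -- The velocity of the flow with `r - R` replaced by `-Δf`, which makes it visibly trace-free.
  set h : Fin 2 → Fin 2 → smoothOn (univ : Set E2) :=
    fun i j => 2 * algHess D g gi φ i j - algLap D g gi φ * g i j with hh
  have hcoe : ∀ i j z, (h i j : E2 → ℝ) z =
      (r - scal b2 univ (Q t) z) * Q t z i j + 2 * hess b2 univ (Q t) f i j z := by
    intro i j z
    have : (h i j : E2 → ℝ) z = 2 * (algHess D g gi φ i j : smoothOn (univ : Set E2)).1 z -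
      (algLap D g gi φ : smoothOn (univ : Set E2)).1 z * (g i j : E2 → ℝ) z := rfl
    rw [this, hr.coe_hess, hr.coe_lap, hr.coe_eq]
    change 2 * hess b2 univ (Q t) f i j z - lap b2 univ (Q t) f z * _ = _
    rw [hpot]
    ring
  have hhs : h 1 0 = h 0 1 := by
    simp only [hh, hm.hess_symm, hm.symm]
  have htr : algTrace gi h = 0 := by
    have : algTrace gi h = 2 * algLap D g gi φ -
        algLap D g gi φ * ∑ i, ∑ l, gi i l * g l i := by
      simp only [algTrace, algLap, hh, Fin.sum_univ_two, hm.symm]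
      ring
    rw [this]
    apply Subtype.ext
    funext z
    have h1 : ((∑ i, ∑ l, gi i l * g l i : smoothOn (univ : Set E2)) : E2 → ℝ) z = 2 := by
      have := hδ z 0 0
      have h3 := hδ z 1 1
      simp only [coe_sum_smoothOn, Finset.sum_apply, Subalgebra.coe_mul, Pi.mul_apply,
        smoothOn.eval_apply, if_true] at this h3 ⊢
      rw [Fin.sum_univ_two, this, h3]
      norm_num
    change 2 * (algLap D g gi φ : smoothOn (univ : Set E2)).1 z -
      (algLap D g gi φ : smoothOn (univ : Set E2)).1 z * _ = 0
    rw [h1]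
    ring
  -- As `∇Δf = ∇R`, the two parts of `h` contribute `2 ∇R + R ∇f` and `-∇R`.
  have hdiv : algDiv D g gi h = fun j => D j (algScal D g gi) + algScal D g gi * D j φ := by
    funext j
    apply Subtype.ext
    funext z
    rw [hh, algDiv_sub, algDiv_two_mul]
    have h1 := hm.eval_algDiv_hess (smoothOn.eval z) φ j
    have h2 := hm.eval_algDiv_smul_metric (smoothOn.eval z) (hδ z) (algLap D g gi φ) j
    rw [hDlap] at h1 h2
    change smoothOn.eval z (2 * _ - _) = smoothOn.eval z (_ + _ * _)
    rw [map_sub, map_mul, map_add, map_mul, map_ofNat, h1, h2]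
    ring
  have hjet := hm.eval_scalJetDeriv (smoothOn.eval y) hhs
  rw [hdiv, hm.algDivForm_grad, htr] at hjet
  have hzero : algLap D g gi 0 = 0 := by
    simp [algLap, algHess]
  rw [hzero] at hjet
  simp only [map_zero, sub_zero, mul_zero, zero_div] at hjet
  have hres : smoothOn.eval y (algLap D g gi (algScal D g gi) +
      algScal D g gi * algLap D g gi φ + algGrad D gi (algScal D g gi) φ) =
      lap b2 univ (Q t) (scal b2 univ (Q t)) y +
        scal b2 univ (Q t) y * (scal b2 univ (Q t) y - r) +
        ∑ i, ∑ j, (Q t y)⁻¹ i j *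
          (pd b2 univ i (scal b2 univ (Q t)) y * pd b2 univ j f y) := by
    simp only [map_add, map_mul, smoothOn.eval_apply, hr.coe_lap, hr.coe_scal, algGrad, map_sum,
      coe_pdDeriv, hD, hr.coe_inv_eq]
    change _ + _ * lap b2 univ (Q t) f y + _ = _
    rw [hpot]
    rfl
  rw [← hres, ← hjet]
  have hev' : ∀ i j z, HasDerivAt (fun s => Q s z i j) ((h i j : E2 → ℝ) z) t := by
    intro i j z
    rw [hcoe]
    exact hev z i j
  have hd1 : ∀ i j k z, HasDerivAt (fun s => pd b2 univ k (fun w => Q s w i j) z)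
      (pd b2 univ k (h i j) z) t := fun i j k z =>
    hasDerivAt_pd (Q := fun s w => Q s w i j) hT (hQ i j) ht (hev' i j) k z
  have hd2 : ∀ i j k l z, HasDerivAt
      (fun s => pd b2 univ l (pd b2 univ k (fun w => Q s w i j)) z)
      (pd b2 univ l (pd b2 univ k (h i j)) z) t := fun i j k l z =>
    hasDerivAt_pd (Q := fun s => pd b2 univ k (fun w => Q s w i j)) hT
      (contDiffOn_pd_param (Q := fun s w => Q s w i j) hT.uniqueDiffOn (hQ i j) k) ht (hd1 i j k) l z
  have hi : ∀ i j, HasDerivAt (fun s => (Q s y)⁻¹ i j)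
      (smoothOn.eval y (-∑ p, ∑ q, gi i p * h p q * gi q j)) t := by
    intro i j
    refine (hasDerivAt_inv_entry (fun i j => hev' i j y) (hu t ht y).ne_zero i j).congr_deriv ?_
    simp only [map_neg, map_sum, map_mul, smoothOn.eval_apply, hr.coe_inv_eq]
  have := hasDerivAt_scalJet (hi 0 0) (hi 0 1) (hi 1 1) (hd1 0 0 0 y) (hd1 0 0 1 y) (hd1 0 1 0 y)
    (hd1 0 1 1 y) (hd1 1 1 0 y) (hd1 1 1 1 y) (hd2 0 0 1 1 y) (hd2 0 1 1 0 y) (hd2 1 1 0 0 y)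
  simp only [smoothOn.eval_apply, coe_pdDeriv, hD, hr.coe_inv_eq, hr.coe_eq'] at this ⊢
  refine this.congr_of_eventuallyEq ?_
  filter_upwards [hT.mem_nhds ht] with s hsT
  exact scal_eq_scalJet (hQs s hsT) (hs s hsT) (hu s hsT) y

end SurfaceCoordinates

/-! ### Stereographic charts of the sphere -/

section SphereCharts

/-- The chart around `p` is the stereographic projection from `-p`, which is onto the plane. Hence
all derivatives within chart domains of the sphere are ordinary ones. -/
theorem target_extChartAt_S2 (p : S2) : (extChartAt (𝓡 2) p).target = univ := by
  have := Fact.mk (@finrank_euclideanSpace_fin ℝ _ (2 + 1))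
  have h : chartAt E2 p = stereographic' 2 (-p) := rfl
  simp [h]

theorem chartDomain_univ_S2 (p : S2) : chartDomain (𝓡 2) univ p = univ := by
  rw [chartDomain, target_extChartAt_S2, preimage_univ, inter_univ]

/-- The inverse of the chart around `p`. -/
def param (p : S2) : E2 → S2 := (extChartAt (𝓡 2) p).symm

/-- The inverse stereographic projection. The identification of the plane with the orthogonal
complement of `p` depends on a chosen basis, but only the fact that `L` is isometric with range
orthogonal to `v` matters. -/
theorem exists_param_eq (p : S2) : ∃ (L : E2 →ₗᵢ[ℝ] EuclideanSpace ℝ (Fin 3))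
    (v : EuclideanSpace ℝ (Fin 3)), v = -p ∧ ‖v‖ = 1 ∧ (∀ y, inner ℝ (L y) v = 0) ∧
    ∀ y, (param p y : EuclideanSpace ℝ (Fin 3)) =
      (‖y‖ ^ 2 + 4)⁻¹ • (4 : ℝ) • L y + (‖y‖ ^ 2 + 4)⁻¹ • (‖y‖ ^ 2 - 4) • v := by
  have := Fact.mk (@finrank_euclideanSpace_fin ℝ _ (2 + 1))
  let U := (OrthonormalBasis.fromOrthogonalSpanSingleton (𝕜 := ℝ) 2
    (ne_zero_of_mem_unit_sphere (-p))).repr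
  refine ⟨(ℝ ∙ ((-p : S2) : EuclideanSpace ℝ (Fin 3)))ᗮ.subtypeₗᵢ.comp U.symm.toLinearIsometry,
    ((-p : S2) : EuclideanSpace ℝ (Fin 3)), rfl, norm_eq_of_mem_sphere (-p), ?_, ?_⟩
  · intro y
    exact Submodule.mem_orthogonal_singleton_iff_inner_left.mp (U.symm y).2
  · intro y
    have h := stereographic'_symm_apply (-p) y
    have hn : ‖((U.symm y : (ℝ ∙ ((-p : S2) : EuclideanSpace ℝ (Fin 3)))ᗮ) :
      EuclideanSpace ℝ (Fin 3))‖ = ‖y‖ := by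
      rw [← Submodule.coe_norm, LinearIsometryEquiv.norm_map]
    have h2 : (param p y : EuclideanSpace ℝ (Fin 3)) = ((stereographic' 2 (-p)).symm y :) := by
      simp only [param, mfld_simps]
      rfl
    rw [h2, h]
    simp only [U] at hn
    simp only [hn]
    rfl

theorem param_extChartAt (p : S2) {x : S2} (hx : x ∈ (extChartAt (𝓡 2) p).source) :
    param p (extChartAt (𝓡 2) p x) = x := (extChartAt (𝓡 2) p).left_inv hx

theorem extChartAt_S2_self (p : S2) : extChartAt (𝓡 2) p p = 0 := by
  obtain ⟨L, v, hvp, hv, hL, h⟩ := exists_param_eq p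
  have h1 : param p (extChartAt (𝓡 2) p p) = p := extChartAt_to_inv p
  set y := extChartAt (𝓡 2) p p
  have h2 := h y
  rw [h1] at h2
  have h3 : inner ℝ (p : EuclideanSpace ℝ (Fin 3)) v = -1 := by
    rw [hvp, inner_neg_right, real_inner_self_eq_norm_sq]
    have := norm_eq_of_mem_sphere p
    rw [this]
    norm_num
  rw [h2] at h3
  simp only [inner_add_left, inner_smul_left, hL, real_inner_self_eq_norm_sq, hv] at h3
  simp only [conj_trivial] at h3
  have h4 : (0 : ℝ) < ‖y‖ ^ 2 + 4 := by positivity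
  field_simp at h3
  -- The component along `v = -p` gives `(‖y‖² - 4) / (‖y‖² + 4) = -1`.
  have h5 : ‖y‖ = 0 := by nlinarith [norm_nonneg y]
  simpa using h5

theorem param_zero (p : S2) : param p 0 = p := by
  rw [← extChartAt_S2_self p]
  exact extChartAt_to_inv p

theorem contMDiff_param (p : S2) : ContMDiff 𝓘(ℝ, E2) (𝓡 2) ∞ (param p) := by
  have := contMDiffOn_extChartAt_symm (I := 𝓡 2) (n := ∞) p
  rwa [target_extChartAt_S2, contMDiffOn_univ] at this

theorem contMDiffAt_extChartAt_S2 (p : S2) {x : S2} (hx : x ∈ (extChartAt (𝓡 2) p).source) :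
    ContMDiffAt (𝓡 2) 𝓘(ℝ, E2) ∞ (extChartAt (𝓡 2) p) x :=
  contMDiffAt_extChartAt' (by rwa [extChartAt_source] at hx)

/-- The coordinate vector field `∂_i` of the chart around `p`, as a vector of the model plane. -/
def coordVecE (p : S2) (y : E2) (i : Fin 2) : E2 := coordVec (𝓡 2) b2 p y i

/-- The derivative of the inverse of the chart around `p`, as a map of the model plane. -/
def dparam (p : S2) (y : E2) : E2 →L[ℝ] E2 := mfderiv 𝓘(ℝ, E2) (𝓡 2) (param p) y

theorem coordVecE_eq (p : S2) (y : E2) (i : Fin 2) : coordVecE p y i = dparam p y (b2 i) := by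
  simp only [coordVecE, coordVec, dparam, param, modelWithCornersSelf_coe, range_id,
    mfderivWithin_univ]
  rfl

/-- A tensor field on the sphere, as a function with values in the bilinear forms on the model
plane. -/
def formE (g : Tensor2 (𝓡 2) S2) (x : S2) : LinearMap.BilinForm ℝ E2 := g x

theorem coordMatrix_S2 (g : Tensor2 (𝓡 2) S2) (p : S2) (y : E2) (i j : Fin 2) :
    coordMatrix (𝓡 2) b2 g p y i j = formE g (param p y) (coordVecE p y i) (coordVecE p y j) :=
  rfl

/-- The change of coordinates from the chart around `p` to the chart around `q`. -/
def transition (p q : S2) : E2 → E2 := extChartAt (𝓡 2) q ∘ param p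

/-- The domain of the change of coordinates from the chart around `p` to the chart around `q`. -/
def transitionDomain (p q : S2) : Set E2 := param p ⁻¹' (extChartAt (𝓡 2) q).source

theorem isOpen_transitionDomain (p q : S2) : IsOpen (transitionDomain p q) :=
  (isOpen_extChartAt_source q).preimage (contMDiff_param p).continuous

theorem contDiffAt_transition (p q : S2) {y : E2} (hy : y ∈ transitionDomain p q) :
    ContDiffAt ℝ ∞ (transition p q) y := by
  rw [← contMDiffAt_iff_contDiffAt]
  exact (contMDiffAt_extChartAt_S2 q hy).comp y (contMDiff_param p).contMDiffAt

theorem param_transition (p q : S2) {y : E2} (hy : y ∈ transitionDomain p q) :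
    param q (transition p q y) = param p y := param_extChartAt q hy

/-- The Jacobian matrix `∂ φ_k / ∂ y_i` of a map of the plane. -/
def jac (φ : E2 → E2) (k i : Fin 2) (y : E2) : ℝ := pd b2 univ i (fun z => φ z k) y

theorem fderiv_b2_eq {φ : E2 → E2} {y : E2} (h : DifferentiableAt ℝ φ y) (i : Fin 2) :
    fderiv ℝ φ y (b2 i) = ∑ k, jac φ k i y • b2 k := by
  have h1 : ∀ k, jac φ k i y = fderiv ℝ φ y (b2 i) k := by
    intro k
    have : HasFDerivAt (fun z => φ z k)
        ((EuclideanSpace.proj k : E2 →L[ℝ] ℝ).comp (fderiv ℝ φ y)) y :=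
      (EuclideanSpace.proj k : E2 →L[ℝ] ℝ).hasFDerivAt.comp y h.hasFDerivAt
    rw [jac, pd, fderivWithin_univ, this.fderiv]
    rfl
  simp only [h1]
  have := (b2.sum_repr (fderiv ℝ φ y (b2 i))).symm
  simpa [b2] using this

theorem coordVecE_transition (p q : S2) {y : E2} (hy : y ∈ transitionDomain p q) (i : Fin 2) :
    coordVecE p y i =
      ∑ k, jac (transition p q) k i y • coordVecE q (transition p q y) k := by
  have h1 : param p =ᶠ[𝓝 y] param q ∘ transition p q := by
    filter_upwards [(isOpen_transitionDomain p q).mem_nhds hy] with z hz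
    exact (param_transition p q hz).symm
  have hd := (contDiffAt_transition p q hy).differentiableAt (by simp)
  have h2 : HasMFDerivAt 𝓘(ℝ, E2) (𝓡 2) (param q ∘ transition p q) y
      ((dparam q (transition p q y)).comp (fderiv ℝ (transition p q) y)) :=
    HasMFDerivAt.comp y
      (((contMDiff_param q).mdifferentiableAt (by simp)).hasMFDerivAt) hd.hasFDerivAt.hasMFDerivAt
  have h3 : dparam p y = (dparam q (transition p q y)).comp (fderiv ℝ (transition p q) y) :=
    (h2.congr_of_eventuallyEq h1).mfderiv
  rw [coordVecE_eq, h3, ContinuousLinearMap.comp_apply, fderiv_b2_eq hd, map_sum]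
  refine Finset.sum_congr rfl fun k _ => ?_
  rw [coordVecE_eq, map_smul]

theorem coordMatrix_transition (g : Tensor2 (𝓡 2) S2) (p q : S2) {y : E2}
    (hy : y ∈ transitionDomain p q) (i j : Fin 2) :
    coordMatrix (𝓡 2) b2 g p y i j = ∑ k, ∑ l, jac (transition p q) k i y *
      jac (transition p q) l j y * coordMatrix (𝓡 2) b2 g q (transition p q y) k l := by
  simp only [coordMatrix_S2, param_transition p q hy, coordVecE_transition p q hy,
    Fin.sum_univ_two, map_add, map_smul, LinearMap.add_apply, LinearMap.smul_apply, smul_eq_mul]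
  ring

theorem linearIndependent_coordVecE (p : S2) (y : E2) : LinearIndependent ℝ (coordVecE p y) := by
  have h := isInvertible_mfderivWithin_extChartAt_symm (I := 𝓡 2) (x := p) (y := y)
    (by rw [target_extChartAt_S2]; trivial)
  obtain ⟨e, he⟩ := h
  let e' : E2 ≃L[ℝ] E2 := e
  have : coordVecE p y = fun i => e' (b2 i) := by
    funext i
    simp only [coordVecE, coordVec, ← he]
    rfl
  rw [this]
  exact b2.linearIndependent.map' (e' : E2 →ₗ[ℝ] E2) (LinearMap.ker_eq_bot.2 e'.injective)

theorem formE_ext {B B' : LinearMap.BilinForm ℝ E2} (p : S2) (y : E2)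
    (h : ∀ i j, B (coordVecE p y i) (coordVecE p y j) =
      B' (coordVecE p y i) (coordVecE p y j)) : B = B' := by
  have hc : Fintype.card (Fin 2) = finrank ℝ E2 := by simp
  let c := basisOfLinearIndependentOfCardEqFinrank (linearIndependent_coordVecE p y) hc
  refine LinearMap.BilinForm.ext_basis c fun i j => ?_
  simpa [c] using h i j

end SphereCharts

/-! ### The round metric in stereographic coordinates -/

section RoundMetric

theorem contMDiff_coe_S2 : ContMDiff (𝓡 2) 𝓘(ℝ, EuclideanSpace ℝ (Fin 3)) ∞
    (Subtype.val : S2 → EuclideanSpace ℝ (Fin 3)) := by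
  have := Fact.mk (@finrank_euclideanSpace_fin ℝ _ (2 + 1))
  exact contMDiff_coe_sphere

theorem coordMatrix_roundMetric (p : S2) (y : E2) (i j : Fin 2) :
    coordMatrix (𝓡 2) b2 roundMetric p y i j =
      if i = j then 16 * ((‖y‖ ^ 2 + 4)⁻¹) ^ 2 else 0 := by
  obtain ⟨L, v, hvp, hv, hL, h⟩ := exists_param_eq p
  have hc : HasFDerivAt (fun y : E2 => (‖y‖ ^ 2 + 4)⁻¹)
      (-((‖y‖ ^ 2 + 4) ^ 2)⁻¹ • (2 • innerSL ℝ y)) y := by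
    have h1 : HasFDerivAt (fun y : E2 => ‖y‖ ^ 2 + 4) (2 • innerSL ℝ y) y :=
      ((hasStrictFDerivAt_norm_sq y).hasFDerivAt).add_const 4
    exact (hasDerivAt_inv (by positivity)).comp_hasFDerivAt y h1
  set c := (‖y‖ ^ 2 + 4)⁻¹ with hcdef
  -- The coefficient of `v` is rewritten as `1 - 8c`, so that `c` is the only nonlinear function to
  -- differentiate.
  have hX : ∀ w, (param p w : EuclideanSpace ℝ (Fin 3)) =
      (‖w‖ ^ 2 + 4)⁻¹ • (4 : ℝ) • L w + (1 - 8 * (‖w‖ ^ 2 + 4)⁻¹) • v := by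
    intro w
    rw [h w, smul_smul (‖w‖ ^ 2 + 4)⁻¹ (‖w‖ ^ 2 - 4)]
    have : (0 : ℝ) < ‖w‖ ^ 2 + 4 := by positivity
    congr 2
    field_simp
    ring
  have hd : ∀ e : E2, fderiv ℝ (fun w => (param p w : EuclideanSpace ℝ (Fin 3))) y e =
      (-2 * inner ℝ y e * c ^ 2) • (4 : ℝ) • L y + c • (4 : ℝ) • L e +
        (16 * inner ℝ y e * c ^ 2) • v := by
    intro e
    have h1 := (hc.smul (L.toContinuousLinearMap.hasFDerivAt (x := y).const_smul (4 : ℝ))).add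
      (((hc.const_mul 8).const_sub 1).smul_const v)
    rw [funext hX]
    refine (congrArg (fun T => T e) h1.fderiv).trans ?_
    simp [hcdef]
    module
  have hi : ∀ k, inclDeriv (param p y) (coordVecE p y k) =
      fderiv ℝ (fun w => (param p w : EuclideanSpace ℝ (Fin 3))) y (b2 k) := by
    intro k
    have h1 : HasMFDerivAt 𝓘(ℝ, E2) 𝓘(ℝ, EuclideanSpace ℝ (Fin 3))
        ((Subtype.val : S2 → EuclideanSpace ℝ (Fin 3)) ∘ param p) y
        ((mfderiv (𝓡 2) 𝓘(ℝ, EuclideanSpace ℝ (Fin 3))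
          (Subtype.val : S2 → EuclideanSpace ℝ (Fin 3)) (param p y)).comp (dparam p y)) :=
      HasMFDerivAt.comp y
        ((contMDiff_coe_S2.mdifferentiableAt (by simp)).hasMFDerivAt)
        (((contMDiff_param p).mdifferentiableAt (by simp)).hasMFDerivAt)
    have h2 := h1.mfderiv
    rw [mfderiv_eq_fderiv] at h2
    rw [coordVecE_eq]
    exact (congrArg (fun T => T (b2 k)) h2).symm
  have e1 : coordMatrix (𝓡 2) b2 roundMetric p y i j =
      inner ℝ (inclDeriv (param p y) (coordVecE p y i))
        (inclDeriv (param p y) (coordVecE p y j)) := rfl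
  have hb : inner ℝ (b2 i) (b2 j) = if i = j then (1 : ℝ) else 0 := by
    have := orthonormal_iff_ite.1 (EuclideanSpace.basisFun (Fin 2) ℝ).orthonormal i j
    simpa [b2] using this
  rw [e1, hi, hi, hd, hd]
  have hvL : ∀ y, inner ℝ v (L y) = 0 := fun y => by rw [real_inner_comm, hL]
  simp only [inner_add_left, inner_add_right, inner_smul_left, inner_smul_right, hL, hvL,
    LinearIsometry.inner_map_map, real_inner_self_eq_norm_sq, hv, hb, conj_trivial,
    real_inner_comm y (b2 _)]
  -- This relation cancels all terms containing `⟨y, e_i⟩ ⟨y, e_j⟩`, so the metric is conformal to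
  -- the flat one.
  have hc4 : c * ‖y‖ ^ 2 = 1 - 4 * c := by
    rw [hcdef]
    have : (0 : ℝ) < ‖y‖ ^ 2 + 4 := by positivity
    field_simp
    ring
  split_ifs
  · linear_combination 64 * inner ℝ y (b2 i) * inner ℝ y (b2 j) * c ^ 3 * hc4
  · linear_combination 64 * inner ℝ y (b2 i) * inner ℝ y (b2 j) * c ^ 3 * hc4

end RoundMetric

/-! ### Change of coordinates for the Laplacian -/

section ChangeOfCoordinates

theorem pd_comp {F : E2 → ℝ} {φ : E2 → E2} {y : E2} (hF : DifferentiableAt ℝ F (φ y))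
    (hφ : DifferentiableAt ℝ φ y) (i : Fin 2) :
    pd b2 univ i (F ∘ φ) y = ∑ k, jac φ k i y * pd b2 univ k F (φ y) := by
  rw [pd, fderivWithin_univ, fderiv_comp y hF hφ, ContinuousLinearMap.comp_apply,
    fderiv_b2_eq hφ, map_sum]
  refine Finset.sum_congr rfl fun k _ => ?_
  rw [map_smul, smul_eq_mul, pd, fderivWithin_univ]

theorem pd_mul_univ {F G : E2 → ℝ} {y : E2} (hF : DifferentiableAt ℝ F y)
    (hG : DifferentiableAt ℝ G y) (i : Fin 2) :
    pd b2 univ i (fun z => F z * G z) y = F y * pd b2 univ i G y + G y * pd b2 univ i F y :=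
  pd_mul b2 isRegularDomain_univ (mem_univ y) hF.differentiableWithinAt hG.differentiableWithinAt i

theorem pd_sum_univ {κ : Type*} (s : Finset κ) {F : κ → E2 → ℝ} {y : E2}
    (hF : ∀ k ∈ s, DifferentiableAt ℝ (F k) y) (i : Fin 2) :
    pd b2 univ i (fun z => ∑ k ∈ s, F k z) y = ∑ k ∈ s, pd b2 univ i (F k) y := by
  rw [pd, fderivWithin_univ, fderiv_fun_sum hF]
  simp [pd, fderivWithin_univ]

theorem pd_congr_eventually {F G : E2 → ℝ} {y : E2} (h : F =ᶠ[𝓝 y] G) (i : Fin 2) :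
    pd b2 univ i F y = pd b2 univ i G y := by
  rw [pd, pd, fderivWithin_univ, fderivWithin_univ, h.fderiv_eq]

theorem pd_pd_comm {F : E2 → ℝ} {y : E2} (hF : ContDiffAt ℝ ∞ F y) (i j : Fin 2) :
    pd b2 univ i (pd b2 univ j F) y = pd b2 univ j (pd b2 univ i F) y := by
  have hd : DifferentiableAt ℝ (fderiv ℝ F) y :=
    (hF.fderiv_right (m := ∞) (by simp)).differentiableAt (by simp)
  have key : ∀ k l, pd b2 univ k (pd b2 univ l F) y = fderiv ℝ (fderiv ℝ F) y (b2 k) (b2 l) := by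
    intro k l
    have e : pd b2 univ l F = fun z => fderiv ℝ F z (b2 l) := by
      funext z
      rw [pd, fderivWithin_univ]
    rw [e, pd, fderivWithin_univ, fderiv_clm_apply hd (differentiableAt_const _)]
    simp
  have hs : IsSymmSndFDerivAt ℝ F y := hF.isSymmSndFDerivAt
    (by rw [minSmoothness_of_isRCLikeNormedField]
        exact WithTop.coe_le_coe.2 (le_top (a := (2 : ℕ∞))))
  rw [key, key]
  exact hs (b2 i) (b2 j)

theorem contDiffAt_pd {F : E2 → ℝ} {y : E2} (hF : ContDiffAt ℝ ∞ F y) (i : Fin 2) :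
    ContDiffAt ℝ ∞ (pd b2 univ i F) y := by
  have : ContDiffAt ℝ ∞ (fun z => fderiv ℝ F z (b2 i)) y :=
    (hF.fderiv_right (m := ∞) (by simp)).clm_apply contDiffAt_const
  refine this.congr_of_eventuallyEq (Filter.Eventually.of_forall fun z => ?_)
  rw [pd, fderivWithin_univ]

theorem contDiffAt_jac {φ : E2 → E2} {y : E2} (hφ : ContDiffAt ℝ ∞ φ y) (k i : Fin 2) :
    ContDiffAt ℝ ∞ (jac φ k i) y :=
  contDiffAt_pd ((EuclideanSpace.proj k : E2 →L[ℝ] ℝ).contDiff.contDiffAt.comp y hφ) i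

/-- The metric `G'` is the pullback of `G` under the smooth map `φ` near `y`. -/
structure IsPullbackAt (φ : E2 → E2) (G G' : E2 → Matrix (Fin 2) (Fin 2) ℝ) (y : E2) :
    Prop where
  contDiffAt : ContDiffAt ℝ ∞ φ y
  eventually_eq : ∀ᶠ z in 𝓝 y, ∀ i j,
    G' z i j = ∑ k, ∑ l, jac φ k i z * jac φ l j z * G (φ z) k l

variable {φ : E2 → E2} {G G' : E2 → Matrix (Fin 2) (Fin 2) ℝ} {y : E2}

/-- Invert `G' = Jᵀ G J`. Invertibility of the Jacobian follows from that of `G'`. -/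
theorem IsPullbackAt.inv_eq (h : IsPullbackAt φ G G' y) (hu' : IsUnit (G' y).det) (a b : Fin 2) :
    ∑ k, ∑ l, jac φ a k y * (G' y)⁻¹ k l * jac φ b l y = (G (φ y))⁻¹ a b := by
  let J : Matrix (Fin 2) (Fin 2) ℝ := Matrix.of fun k i => jac φ k i y
  have h1 : G' y = J.transpose * G (φ y) * J := by
    ext i j
    rw [h.eventually_eq.self_of_nhds]
    simp only [Matrix.mul_apply, Fin.sum_univ_two, J, Matrix.transpose_apply, Matrix.of_apply]
    ring
  have hJ : IsUnit J.det := by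
    rw [h1, Matrix.det_mul] at hu'
    exact isUnit_of_mul_isUnit_right hu'
  have h2 : J * (G' y)⁻¹ * J.transpose = (G (φ y))⁻¹ := by
    rw [h1, Matrix.mul_inv_rev, Matrix.mul_inv_rev]
    rw [← Matrix.mul_assoc, Matrix.mul_nonsing_inv _ hJ, Matrix.one_mul, Matrix.mul_assoc,
      Matrix.nonsing_inv_mul _ (by rwa [Matrix.det_transpose]), Matrix.mul_one]
  rw [← h2]
  simp only [Matrix.mul_apply, Fin.sum_univ_two, J, Matrix.transpose_apply, Matrix.of_apply]
  ring

theorem IsPullbackAt.pd_eq (h : IsPullbackAt φ G G' y)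
    (hG : ∀ i j, ContDiff ℝ ∞ (fun y => G y i j)) (m i j : Fin 2) :
    pd b2 univ m (fun z => G' z i j) y = ∑ k, ∑ l,
      ((pd b2 univ m (jac φ k i) y * jac φ l j y + jac φ k i y * pd b2 univ m (jac φ l j) y) *
        G (φ y) k l + jac φ k i y * jac φ l j y *
          ∑ n, jac φ n m y * pd b2 univ n (fun z => G z k l) (φ y)) := by
  have hφ := h.contDiffAt.differentiableAt (by simp)
  have hJ : ∀ k i, DifferentiableAt ℝ (jac φ k i) y := fun k i =>
    (contDiffAt_jac h.contDiffAt k i).differentiableAt (by simp)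
  have hGd : ∀ k l, DifferentiableAt ℝ (fun z => G z k l) (φ y) := fun k l =>
    (hG k l).contDiffAt.differentiableAt (by simp)
  have hGc : ∀ k l, DifferentiableAt ℝ (fun z => G (φ z) k l) y := fun k l => (hGd k l).comp y hφ
  have e : (fun z => G' z i j) =ᶠ[𝓝 y]
      fun z => ∑ k, ∑ l, jac φ k i z * jac φ l j z * G (φ z) k l := by
    filter_upwards [h.eventually_eq] with z hz using hz i j
  have hJJ : ∀ k l, DifferentiableAt ℝ (fun z => jac φ k i z * jac φ l j z) y :=
    fun k l => (hJ k i).mul (hJ l j)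
  rw [pd_congr_eventually e, pd_sum_univ]
  · refine Finset.sum_congr rfl fun k _ => ?_
    rw [pd_sum_univ]
    · refine Finset.sum_congr rfl fun l _ => ?_
      rw [pd_mul_univ (hJJ k l) (hGc k l), pd_mul_univ (hJ k i) (hJ l j)]
      have := pd_comp (hGd k l) hφ m
      change pd b2 univ m (fun z => G (φ z) k l) y = _ at this
      rw [this]
      ring
    · exact fun l _ => (hJJ k l).mul (hGc k l)
  · exact fun k _ => DifferentiableAt.fun_sum fun l _ => (hJJ k l).mul (hGc k l)

theorem pd_jac_symm (hφ : ContDiffAt ℝ ∞ φ y) (k i j : Fin 2) :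
    pd b2 univ i (jac φ k j) y = pd b2 univ j (jac φ k i) y :=
  pd_pd_comm ((EuclideanSpace.proj k : E2 →L[ℝ] ℝ).contDiff.contDiffAt.comp y hφ) i j

/-- The transformation law of the Christoffel symbols. -/
theorem IsPullbackAt.christoffel_eq (h : IsPullbackAt φ G G' y)
    (hG : ∀ i j, ContDiff ℝ ∞ (fun y => G y i j)) (hs : ∀ z, (G z).IsSymm)
    (hu : IsUnit (G (φ y)).det) (hu' : IsUnit (G' y).det) (e i j : Fin 2) :
    ∑ k, jac φ e k y * christoffel b2 univ G' k i j y =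
      (∑ a, ∑ b, christoffel b2 univ G e a b (φ y) * jac φ a i y * jac φ b j y) +
        pd b2 univ i (jac φ e j) y := by
  -- Of the six terms with second derivatives of `φ`, four cancel by symmetry and two combine into
  -- the factor `2`.
  have hB : ∀ l, pd b2 univ i (fun z => G' z j l) y + pd b2 univ j (fun z => G' z i l) y -
      pd b2 univ l (fun z => G' z i j) y =
      ∑ c, jac φ c l y * ((∑ a, ∑ b, jac φ a i y * jac φ b j y *
        (pd b2 univ a (fun z => G z b c) (φ y) + pd b2 univ b (fun z => G z a c) (φ y) -
          pd b2 univ c (fun z => G z a b) (φ y))) +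
        2 * ∑ d, G (φ y) c d * pd b2 univ i (jac φ d j) y) := by
    intro l
    have hGs : G (φ y) 1 0 = G (φ y) 0 1 := (hs (φ y)).apply 0 1
    have hGs' : (fun z => G z 1 0) = fun z => G z 0 1 := funext fun z => (hs z).apply 0 1
    simp only [h.pd_eq hG, Fin.sum_univ_two, hGs, hGs', pd_jac_symm h.contDiffAt _ j i,
      pd_jac_symm h.contDiffAt _ l i, pd_jac_symm h.contDiffAt _ l j]
    ring
  have hK := h.inv_eq hu'
  have hI : ∀ d, ∑ c, (G (φ y))⁻¹ e c * G (φ y) c d = if e = d then 1 else 0 := by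
    intro d
    rw [← Matrix.mul_apply, Matrix.nonsing_inv_mul _ hu, Matrix.one_apply]
  have hKe : ∀ c, (G (φ y))⁻¹ e c = ∑ k, ∑ l, jac φ e k y * (G' y)⁻¹ k l * jac φ c l y :=
    fun c => (hK e c).symm
  have h1 : ∑ k, jac φ e k y * christoffel b2 univ G' k i j y =
      1 / 2 * ∑ c, (∑ k, ∑ l, jac φ e k y * (G' y)⁻¹ k l * jac φ c l y) *
        ((∑ a, ∑ b, jac φ a i y * jac φ b j y *
        (pd b2 univ a (fun z => G z b c) (φ y) + pd b2 univ b (fun z => G z a c) (φ y) -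
          pd b2 univ c (fun z => G z a b) (φ y))) +
        2 * ∑ d, G (φ y) c d * pd b2 univ i (jac φ d j) y) := by
    simp only [christoffel, hB, Fin.sum_univ_two]
    ring
  rw [h1]
  simp only [hK]
  have h2 : 1 / 2 * ∑ c, (G (φ y))⁻¹ e c * (2 * ∑ d, G (φ y) c d * pd b2 univ i (jac φ d j) y) =
      pd b2 univ i (jac φ e j) y := by
    have : 1 / 2 * ∑ c, (G (φ y))⁻¹ e c *
        (2 * ∑ d, G (φ y) c d * pd b2 univ i (jac φ d j) y) =
        ∑ d, (∑ c, (G (φ y))⁻¹ e c * G (φ y) c d) * pd b2 univ i (jac φ d j) y := by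
      simp only [Fin.sum_univ_two]
      ring
    rw [this]
    simp [hI]
  rw [← h2]
  simp only [christoffel, Fin.sum_univ_two]
  ring

/-- The Laplacian does not depend on the coordinates. -/
theorem IsPullbackAt.lap_eq (h : IsPullbackAt φ G G' y)
    (hG : ∀ i j, ContDiff ℝ ∞ (fun y => G y i j)) (hs : ∀ z, (G z).IsSymm)
    (hu : IsUnit (G (φ y)).det) (hu' : IsUnit (G' y).det)
    {f f' : E2 → ℝ} (hf : ContDiff ℝ ∞ f) (hff : f' =ᶠ[𝓝 y] f ∘ φ) :
    lap b2 univ G' f' y = lap b2 univ G f (φ y) := by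
  have hφ := h.contDiffAt.differentiableAt (by simp)
  have hJ : ∀ k i, DifferentiableAt ℝ (jac φ k i) y := fun k i =>
    (contDiffAt_jac h.contDiffAt k i).differentiableAt (by simp)
  have hfd : ∀ k, DifferentiableAt ℝ (pd b2 univ k f) (φ y) := fun k =>
    (contDiff_pd_univ hf k).contDiffAt.differentiableAt (by simp)
  have hφe : ∀ᶠ z in 𝓝 y, DifferentiableAt ℝ φ z := by
    have h1 : ContDiffAt ℝ 1 φ y := h.contDiffAt.of_le (by simp)
    filter_upwards [h1.eventually (by simp)] with z hz using hz.differentiableAt (by simp)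
  have h1 : ∀ j, pd b2 univ j f' =ᶠ[𝓝 y] fun z => ∑ k, jac φ k j z * pd b2 univ k f (φ z) := by
    intro j
    filter_upwards [hff.eventuallyEq_nhds, hφe] with z hz hz'
    rw [pd_congr_eventually hz, pd_comp (hf.contDiffAt.differentiableAt (by simp)) hz']
  have h2 : ∀ i j, pd b2 univ i (pd b2 univ j f') y = ∑ k,
      (jac φ k j y * (∑ l, jac φ l i y * pd b2 univ l (pd b2 univ k f) (φ y)) +
        pd b2 univ k f (φ y) * pd b2 univ i (jac φ k j) y) := by
    intro i j
    rw [pd_congr_eventually (h1 j), pd_sum_univ]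
    · refine Finset.sum_congr rfl fun k _ => ?_
      have hc : DifferentiableAt ℝ (fun z => pd b2 univ k f (φ z)) y := (hfd k).comp y hφ
      have := pd_comp (hfd k) hφ i
      change pd b2 univ i (fun z => pd b2 univ k f (φ z)) y = _ at this
      rw [pd_mul_univ (hJ k j) hc, this]
    · exact fun k _ => (hJ k j).mul ((hfd k).comp y hφ)
  -- The Hessian is a tensor: the second derivatives of `φ` produced by the chain rule cancel those
  -- in the law for the Christoffel symbols.
  have h3 : ∀ i j, hess b2 univ G' f' i j y =
      ∑ a, ∑ b, jac φ a i y * jac φ b j y * hess b2 univ G f a b (φ y) := by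
    intro i j
    have c0 := h.christoffel_eq hG hs hu hu' 0 i j
    have c1 := h.christoffel_eq hG hs hu hu' 1 i j
    rw [hess, h2]
    simp only [(h1 _).self_of_nhds, hess, Fin.sum_univ_two] at c0 c1 ⊢
    linear_combination (-pd b2 univ 0 f (φ y)) * c0 - pd b2 univ 1 f (φ y) * c1
  simp only [lap, h3, ← h.inv_eq hu', Fin.sum_univ_two]
  ring

/-- The square of the length of the gradient does not depend on the coordinates. -/
theorem IsPullbackAt.grad_eq (h : IsPullbackAt φ G G' y) (hu' : IsUnit (G' y).det)
    {f f' : E2 → ℝ} (hf : ContDiff ℝ ∞ f) (hff : f' =ᶠ[𝓝 y] f ∘ φ) :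
    ∑ i, ∑ j, (G' y)⁻¹ i j * (pd b2 univ i f' y * pd b2 univ j f' y) =
      ∑ i, ∑ j, (G (φ y))⁻¹ i j * (pd b2 univ i f (φ y) * pd b2 univ j f (φ y)) := by
  have h1 : ∀ j, pd b2 univ j f' y = ∑ k, jac φ k j y * pd b2 univ k f (φ y) := by
    intro j
    rw [pd_congr_eventually hff, pd_comp (hf.contDiffAt.differentiableAt (by simp))
      (h.contDiffAt.differentiableAt (by simp))]
  simp only [h1, ← h.inv_eq hu', Fin.sum_univ_two]
  ring

end ChangeOfCoordinates

/-! ### Maximum principles -/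

section MaximumPrinciple

/-- A positive second derivative at the critical point would make it a local minimum too. The
function would then be locally constant, with second derivative zero. -/
theorem deriv_deriv_nonpos_of_isLocalMax {F : ℝ → ℝ} {x : ℝ} (h : IsLocalMax F x)
    (hc : ContinuousAt F x) : deriv (deriv F) x ≤ 0 := by
  by_contra! hpos
  have h1 := isLocalMin_of_deriv_deriv_pos hpos h.deriv_eq_zero hc
  have h2 : F =ᶠ[𝓝 x] fun _ => F x := by
    filter_upwards [h, h1] with z hz hz' using le_antisymm hz hz'
  have h3 : deriv F =ᶠ[𝓝 x] fun _ => 0 := by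
    filter_upwards [h2.eventuallyEq_nhds] with z hz
    rw [hz.deriv_eq, deriv_const]
  rw [h3.deriv_eq, deriv_const] at hpos
  exact lt_irrefl _ hpos

theorem pd_eq_zero_of_isLocalMax {F : E2 → ℝ} {y : E2} (h : IsLocalMax F y) (i : Fin 2) :
    pd b2 univ i F y = 0 := by
  rw [pd, fderivWithin_univ, h.fderiv_eq_zero]
  rfl

theorem hessian_nonpos_of_isLocalMax {F : E2 → ℝ} {y : E2} (hF : ContDiff ℝ ∞ F)
    (h : IsLocalMax F y) (v : Fin 2 → ℝ) :
    ∑ i, ∑ j, v i * v j * pd b2 univ i (pd b2 univ j F) y ≤ 0 := by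
  set w : E2 := ∑ i, v i • b2 i with hw
  set ℓ : ℝ → E2 := fun s => y + s • w with hℓ
  have hℓd : ∀ s, HasDerivAt ℓ w s := fun s => by
    exact (((hasDerivAt_id s).smul_const w).const_add y).congr_deriv (one_smul ℝ w)
  have hℓ0 : ℓ 0 = y := by simp [hℓ]
  have hcomp : ∀ F' : E2 → ℝ, ContDiff ℝ ∞ F' → deriv (F' ∘ ℓ) =
      (fun z => ∑ i, v i * pd b2 univ i F' z) ∘ ℓ := by
    intro F' hF'
    funext s
    have := (hF'.contDiffAt.differentiableAt (by simp) :
      DifferentiableAt ℝ F' (ℓ s)).hasFDerivAt.comp_hasDerivAt s (hℓd s)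
    rw [this.deriv, hw, map_sum]
    simp [pd, fderivWithin_univ]
  have h1 : IsLocalMax (F ∘ ℓ) 0 := by
    have hcont : ContinuousAt ℓ 0 := (hℓd 0).continuousAt
    have : Filter.Tendsto ℓ (𝓝 0) (𝓝 y) := by
      have := hcont.tendsto
      rwa [hℓ0] at this
    have h2 := this.eventually h
    filter_upwards [h2] with s hs
    simpa [hℓ0] using hs
  have h2 := deriv_deriv_nonpos_of_isLocalMax h1
    (hF.continuous.continuousAt.comp (hℓd 0).continuousAt)
  have hF1 : ContDiff ℝ ∞ (fun z => ∑ i, v i * pd b2 univ i F z) :=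
    ContDiff.sum fun i _ => contDiff_const.mul (contDiff_pd_univ hF i)
  rw [hcomp F hF, hcomp _ hF1] at h2
  simp only [Function.comp_apply, hℓ0] at h2
  refine le_of_eq_of_le ?_ h2
  refine Finset.sum_congr rfl fun i _ => ?_
  rw [pd_sum_univ, Finset.mul_sum]
  · refine Finset.sum_congr rfl fun j _ => ?_
    rw [pd_mul_univ (differentiableAt_const _)
      ((contDiff_pd_univ hF j).contDiffAt.differentiableAt (by simp))]
    simp [pd]
    ring
  · exact fun j _ => (differentiableAt_const _).mul
      ((contDiff_pd_univ hF j).contDiffAt.differentiableAt (by simp))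

/-- The conditions for a matrix function to be a Riemannian metric on the plane. -/
structure IsMetric (G : E2 → Matrix (Fin 2) (Fin 2) ℝ) : Prop where
  smooth : ∀ i j, ContDiff ℝ ∞ (fun y => G y i j)
  symm : ∀ y, (G y).IsSymm
  pos : ∀ y, 0 < G y 0 0
  det_pos : ∀ y, 0 < (G y).det

variable {G : E2 → Matrix (Fin 2) (Fin 2) ℝ}

theorem IsMetric.isUnit (h : IsMetric G) (y : E2) : IsUnit (G y).det := (h.det_pos y).ne'.isUnit

theorem IsMetric.inv_symm (h : IsMetric G) (y : E2) : (G y)⁻¹ 1 0 = (G y)⁻¹ 0 1 := by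
  obtain ⟨-, h01, h10, -⟩ := inv_fin_two_apply (G y)
  rw [h01, h10, (h.symm y).apply 0 1]

theorem IsMetric.inv_pos (h : IsMetric G) (y : E2) : 0 < (G y)⁻¹ 1 1 := by
  rw [(inv_fin_two_apply (G y)).2.2.2]
  exact div_pos (h.pos y) (h.det_pos y)

theorem IsMetric.inv_det_pos (h : IsMetric G) (y : E2) :
    0 < (G y)⁻¹ 0 0 * (G y)⁻¹ 1 1 - (G y)⁻¹ 0 1 ^ 2 := by
  have h1 : 0 < ((G y)⁻¹).det := by
    rw [Matrix.det_nonsing_inv, Ring.inverse_eq_inv']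
    exact _root_.inv_pos.2 (h.det_pos y)
  rw [Matrix.det_fin_two, h.inv_symm] at h1
  linarith

theorem IsMetric.sum_inv_mul_nonpos (h : IsMetric G) (y : E2) {B : Fin 2 → Fin 2 → ℝ}
    (hB : ∀ v : Fin 2 → ℝ, ∑ i, ∑ j, v i * v j * B i j ≤ 0) :
    ∑ i, ∑ j, (G y)⁻¹ i j * B i j ≤ 0 := by
  have h1 := h.inv_pos y
  have h2 := h.inv_det_pos y
  -- Completing the square: `g¹¹ tr(g⁻¹ B) = B(w, w) + det(g⁻¹) B(e₀, e₀)` for the vector `w = (g⁰¹,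
  -- g¹¹)`.
  have h3 := hB ![(G y)⁻¹ 0 1, (G y)⁻¹ 1 1]
  have h4 := hB ![1, 0]
  simp only [Fin.sum_univ_two, Matrix.cons_val_zero, Matrix.cons_val_one, h.inv_symm] at h3 h4 ⊢
  have h5 : 0 ≤ (G y)⁻¹ 1 1 * -(((G y)⁻¹ 0 0 * B 0 0 + (G y)⁻¹ 0 1 * B 0 1) +
      ((G y)⁻¹ 0 1 * B 1 0 + (G y)⁻¹ 1 1 * B 1 1)) := by
    nlinarith
  have := nonneg_of_mul_nonneg_right h5 h1
  linarith

theorem IsMetric.lap_nonpos_of_isLocalMax (h : IsMetric G) {F : E2 → ℝ} {y : E2}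
    (hF : ContDiff ℝ ∞ F) (hmax : IsLocalMax F y) : lap b2 univ G F y ≤ 0 := by
  simp only [lap, hess, pd_eq_zero_of_isLocalMax hmax, mul_zero, Finset.sum_const_zero, sub_zero]
  exact h.sum_inv_mul_nonpos y (hessian_nonpos_of_isLocalMax hF hmax)

theorem IsMetric.grad_nonneg (h : IsMetric G) (y : E2) (v : Fin 2 → ℝ) :
    0 ≤ ∑ i, ∑ j, (G y)⁻¹ i j * (v i * v j) := by
  have := h.sum_inv_mul_nonpos y (B := fun i j => -(v i * v j)) (by
    intro w
    simp only [Fin.sum_univ_two]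
    nlinarith [sq_nonneg (w 0 * v 0 + w 1 * v 1)])
  simp only [mul_neg, Finset.sum_neg_distrib] at this
  linarith

theorem IsMetric.eq_zero_of_grad_eq_zero (h : IsMetric G) (y : E2) (v : Fin 2 → ℝ)
    (hv : ∑ i, ∑ j, (G y)⁻¹ i j * (v i * v j) = 0) : v = 0 := by
  have h1 := h.inv_pos y
  have h2 := h.inv_det_pos y
  simp only [Fin.sum_univ_two, h.inv_symm] at hv
  have h3 : ((G y)⁻¹ 1 1 * v 1 + (G y)⁻¹ 0 1 * v 0) ^ 2 +
      ((G y)⁻¹ 0 0 * (G y)⁻¹ 1 1 - (G y)⁻¹ 0 1 ^ 2) * v 0 ^ 2 = 0 := by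
    linear_combination (G y)⁻¹ 1 1 * hv
  have h4 : v 0 = 0 := by
    by_contra hne
    have : 0 < v 0 ^ 2 := by positivity
    nlinarith [mul_pos h2 this, sq_nonneg ((G y)⁻¹ 1 1 * v 1 + (G y)⁻¹ 0 1 * v 0)]
  rw [h4] at h3
  have h5 : v 1 = 0 := by
    have : (G y)⁻¹ 1 1 * v 1 = 0 := by
      have : ((G y)⁻¹ 1 1 * v 1) ^ 2 = 0 := by linarith
      exact pow_eq_zero_iff (two_ne_zero) |>.1 this
    exact (mul_eq_zero.1 this).resolve_left h1.ne'
  funext i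
  fin_cases i
  · exact h4
  · exact h5

/-- The square of the length of the gradient of `f`. -/
def gradSq (G : E2 → Matrix (Fin 2) (Fin 2) ℝ) (f : E2 → ℝ) (y : E2) : ℝ :=
  ∑ i, ∑ j, (G y)⁻¹ i j * (pd b2 univ i f y * pd b2 univ j f y)

/-- On a surface of constant scalar curvature `2`, the length of the gradient of a harmonic
function vanishes at its local maxima. -/
theorem IsMetric.gradSq_eq_zero_of_isLocalMax (h : IsMetric G) {f : E2 → ℝ}
    (hf : ContDiff ℝ ∞ f) (hscal : ∀ y, scal b2 univ G y = 2) (hlap : ∀ y, lap b2 univ G f y = 0)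
    {y : E2} (hmax : IsLocalMax (gradSq G f) y) : gradSq G f y = 0 := by
  obtain ⟨g, gi, hr⟩ := exists_represents (S := univ) (fun i j => (h.smooth i j).contDiffOn)
    (fun y _ => h.isUnit y)
  have hm := hr.isMetricPair h.symm
  set D := pdDeriv b2 (isRegularDomain_univ (E := E2)) with hD
  set φ : smoothOn (univ : Set E2) := smoothOn.of f hf.contDiffOn with hφ
  have hq : ((algGrad D gi φ φ : smoothOn (univ : Set E2)) : E2 → ℝ) = gradSq G f := by
    funext z
    simp only [algGrad, gradSq, coe_sum_smoothOn, Finset.sum_apply, Subalgebra.coe_mul,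
      Pi.mul_apply, hr.coe_inv_eq, hD, coe_pdDeriv, hφ, smoothOn.coe_of]
  have hB := hm.eval_lap_grad (smoothOn.eval y) φ
  have hφ0 : algLap D g gi φ = 0 := by
    apply Subtype.ext
    funext z
    rw [hr.coe_lap]
    exact hlap z
  have h1 : smoothOn.eval y (algGrad D gi φ (algLap D g gi φ)) = 0 := by
    rw [hφ0]
    simp [algGrad]
  rw [h1] at hB
  rw [hD] at hq
  simp only [smoothOn.eval_apply, hD, hq, hr.coe_lap, hr.coe_scal, hr.coe_hess, hr.coe_inv_eq,
    hscal] at hB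
  have hqs : ContDiff ℝ ∞ (gradSq G f) := by
    rw [← hq, ← contDiffOn_univ]
    exact contDiffOn_coe _
  have h2 := h.lap_nonpos_of_isLocalMax hqs hmax
  have h3 : 0 ≤ gradSq G f y := h.grad_nonneg y fun i => pd b2 univ i f y
  have h4 : hess b2 univ G f 1 0 y = hess b2 univ G f 0 1 y := by
    have := congrArg (fun F : smoothOn (univ : Set E2) => (F : E2 → ℝ) y) (hm.hess_symm φ)
    simpa only [hD, hr.coe_hess, hφ, smoothOn.coe_of] using this
  have h5 := hlap y
  have hp := h.inv_pos y
  have hdp := h.inv_det_pos y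
  simp only [lap, Fin.sum_univ_two, h4, h.inv_symm] at h5
  change lap b2 univ G (gradSq G f) y = 2 * (∑ i, ∑ j, ∑ k, ∑ l, (G y)⁻¹ i k * (G y)⁻¹ j l *
    hess b2 univ G f i j y * hess b2 univ G f k l y) + _ + _ at hB
  simp only [Fin.sum_univ_two, h4, h.inv_symm] at hB
  set a := (G y)⁻¹ 0 0
  set β := (G y)⁻¹ 0 1
  set c := (G y)⁻¹ 1 1
  set x := hess b2 univ G f 0 0 y
  set u := hess b2 univ G f 0 1 y
  set w := hess b2 univ G f 1 1 y
  -- A trace-free Hessian has nonpositive determinant. Eliminating `w` by means of the trace, `c²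
  -- (u² - x w)` becomes a sum of nonnegative squares.
  have h6 : 0 ≤ (a * c - β ^ 2) * (u ^ 2 - x * w) := by
    refine mul_nonneg hdp.le ?_
    have : 0 ≤ c * (u ^ 2 - x * w) := by
      have e : c * c * (u ^ 2 - x * w) = c * (c * u ^ 2 + 2 * β * u * x + a * x ^ 2) := by
        linear_combination (-c * x) * h5
      have e2 : c * (c * u ^ 2 + 2 * β * u * x + a * x ^ 2) =
          (c * u + β * x) ^ 2 + (a * c - β ^ 2) * x ^ 2 := by ring
      have e3 : 0 ≤ c * (c * (u ^ 2 - x * w)) := by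
        rw [← mul_assoc, e, e2]
        positivity
      exact nonneg_of_mul_nonneg_right e3 hp
    exact nonneg_of_mul_nonneg_right this hp
  -- Bochner with `R = 2` and `Δf = 0`: both terms on the right are nonnegative, while the left side
  -- is nonpositive at the maximum.
  have h7 : lap b2 univ G (gradSq G f) y =
      4 * ((a * c - β ^ 2) * (u ^ 2 - x * w)) + 2 * gradSq G f y := by
    rw [hB]
    linear_combination 2 * (a * x + 2 * β * u + c * w) * h5
  linarith

/-- A function on `[1, T] × X`, for a compact space `X`, that is negative at the initial time and
decreasing in time wherever it vanishes for the first time, is negative. -/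
theorem neg_of_deriv_neg {X : Type*} [TopologicalSpace X] [CompactSpace X] {w : ℝ → X → ℝ} {T : ℝ}
    (hw : ContinuousOn (fun z : ℝ × X => w z.1 z.2) (Icc 1 T ×ˢ univ)) (h1 : ∀ x, w 1 x < 0)
    (hd : ∀ t, 1 < t → t ≤ T → ∀ x, w t x = 0 → (∀ z, w t z ≤ 0) →
      ∃ d < 0, HasDerivAt (fun s => w s x) d t) :
    ∀ t ∈ Icc 1 T, ∀ x, w t x < 0 := by
  by_contra! hcon
  obtain ⟨t₁, ht₁, x₁, hx₁⟩ := hcon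
  set B : Set (ℝ × X) := (Icc 1 T ×ˢ univ) ∩ (fun z : ℝ × X => w z.1 z.2) ⁻¹' Ici 0 with hB
  have hcl : IsClosed B := hw.preimage_isClosed_of_isClosed (isClosed_Icc.prod isClosed_univ)
    isClosed_Ici
  have hcomp : IsCompact B := (isCompact_Icc.prod isCompact_univ).of_isClosed_subset hcl
    inter_subset_left
  -- The set where `w ≥ 0` is compact; its point of least time is the first contact with zero.
  obtain ⟨⟨t, x⟩, htx, hmin⟩ := hcomp.exists_isMinOn ⟨(t₁, x₁), ⟨ht₁, mem_univ _⟩, hx₁⟩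
    continuous_fst.continuousOn
  have htI : t ∈ Icc 1 T := htx.1.1
  have hwx : 0 ≤ w t x := htx.2
  have hlt : ∀ s ∈ Ico 1 t, ∀ z, w s z < 0 := by
    intro s hs z
    by_contra! hz
    have : t ≤ s := hmin (show (s, z) ∈ B from ⟨⟨⟨hs.1, hs.2.le.trans htI.2⟩, mem_univ _⟩, hz⟩)
    exact absurd hs.2 (not_lt.2 this)
  have h1t : 1 < t := by
    rcases htI.1.lt_or_eq with h | h
    · exact h
    · rw [← h] at hwx
      exact absurd (h1 x) (not_lt.2 hwx)
  -- By continuity from earlier times, `x` is a spatial maximum of `w t`, which is what makes `hd`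
  -- applicable.
  have hle : ∀ z, w t z ≤ 0 := by
    intro z
    have hc : ContinuousWithinAt (fun s => w s z) (Ico 1 t) t := by
      have : ContinuousWithinAt (fun z : ℝ × X => w z.1 z.2) (Icc 1 T ×ˢ univ) (t, z) :=
        hw _ ⟨htI, mem_univ _⟩
      exact this.comp (t := Icc 1 T ×ˢ univ)
        (f := fun s : ℝ => ((s, z) : ℝ × X)) (by fun_prop)
        fun s hs => ⟨⟨hs.1, hs.2.le.trans htI.2⟩, mem_univ _⟩
    have hne : (𝓝[Ico 1 t] t).NeBot := by
      rw [← mem_closure_iff_nhdsWithin_neBot, closure_Ico h1t.ne]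
      exact ⟨h1t.le, le_rfl⟩
    refine le_of_tendsto hc.tendsto ?_
    filter_upwards [self_mem_nhdsWithin] with s hs using (hlt s hs z).le
  have hzero : w t x = 0 := le_antisymm (hle x) hwx
  obtain ⟨d, hd0, hder⟩ := hd t h1t htI.2 x hzero hle
  -- The left difference quotients are nonnegative, because `w` rises from negative values to zero.
  have h2 : 0 ≤ d := by
    have h3 := hder.hasDerivWithinAt (s := Iio t)
    rw [hasDerivWithinAt_iff_tendsto_slope' self_notMem_Iio] at h3
    refine ge_of_tendsto h3 ?_
    filter_upwards [Ioo_mem_nhdsLT h1t] with s hs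
    rw [slope_def_field, hzero]
    exact div_nonneg_of_nonpos (by linarith [hlt s ⟨hs.1.le, hs.2⟩ x]) (by linarith [hs.2])
  linarith

end MaximumPrinciple

/-! ### The scalar curvature of the round metric -/

section RoundScalar

theorem hasFDerivAt_stereoFactor (y : E2) : HasFDerivAt (fun y : E2 => (‖y‖ ^ 2 + 4)⁻¹)
    (-((‖y‖ ^ 2 + 4) ^ 2)⁻¹ • (2 • innerSL ℝ y)) y := by
  have h1 : HasFDerivAt (fun y : E2 => ‖y‖ ^ 2 + 4) (2 • innerSL ℝ y) y :=
    ((hasStrictFDerivAt_norm_sq y).hasFDerivAt).add_const 4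
  exact (hasDerivAt_inv (by positivity)).comp_hasFDerivAt y h1

theorem contDiff_stereoFactor : ContDiff ℝ ∞ (fun y : E2 => (‖y‖ ^ 2 + 4)⁻¹) :=
  ((contDiff_norm_sq ℝ).add contDiff_const).inv fun y => by positivity

theorem pd_stereoFactor (i : Fin 2) (y : E2) :
    pd b2 univ i (fun y : E2 => (‖y‖ ^ 2 + 4)⁻¹) y = -2 * y i * ((‖y‖ ^ 2 + 4)⁻¹) ^ 2 := by
  rw [pd, fderivWithin_univ, (hasFDerivAt_stereoFactor y).fderiv]
  have : inner ℝ y (b2 i) = y i := by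
    simp [b2, EuclideanSpace.inner_single_right]
  simp [this]
  ring

theorem pd_coord (i j : Fin 2) (y : E2) :
    pd b2 univ i (fun z : E2 => z j) y = if i = j then 1 else 0 := by
  have : HasFDerivAt (fun z : E2 => z j) (EuclideanSpace.proj j : E2 →L[ℝ] ℝ) y :=
    (EuclideanSpace.proj j : E2 →L[ℝ] ℝ).hasFDerivAt
  rw [pd, fderivWithin_univ, this.fderiv]
  simp [b2, eq_comm]

theorem pd_roundFactor (i : Fin 2) : pd b2 univ i (fun y : E2 => 16 * ((‖y‖ ^ 2 + 4)⁻¹) ^ 2) =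
    fun y => y i * (-64 * ((‖y‖ ^ 2 + 4)⁻¹) ^ 3) := by
  funext y
  have hd : DifferentiableAt ℝ (fun y : E2 => (‖y‖ ^ 2 + 4)⁻¹) y :=
    contDiff_stereoFactor.contDiffAt.differentiableAt (by simp)
  simp only [pow_two ((‖_‖ ^ 2 + 4)⁻¹)]
  rw [pd_mul_univ (differentiableAt_const _) (hd.fun_mul hd), pd_mul_univ hd hd, pd_stereoFactor]
  simp only [pd, fderivWithin_univ, fderiv_fun_const]
  generalize (‖y‖ ^ 2 + 4)⁻¹ = c
  simp
  ring

theorem pd_pd_roundFactor (i j : Fin 2) (y : E2) :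
    pd b2 univ i (pd b2 univ j (fun y : E2 => 16 * ((‖y‖ ^ 2 + 4)⁻¹) ^ 2)) y =
      384 * y i * y j * ((‖y‖ ^ 2 + 4)⁻¹) ^ 4 -
        if i = j then 64 * ((‖y‖ ^ 2 + 4)⁻¹) ^ 3 else 0 := by
  have hd : DifferentiableAt ℝ (fun y : E2 => (‖y‖ ^ 2 + 4)⁻¹) y :=
    contDiff_stereoFactor.contDiffAt.differentiableAt (by simp)
  have hc : DifferentiableAt ℝ (fun z : E2 => z j) y :=
    (EuclideanSpace.proj j : E2 →L[ℝ] ℝ).differentiableAt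
  rw [pd_roundFactor]
  have e : ∀ z : E2, ((‖z‖ ^ 2 + 4)⁻¹) ^ 3 =
      (‖z‖ ^ 2 + 4)⁻¹ * ((‖z‖ ^ 2 + 4)⁻¹ * (‖z‖ ^ 2 + 4)⁻¹) := fun z => by ring
  simp only [e]
  rw [pd_mul_univ hc ((differentiableAt_const _).fun_mul (hd.fun_mul (hd.fun_mul hd))),
    pd_mul_univ (differentiableAt_const _) (hd.fun_mul (hd.fun_mul hd)),
    pd_mul_univ hd (hd.fun_mul hd), pd_mul_univ hd hd, pd_stereoFactor, pd_coord]
  simp only [pd, fderivWithin_univ, fderiv_fun_const]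
  generalize (‖y‖ ^ 2 + 4)⁻¹ = c
  split_ifs <;> simp <;> ring

theorem coordMatrix_roundMetric_eq (p : S2) : coordMatrix (𝓡 2) b2 roundMetric p =
    fun y => (16 * ((‖y‖ ^ 2 + 4)⁻¹) ^ 2) • (1 : Matrix (Fin 2) (Fin 2) ℝ) := by
  funext y
  ext i j
  rw [coordMatrix_roundMetric, Matrix.smul_apply, Matrix.one_apply]
  split_ifs <;> simp

theorem isMetric_round : IsMetric
    (fun y : E2 => (16 * ((‖y‖ ^ 2 + 4)⁻¹) ^ 2) • (1 : Matrix (Fin 2) (Fin 2) ℝ)) where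
  smooth i j := by
    simp only [Matrix.smul_apply, smul_eq_mul]
    exact (contDiff_const.mul (contDiff_stereoFactor.pow 2)).mul contDiff_const
  symm y := by
    rw [Matrix.IsSymm, Matrix.transpose_smul, Matrix.transpose_one]
  pos y := by
    simp only [Matrix.smul_apply, Matrix.one_apply_eq, smul_eq_mul]
    positivity
  det_pos y := by
    rw [Matrix.det_smul, Matrix.det_one]
    positivity

theorem scal_round (y : E2) : scal b2 univ
    (fun y : E2 => (16 * ((‖y‖ ^ 2 + 4)⁻¹) ^ 2) • (1 : Matrix (Fin 2) (Fin 2) ℝ)) y = 2 := by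
  have h := isMetric_round
  rw [scal_eq_scalJet h.smooth h.symm h.isUnit]
  obtain ⟨e00, e01, -, e11⟩ := inv_fin_two_apply
    ((16 * ((‖y‖ ^ 2 + 4)⁻¹) ^ 2) • (1 : Matrix (Fin 2) (Fin 2) ℝ))
  rw [e00, e01, e11, Matrix.det_smul, Matrix.det_one]
  simp only [Matrix.smul_apply, Matrix.one_apply_eq, smul_eq_mul, mul_one, Fintype.card_fin,
    Matrix.one_apply_ne (show (0 : Fin 2) ≠ 1 by decide), mul_zero, pd_pd_roundFactor]
  simp only [pd_roundFactor]
  have hz : ∀ i, pd b2 univ i (fun _ : E2 => (0 : ℝ)) = fun _ => 0 := by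
    intro i
    funext z
    simp [pd]
  simp only [hz, scalJet, if_true]
  have hn : ‖y‖ ^ 2 = y 0 ^ 2 + y 1 ^ 2 := by
    rw [EuclideanSpace.norm_sq_eq, Fin.sum_univ_two]
    simp
  rw [hn]
  have : y 0 ^ 2 + y 1 ^ 2 + 4 ≠ 0 := by positivity
  field_simp
  ring

end RoundScalar

/-! ### The modified Ricci flow starting at the round metric -/

section Flow

/-- Joint continuity up to and including the initial time is what the compactness argument of the
maximum principle requires. -/
theorem continuousOn_scal_param {Q : ℝ → E2 → Matrix (Fin 2) (Fin 2) ℝ} {T : Set ℝ}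
    (hT : UniqueDiffOn ℝ T)
    (hQ : ∀ i j, ContDiffOn ℝ ∞ (fun z : ℝ × E2 => Q z.1 z.2 i j) (T ×ˢ univ))
    (hm : ∀ t ∈ T, IsMetric (Q t)) :
    ContinuousOn (fun z : ℝ × E2 => scal b2 univ (Q z.1) z.2) (T ×ˢ univ) := by
  have h1 : ∀ i j k, ContDiffOn ℝ ∞
      (fun z : ℝ × E2 => pd b2 univ k (fun w => Q z.1 w i j) z.2) (T ×ˢ univ) := fun i j k =>
    contDiffOn_pd_param (Q := fun s w => Q s w i j) hT (hQ i j) k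
  have h2 : ∀ i j k l, ContinuousOn (fun z : ℝ × E2 =>
      pd b2 univ l (pd b2 univ k (fun w => Q z.1 w i j)) z.2) (T ×ˢ univ) := fun i j k l =>
    (contDiffOn_pd_param (Q := fun s => pd b2 univ k (fun w => Q s w i j)) hT
      (h1 i j k) l).continuousOn
  have h1' := fun i j k => (h1 i j k).continuousOn
  have h0 : ∀ i j, ContinuousOn (fun z : ℝ × E2 => (Q z.1 z.2)⁻¹ i j) (T ×ˢ univ) := fun i j =>
    (contDiffOn_inv_entry (G := fun z : ℝ × E2 => Q z.1 z.2) hQ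
      (fun z hz => (hm z.1 hz.1).isUnit z.2) i j).continuousOn
  have e : EqOn (fun z : ℝ × E2 => scal b2 univ (Q z.1) z.2) (fun z => scalJet
      ((Q z.1 z.2)⁻¹ 0 0) ((Q z.1 z.2)⁻¹ 0 1) ((Q z.1 z.2)⁻¹ 1 1)
      (pd b2 univ 0 (fun w => Q z.1 w 0 0) z.2) (pd b2 univ 1 (fun w => Q z.1 w 0 0) z.2)
      (pd b2 univ 0 (fun w => Q z.1 w 0 1) z.2) (pd b2 univ 1 (fun w => Q z.1 w 0 1) z.2)
      (pd b2 univ 0 (fun w => Q z.1 w 1 1) z.2) (pd b2 univ 1 (fun w => Q z.1 w 1 1) z.2)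
      (pd b2 univ 1 (pd b2 univ 1 (fun w => Q z.1 w 0 0)) z.2)
      (pd b2 univ 0 (pd b2 univ 1 (fun w => Q z.1 w 0 1)) z.2)
      (pd b2 univ 0 (pd b2 univ 0 (fun w => Q z.1 w 1 1)) z.2)) (T ×ˢ univ) := fun z hz =>
    scal_eq_scalJet (hm z.1 hz.1).smooth (hm z.1 hz.1).symm (hm z.1 hz.1).isUnit z.2
  exact (continuousOn_scalJet (h0 0 0) (h0 0 1) (h0 1 1) (h1' 0 0 0) (h1' 0 0 1) (h1' 0 1 0)
    (h1' 0 1 1) (h1' 1 1 0) (h1' 1 1 1) (h2 0 0 1 1) (h2 0 1 1 0) (h2 1 1 0 0)).congr e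

variable {g : ℝ → Tensor2 (𝓡 2) S2} {f : ℝ → S2 → ℝ}

theorem contDiff_comp_param {F : S2 → ℝ} (hF : ContMDiff (𝓡 2) 𝓘(ℝ, ℝ) ∞ F) (p : S2) :
    ContDiff ℝ ∞ (F ∘ param p) := by
  rw [← contMDiff_iff_contDiff]
  exact hF.comp (contMDiff_param p)

theorem scalarS2_eq (g : Tensor2 (𝓡 2) S2) (x : S2) :
    scalarS2 g x = scal b2 univ (coordMatrix (𝓡 2) b2 g x) 0 := by
  rw [scalarS2, scalarCurvature, chartDomain_univ_S2, extChartAt_S2_self]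

theorem isMetric_coordMatrix {g : Tensor2 (𝓡 2) S2} (p : S2)
    (hsm : ∀ i j, ContDiff ℝ ∞ (fun y => coordMatrix (𝓡 2) b2 g p y i j))
    (hs : ∀ x v w, g x v w = g x w v) (hp : ∀ x v, v ≠ 0 → 0 < g x v v) :
    IsMetric (coordMatrix (𝓡 2) b2 g p) where
  smooth := hsm
  symm y := by
    ext i j
    exact hs _ _ _
  pos y := hp _ _ ((linearIndependent_coordVecE p y).ne_zero 0)
  det_pos y := by
    set B := formE g (param p y)
    have hs' : ∀ v w, B v w = B w v := hs _
    have hp' : ∀ v, v ≠ 0 → 0 < B v v := hp _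
    set v := coordVecE p y with hv
    have hli := linearIndependent_coordVecE p y
    have h0 : 0 < B (v 0) (v 0) := hp' _ (hli.ne_zero 0)
    have h1 : B (v 0) (v 0) • v 1 - B (v 0) (v 1) • v 0 ≠ 0 := by
      intro h
      have := Fintype.linearIndependent_iff.1 hli ![-B (v 0) (v 1), B (v 0) (v 0)] (by
        rw [Fin.sum_univ_two]
        simp only [Matrix.cons_val_zero, Matrix.cons_val_one]
        rw [← h]
        module) 1
      simp only [Matrix.cons_val_one] at this
      exact h0.ne' this
    have h2 := hp' _ h1
    simp only [map_sub, map_smul, LinearMap.sub_apply, LinearMap.smul_apply, smul_eq_mul,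
      hs' (v 1) (v 0)] at h2
    rw [Matrix.det_fin_two]
    simp only [coordMatrix_S2]
    change 0 < B (v 0) (v 0) * B (v 1) (v 1) - B (v 0) (v 1) * B (v 1) (v 0)
    rw [hs' (v 1) (v 0)]
    refine pos_of_mul_pos_right (a := B (v 0) (v 0)) ?_ h0.le
    linarith

theorem isPullbackAt_coordMatrix (g : Tensor2 (𝓡 2) S2) (p q : S2) {y : E2}
    (hy : y ∈ transitionDomain p q) :
    IsPullbackAt (transition p q) (coordMatrix (𝓡 2) b2 g q) (coordMatrix (𝓡 2) b2 g p) y where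
  contDiffAt := contDiffAt_transition p q hy
  eventually_eq := by
    filter_upwards [(isOpen_transitionDomain p q).mem_nhds hy] with z hz i j
    exact coordMatrix_transition g p q hz i j

theorem mem_transitionDomain_param (p : S2) (y : E2) : y ∈ transitionDomain p (param p y) :=
  mem_extChartAt_source (I := 𝓡 2) (param p y)

theorem transition_param (p : S2) (y : E2) : transition p (param p y) y = 0 :=
  extChartAt_S2_self (param p y)

theorem comp_param_transition (F : S2 → ℝ) (p q : S2) {y : E2} (hy : y ∈ transitionDomain p q) :
    F ∘ param p =ᶠ[𝓝 y] (F ∘ param q) ∘ transition p q := by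
  filter_upwards [(isOpen_transitionDomain p q).mem_nhds hy] with z hz
  simp only [Function.comp_apply, param_transition p q hz]

theorem IsModifiedRicciFlow.contDiffOn (h : IsModifiedRicciFlow g f) (p : S2) (i j : Fin 2) :
    ContDiffOn ℝ ∞ (fun z : ℝ × E2 => coordMatrix (𝓡 2) b2 (g z.1) p z.2 i j)
      (Ici 1 ×ˢ univ) := by
  have := h.smooth p i j
  rwa [target_extChartAt_S2] at this

theorem IsModifiedRicciFlow.isMetric (h : IsModifiedRicciFlow g f) {t : ℝ} (ht : 1 ≤ t) (p : S2) :
    IsMetric (coordMatrix (𝓡 2) b2 (g t) p) :=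
  isMetric_coordMatrix p (fun i j => by
    rw [← contDiffOn_univ]
    exact (h.contDiffOn p i j).comp (contDiff_prodMk_right t).contDiffOn
      fun y _ => ⟨ht, mem_univ y⟩) (h.symm t ht) (h.pos t ht)

theorem IsModifiedRicciFlow.lap_potential (h : IsModifiedRicciFlow g f) {t : ℝ} (ht : 1 ≤ t)
    (p : S2) (y : E2) : lap b2 univ (coordMatrix (𝓡 2) b2 (g t) p) (f t ∘ param p) y =
      scal b2 univ (coordMatrix (𝓡 2) b2 (g t) p) y - meanScalar (g t) := by
  have := h.potential t ht p y (by rw [target_extChartAt_S2]; trivial)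
  rwa [chartDomain_univ_S2] at this

/-- The scalar curvature of a metric of the flow does not depend on the coordinates. -/
theorem IsModifiedRicciFlow.scal_eq (h : IsModifiedRicciFlow g f) {t : ℝ} (ht : 1 ≤ t)
    (p : S2) (y : E2) :
    scal b2 univ (coordMatrix (𝓡 2) b2 (g t) p) y = scalarS2 (g t) (param p y) := by
  -- In every chart `R = Δf + r`, so the invariance of the Laplacian yields that of `R`, without a
  -- transformation law for the curvature tensor.
  have h1 := h.lap_potential ht p y
  have h2 := h.lap_potential ht (param p y) 0
  have hy := mem_transitionDomain_param p y
  have hm := h.isMetric ht (param p y)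
  have h3 := (isPullbackAt_coordMatrix (g t) p (param p y) hy).lap_eq hm.smooth hm.symm
    (hm.isUnit _) ((h.isMetric ht p).isUnit y)
    (contDiff_comp_param (h.smooth_potential t ht) (param p y))
    (comp_param_transition (f t) p (param p y) hy)
  rw [transition_param] at h3
  rw [scalarS2_eq]
  linarith

theorem IsModifiedRicciFlow.flowTensor_eq (p : S2) (t : ℝ) (y : E2) (i j : Fin 2) :
    2 * flowTensor (g t) (f t) p y i j = (meanScalar (g t) -
      scal b2 univ (coordMatrix (𝓡 2) b2 (g t) p) y) * coordMatrix (𝓡 2) b2 (g t) p y i j +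
        2 * hess b2 univ (coordMatrix (𝓡 2) b2 (g t) p) (f t ∘ param p) i j y := by
  simp only [flowTensor, Matrix.of_apply, chartDomain_univ_S2, param]
  ring

theorem IsModifiedRicciFlow.evolution' (h : IsModifiedRicciFlow g f) {t : ℝ} (ht : 1 ≤ t)
    (p : S2) (y : E2) (i j : Fin 2) :
    HasDerivWithinAt (fun s => coordMatrix (𝓡 2) b2 (g s) p y i j)
      (2 * flowTensor (g t) (f t) p y i j) (Ici 1) t :=
  h.evolution t ht p y (by rw [target_extChartAt_S2]; trivial) i j

theorem eq_of_hasDerivWithinAt_zero {F : ℝ → ℝ}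
    (h : ∀ t, 1 ≤ t → HasDerivWithinAt F 0 (Ici 1) t) {t : ℝ} (ht : 1 ≤ t) : F t = F 1 := by
  refine constant_of_has_deriv_right_zero (a := 1) (b := t)
    (fun s hs => (h s hs.1).continuousWithinAt.mono Icc_subset_Ici_self)
    (fun s hs => (h s hs.1).mono (Ici_subset_Ici.2 hs.1)) t ⟨ht, le_rfl⟩

/-- The flow preserves the area form. -/
theorem IsModifiedRicciFlow.det_eq (h : IsModifiedRicciFlow g f) {t : ℝ} (ht : 1 ≤ t)
    (p : S2) (y : E2) :
    (coordMatrix (𝓡 2) b2 (g t) p y).det = (coordMatrix (𝓡 2) b2 (g 1) p y).det := by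
  refine eq_of_hasDerivWithinAt_zero (F := fun t => (coordMatrix (𝓡 2) b2 (g t) p y).det)
    (fun s hs => ?_) ht
  have hm := h.isMetric hs p
  have hev := h.evolution' hs p y
  simp only [Matrix.det_fin_two]
  -- Here `∂_t det g = det g · tr(2M) = 2 det g · (r - R + Δf)`, which vanishes by the potential
  -- equation.
  refine (((hev 0 0).mul (hev 1 1)).sub ((hev 0 1).mul (hev 1 0))).congr_deriv ?_
  have hlap := h.lap_potential hs p y
  obtain ⟨e00, e01, e10, e11⟩ := inv_fin_two_apply (coordMatrix (𝓡 2) b2 (g s) p y)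
  have hd := (hm.det_pos y).ne'
  simp only [flowTensor_eq]
  simp only [lap, Fin.sum_univ_two, e00, e01, e10, e11] at hlap
  field_simp at hlap
  rw [Matrix.det_fin_two] at hlap
  have hsym : coordMatrix (𝓡 2) b2 (g s) p y 1 0 = coordMatrix (𝓡 2) b2 (g s) p y 0 1 :=
    (hm.symm y).apply 0 1
  rw [hsym] at hlap ⊢
  linear_combination 2 * hlap

/-- The preserved area form makes `r(t)` an average of `R` against a measure independent of time. -/
theorem IsModifiedRicciFlow.areaMeasure_eq (h : IsModifiedRicciFlow g f) (h1 : g 1 = roundMetric)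
    {t : ℝ} (ht : 1 ≤ t) :
    areaMeasure (g t) = (volume : Measure (EuclideanSpace ℝ (Fin 3))).toSphere := by
  have : ∀ x : S2, ENNReal.ofReal
      (√((coordMatrix (𝓡 2) b2 (g t) x (extChartAt (𝓡 2) x x)).det /
        (coordMatrix (𝓡 2) b2 roundMetric x (extChartAt (𝓡 2) x x)).det)) = 1 := by
    intro x
    rw [h.det_eq ht, h1, div_self, Real.sqrt_one, ENNReal.ofReal_one]
    rw [coordMatrix_roundMetric_eq]
    exact (isMetric_round.det_pos _).ne'
  simp only [areaMeasure, this]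
  exact withDensity_one

/-- In `scalarS2` the chart moves with the point. Coordinate invariance permits a fixed chart near
each point, where continuity is visible. -/
theorem IsModifiedRicciFlow.continuousOn_scalarS2 (h : IsModifiedRicciFlow g f) :
    ContinuousOn (fun z : ℝ × S2 => scalarS2 (g z.1) z.2) (Ici 1 ×ˢ univ) := by
  rintro ⟨t, x⟩ ⟨ht, -⟩
  have h1 := continuousOn_scal_param (Q := fun t => coordMatrix (𝓡 2) b2 (g t) x)
    (uniqueDiffOn_Ici 1) (h.contDiffOn x) (fun t ht => h.isMetric ht x)
  have hφ : ContinuousAt (fun z : ℝ × S2 => (z.1, extChartAt (𝓡 2) x z.2)) (t, x) :=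
    continuousAt_fst.prodMk
      (ContinuousAt.comp (f := Prod.snd) (continuousAt_extChartAt x) continuousAt_snd)
  have h2 := (h1 (t, extChartAt (𝓡 2) x x) ⟨ht, mem_univ _⟩).comp
    (f := fun z : ℝ × S2 => (z.1, extChartAt (𝓡 2) x z.2)) (s := Ici 1 ×ˢ univ) (x := (t, x))
    hφ.continuousWithinAt (fun z hz => ⟨hz.1, mem_univ _⟩)
  refine h2.congr_of_eventuallyEq ?_ ?_
  · have hmem : ∀ᶠ z : ℝ × S2 in 𝓝[Ici 1 ×ˢ univ] (t, x), z.2 ∈ (extChartAt (𝓡 2) x).source :=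
      mem_nhdsWithin_of_mem_nhds
        (continuousAt_snd.preimage_mem_nhds (extChartAt_source_mem_nhds x))
    filter_upwards [hmem, self_mem_nhdsWithin] with z hz hz'
    simp only [Function.comp_apply]
    rw [h.scal_eq hz'.1, param_extChartAt x hz]
  · simp only [Function.comp_apply]
    rw [h.scal_eq ht, param_extChartAt x (mem_extChartAt_source x)]

theorem IsModifiedRicciFlow.continuous_scalarS2 (h : IsModifiedRicciFlow g f) {t : ℝ}
    (ht : 1 ≤ t) : Continuous (scalarS2 (g t)) := by
  rw [← continuousOn_univ]
  exact ContinuousOn.comp (g := fun z : ℝ × S2 => scalarS2 (g z.1) z.2) (f := fun x => (t, x))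
    h.continuousOn_scalarS2 (Continuous.prodMk_right t).continuousOn fun x _ => ⟨ht, mem_univ x⟩

theorem abs_average_sub_le {μ : Measure S2} [IsFiniteMeasure μ] (hμ : μ ≠ 0) {F : S2 → ℝ}
    (hF : Continuous F) {c δ : ℝ} (hδ : ∀ x, |F x - c| ≤ δ) : |(⨍ x, F x ∂μ) - c| ≤ δ := by
  have : NeZero μ := ⟨hμ⟩
  have hi : Integrable F ((μ univ)⁻¹ • μ) := by
    obtain ⟨C, hC⟩ := isCompact_univ.exists_bound_of_continuousOn hF.continuousOn
    exact Integrable.of_bound hF.aestronglyMeasurable C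
      (Filter.Eventually.of_forall fun x => hC x (mem_univ x))
  have h1 : (⨍ x, F x ∂μ) - c = ∫ x, (F x - c) ∂((μ univ)⁻¹ • μ) := by
    rw [integral_sub hi (integrable_const c), integral_const, average]
    simp
  rw [h1, ← Real.norm_eq_abs]
  refine (norm_integral_le_of_norm_le_const (C := δ) (Filter.Eventually.of_forall hδ)).trans ?_
  simp

/-- Controls the nonlocal term `r` of the evolution equation by the pointwise deviation of `R`. -/
theorem IsModifiedRicciFlow.abs_meanScalar_sub_le (h : IsModifiedRicciFlow g f)
    (h1 : g 1 = roundMetric) {t : ℝ} (ht : 1 ≤ t) {δ : ℝ}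
    (hδ : ∀ x, |scalarS2 (g t) x - 2| ≤ δ) : |meanScalar (g t) - 2| ≤ δ := by
  rw [meanScalar, h.areaMeasure_eq h1 ht]
  exact abs_average_sub_le (Measure.toSphere_ne_zero _) (h.continuous_scalarS2 ht) hδ

/-- The evolution of the scalar curvature at its maxima and minima. -/
theorem IsModifiedRicciFlow.hasDerivAt_scalarS2 (h : IsModifiedRicciFlow g f) {t : ℝ} (ht : 1 < t)
    (x : S2) : ∃ l, HasDerivAt (fun s => scalarS2 (g s) x)
      (l + scalarS2 (g t) x * (scalarS2 (g t) x - meanScalar (g t))) t ∧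
      ((∀ z, scalarS2 (g t) z ≤ scalarS2 (g t) x) → l ≤ 0) ∧
      ((∀ z, scalarS2 (g t) x ≤ scalarS2 (g t) z) → 0 ≤ l) := by
  have hm := h.isMetric ht.le x
  have hsm := contDiff_scal hm.smooth hm.isUnit
  have key := hasDerivAt_scal (Q := fun s => coordMatrix (𝓡 2) b2 (g s) x) (T := Ioi 1) isOpen_Ioi
    (fun i j => (h.contDiffOn x i j).mono (prod_mono Ioi_subset_Ici_self subset_rfl))
    (fun s hs => (h.isMetric (le_of_lt hs) x).symm)
    (fun s hs => (h.isMetric (le_of_lt hs) x).isUnit) ht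
    (contDiff_comp_param (h.smooth_potential t ht.le) x) (meanScalar (g t))
    (h.lap_potential ht.le x) (fun y i j => by
      rw [← flowTensor_eq]
      exact (h.evolution' ht.le x y i j).hasDerivAt (Ici_mem_nhds ht)) 0
  have e : ∀ y, scal b2 univ (coordMatrix (𝓡 2) b2 (g t) x) y = scalarS2 (g t) (param x y) :=
    h.scal_eq ht.le x
  have e0 : scal b2 univ (coordMatrix (𝓡 2) b2 (g t) x) 0 = scalarS2 (g t) x :=
    (scalarS2_eq _ _).symm
  set G := coordMatrix (𝓡 2) b2 (g t) x
  rw [e0] at key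
  refine ⟨lap b2 univ G (scal b2 univ G) 0 + ∑ i, ∑ j, (G 0)⁻¹ i j *
    (pd b2 univ i (scal b2 univ G) 0 * pd b2 univ j (f t ∘ param x) 0), ?_, ?_, ?_⟩
  · refine (key.congr_of_eventuallyEq ?_).congr_deriv (by ring)
    exact Filter.Eventually.of_forall fun s => scalarS2_eq (g s) x
  · intro hz
    have hmax : IsLocalMax (scal b2 univ G) 0 := Filter.Eventually.of_forall fun y => by
      rw [e, e0]
      exact hz _
    simp only [pd_eq_zero_of_isLocalMax hmax, zero_mul, mul_zero, Finset.sum_const_zero, add_zero]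
    exact hm.lap_nonpos_of_isLocalMax hsm hmax
  · intro hz
    have hmax : IsLocalMax (fun y => -scal b2 univ G y) 0 := Filter.Eventually.of_forall fun y => by
      simp only [e, neg_le_neg_iff]
      rw [param_zero]
      exact hz _
    have hpd : ∀ i, pd b2 univ i (fun y => -scal b2 univ G y) =
        fun y => -pd b2 univ i (scal b2 univ G) y := by
      intro i
      funext y
      simp only [pd, fderivWithin_univ]
      rw [fderiv_fun_neg]
      rfl
    have hpd0 : ∀ i, pd b2 univ i (scal b2 univ G) 0 = 0 := by
      intro i
      have := pd_eq_zero_of_isLocalMax hmax i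
      rw [hpd] at this
      linarith
    simp only [hpd0, zero_mul, mul_zero, Finset.sum_const_zero, add_zero]
    have hl := hm.lap_nonpos_of_isLocalMax hsm.neg hmax
    have hneg : lap b2 univ G (fun y => -scal b2 univ G y) 0 =
        -lap b2 univ G (scal b2 univ G) 0 := by
      have hpd2 : ∀ i j, pd b2 univ i (fun y => -pd b2 univ j (scal b2 univ G) y) 0 =
          -pd b2 univ i (pd b2 univ j (scal b2 univ G)) 0 := by
        intro i j
        rw [pd, fderivWithin_univ, fderiv_fun_neg, pd, fderivWithin_univ]
        rfl
      simp only [lap, hess, hpd, hpd2, Fin.sum_univ_two]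
      ring
    linarith

/-- Under the modified Ricci flow of the round metric the scalar curvature is constant. -/
theorem IsModifiedRicciFlow.scalarS2_eq_two (h : IsModifiedRicciFlow g f)
    (h1 : g 1 = roundMetric) {t : ℝ} (ht : 1 ≤ t) (x : S2) : scalarS2 (g t) x = 2 := by
  have hcont : ContinuousOn (fun z : ℝ × S2 => scalarS2 (g z.1) z.2) (Icc 1 t ×ˢ univ) :=
    h.continuousOn_scalarS2.mono (prod_mono Icc_subset_Ici_self subset_rfl)
  obtain ⟨C, hC⟩ := (isCompact_Icc.prod isCompact_univ).exists_bound_of_continuousOn hcont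
  have hC' : ∀ s ∈ Icc 1 t, ∀ z, |scalarS2 (g s) z| ≤ C := fun s hs z =>
    hC (s, z) ⟨hs, mem_univ z⟩
  have hstart : ∀ z, scalarS2 (g 1) z = 2 := by
    intro z
    rw [h1, scalarS2_eq, coordMatrix_roundMetric_eq, scal_round]
  -- At a contact point with the barrier `δ = ε exp(L (s - 1))` the reaction term satisfies `|R (R -
  -- r)| ≤ 2 C δ`, which is less than the speed `L δ` of the barrier.
  set L := 2 * C + 1 with hL
  have main : ∀ ε > 0, |scalarS2 (g t) x - 2| < ε * Real.exp (L * (t - 1)) := by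
    intro ε hε
    -- Both signs are run at once on `S² × Bool`: bounding `|r - 2|` at the first contact requires
    -- the upper and the lower barrier simultaneously.
    set w : ℝ → S2 × Bool → ℝ := fun s z =>
      (cond z.2 1 (-1) : ℝ) * (scalarS2 (g s) z.1 - 2) - ε * Real.exp (L * (s - 1)) with hw
    have hneg : ∀ s ∈ Icc 1 t, ∀ z, w s z < 0 := by
      refine neg_of_deriv_neg ?_ ?_ ?_
      · have hb : Continuous (fun b : Bool => (cond b 1 (-1) : ℝ)) :=
          continuous_of_discreteTopology
        have h3 : ContinuousOn (fun z : ℝ × S2 × Bool => scalarS2 (g z.1) z.2.1)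
            (Icc 1 t ×ˢ univ) :=
          hcont.comp (f := fun z : ℝ × S2 × Bool => (z.1, z.2.1)) (by fun_prop)
            fun z hz => ⟨hz.1, mem_univ _⟩
        have h4 : Continuous (fun z : ℝ × S2 × Bool => (cond z.2.2 1 (-1) : ℝ)) :=
          hb.comp (continuous_snd.comp continuous_snd)
        exact (h4.continuousOn.mul (h3.sub continuousOn_const)).sub
          (Continuous.continuousOn (by fun_prop))
      · intro z
        simp only [hw, hstart, sub_self, mul_zero, Real.exp_zero, zero_sub, mul_one]
        linarith
      · rintro s hs hst ⟨z, b⟩ hz hle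
        set δ := ε * Real.exp (L * (s - 1)) with hδ
        have hδ0 : 0 < δ := by positivity
        have habs : ∀ y, |scalarS2 (g s) y - 2| ≤ δ := by
          intro y
          have e1 := hle (y, true)
          have e2 := hle (y, false)
          simp only [hw, cond_true, cond_false] at e1 e2
          rw [abs_le]
          constructor <;> linarith
        have hr := h.abs_meanScalar_sub_le h1 hs.le habs
        have hprod : |scalarS2 (g s) z * (scalarS2 (g s) z - meanScalar (g s))| ≤ C * (2 * δ) := by
          rw [abs_mul]
          have e1 := hC' s ⟨hs.le, hst⟩ z
          have e2 : |scalarS2 (g s) z - meanScalar (g s)| ≤ 2 * δ := by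
            have := habs z
            rw [abs_le] at this hr ⊢
            constructor <;> linarith
          exact mul_le_mul e1 e2 (abs_nonneg _) ((abs_nonneg _).trans e1)
        have hprod' := abs_le.1 hprod
        obtain ⟨l, hl, hlmax, hlmin⟩ := h.hasDerivAt_scalarS2 hs z
        have hexp : HasDerivAt (fun s => ε * Real.exp (L * (s - 1))) (L * δ) s := by
          have := (((hasDerivAt_id s).sub_const 1).const_mul L).exp.const_mul ε
          refine this.congr_deriv ?_
          simp only [hδ, id]
          ring
        have hder := ((hl.sub_const 2).const_mul (cond b 1 (-1) : ℝ)).sub hexp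
        refine ⟨_, ?_, hder⟩
        cases b
        · simp only [hw, cond_false] at hz
          have : 0 ≤ l := hlmin fun y => by
            have := abs_le.1 (habs y)
            linarith
          simp only [cond_false, hL]
          nlinarith
        · simp only [hw, cond_true] at hz
          have : l ≤ 0 := hlmax fun y => by
            have := abs_le.1 (habs y)
            linarith
          simp only [cond_true, hL]
          nlinarith
    have e1 := hneg t ⟨ht, le_rfl⟩ (x, true)
    have e2 := hneg t ⟨ht, le_rfl⟩ (x, false)
    simp only [hw, cond_true, cond_false] at e1 e2
    rw [abs_lt]
    constructor <;> linarith
  have hzero : |scalarS2 (g t) x - 2| ≤ 0 := by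
    refine le_of_forall_pos_lt_add fun ε hε => ?_
    have := main (ε / Real.exp (L * (t - 1))) (by positivity)
    rw [div_mul_cancel₀ _ (Real.exp_pos _).ne'] at this
    linarith
  have := abs_nonpos_iff.1 hzero
  linarith

theorem IsModifiedRicciFlow.meanScalar_eq_two (h : IsModifiedRicciFlow g f)
    (h1 : g 1 = roundMetric) {t : ℝ} (ht : 1 ≤ t) : meanScalar (g t) = 2 := by
  have := h.abs_meanScalar_sub_le h1 ht (δ := 0) (fun x => by
    rw [h.scalarS2_eq_two h1 ht]
    simp)
  have := abs_nonpos_iff.1 this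
  linarith

/-- Under the modified Ricci flow of the round metric the potential is constant. -/
theorem IsModifiedRicciFlow.pd_potential_eq_zero (h : IsModifiedRicciFlow g f)
    (h1 : g 1 = roundMetric) {t : ℝ} (ht : 1 ≤ t) (p : S2) (y : E2) (i : Fin 2) :
    pd b2 univ i (f t ∘ param p) y = 0 := by
  have hf := h.smooth_potential t ht
  set q : S2 → ℝ := fun x => gradSq (coordMatrix (𝓡 2) b2 (g t) x) (f t ∘ param x) 0 with hq
  -- The function `|∇f|²` is independent of the chart, so it is a function on the compact sphere and
  -- attains a maximum.
  have hinv : ∀ p y, gradSq (coordMatrix (𝓡 2) b2 (g t) p) (f t ∘ param p) y = q (param p y) := by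
    intro p y
    have hy := mem_transitionDomain_param p y
    have := (isPullbackAt_coordMatrix (g t) p (param p y) hy).grad_eq
      ((h.isMetric ht p).isUnit y) (contDiff_comp_param hf (param p y))
      (comp_param_transition (f t) p (param p y) hy)
    rwa [transition_param] at this
  have hscal : ∀ p y, scal b2 univ (coordMatrix (𝓡 2) b2 (g t) p) y = 2 := fun p y => by
    rw [h.scal_eq ht, h.scalarS2_eq_two h1 ht]
  have hlap : ∀ p y, lap b2 univ (coordMatrix (𝓡 2) b2 (g t) p) (f t ∘ param p) y = 0 :=
    fun p y => by
      rw [h.lap_potential ht, hscal, h.meanScalar_eq_two h1 ht, sub_self]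
  have hcont : Continuous q := by
    rw [continuous_iff_continuousAt]
    intro x
    have hm := h.isMetric ht x
    have hg : Continuous (gradSq (coordMatrix (𝓡 2) b2 (g t) x) (f t ∘ param x)) := by
      refine continuous_finsetSum _ fun i _ => continuous_finsetSum _ fun j _ => ?_
      refine Continuous.mul ?_ (((contDiff_pd_univ (contDiff_comp_param hf x) i).continuous).mul
        (contDiff_pd_univ (contDiff_comp_param hf x) j).continuous)
      have := contDiffOn_inv_entry (S := univ) (fun i j => (hm.smooth i j).contDiffOn)
        (fun y _ => hm.isUnit y) i j
      exact (contDiffOn_univ.1 this).continuous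
    have h2 : ContinuousAt (gradSq (coordMatrix (𝓡 2) b2 (g t) x) (f t ∘ param x) ∘
        extChartAt (𝓡 2) x) x := hg.continuousAt.comp (continuousAt_extChartAt x)
    refine h2.congr ?_
    filter_upwards [extChartAt_source_mem_nhds (I := 𝓡 2) x] with z hz
    simp only [Function.comp_apply]
    rw [hinv, param_extChartAt x hz]
  obtain ⟨x₀, -, hx₀⟩ := isCompact_univ.exists_isMaxOn ⟨p, mem_univ p⟩ hcont.continuousOn
  have hle : ∀ x, q x ≤ q x₀ := fun x => hx₀ (mem_univ x)
  have h0 : q x₀ = 0 := by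
    refine (h.isMetric ht x₀).gradSq_eq_zero_of_isLocalMax (contDiff_comp_param hf x₀) (hscal x₀)
      (hlap x₀) (Filter.Eventually.of_forall fun y => ?_)
    rw [hinv, hinv, param_zero]
    exact hle _
  have hm := h.isMetric ht p
  have h2 : gradSq (coordMatrix (𝓡 2) b2 (g t) p) (f t ∘ param p) y = 0 := by
    refine le_antisymm ?_ (hm.grad_nonneg y fun i => pd b2 univ i (f t ∘ param p) y)
    rw [hinv, ← h0]
    exact hle _
  exact congrFun (hm.eq_zero_of_grad_eq_zero y (fun i => pd b2 univ i (f t ∘ param p) y) h2) i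

theorem IsModifiedRicciFlow.flowTensor_eq_zero (h : IsModifiedRicciFlow g f)
    (h1 : g 1 = roundMetric) {t : ℝ} (ht : 1 ≤ t) (p : S2) (y : E2) :
    flowTensor (g t) (f t) p y = 0 := by
  ext i j
  have hz : ∀ i, pd b2 univ i (f t ∘ param p) = fun _ => 0 := fun i =>
    funext fun y => h.pd_potential_eq_zero h1 ht p y i
  have hh : hess b2 univ (coordMatrix (𝓡 2) b2 (g t) p) (f t ∘ param p) i j y = 0 := by
    have hz' : ∀ i, pd b2 univ i (fun _ : E2 => (0 : ℝ)) y = 0 := fun i => by simp [pd]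
    simp only [hess, hz, hz', mul_zero, Finset.sum_const_zero, sub_zero]
  have := flowTensor_eq (g := g) (f := f) p t y i j
  rw [hh, h.scal_eq ht, h.scalarS2_eq_two h1 ht, h.meanScalar_eq_two h1 ht] at this
  simpa using this

/-- The modified Ricci flow starting at the round metric is constant. -/
theorem IsModifiedRicciFlow.eq_roundMetric (h : IsModifiedRicciFlow g f)
    (h1 : g 1 = roundMetric) {t : ℝ} (ht : 1 ≤ t) : g t = roundMetric := by
  rw [← h1]
  funext x
  refine formE_ext (B := formE (g t) x) (B' := formE (g 1) x) x 0 fun i j => ?_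
  have key : coordMatrix (𝓡 2) b2 (g t) x 0 i j = coordMatrix (𝓡 2) b2 (g 1) x 0 i j := by
    refine eq_of_hasDerivWithinAt_zero (F := fun t => coordMatrix (𝓡 2) b2 (g t) x 0 i j)
      (fun s hs => ?_) ht
    have := h.evolution' hs x 0 i j
    rw [h.flowTensor_eq_zero h1 hs] at this
    simpa using this
  simpa only [coordMatrix_S2, param_zero] using key

end Flow

/-! ### Diagonal metrics in dimension three -/

section Diagonal

variable {A : Type*}

/-- The entries of the diagonal matrix with diagonal `a, b, b`. -/
def diagEntries [Zero A] (a b : A) (i j : Unit ⊕ Fin 2) : A :=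
  Matrix.diagonal (Sum.elim (fun _ => a) (fun _ => b)) i j

section
variable [Zero A] (a b : A)

@[simp] theorem diagEntries_inl (u v : Unit) : diagEntries a b (Sum.inl u) (Sum.inl v) = a := rfl
@[simp] theorem diagEntries_inl_inr (u : Unit) (k : Fin 2) :
    diagEntries a b (Sum.inl u) (Sum.inr k) = 0 := rfl
@[simp] theorem diagEntries_inr_inl (u : Unit) (k : Fin 2) :
    diagEntries a b (Sum.inr k) (Sum.inl u) = 0 := rfl
@[simp] theorem diagEntries_inr (k l : Fin 2) :
    diagEntries a b (Sum.inr k) (Sum.inr l) = if k = l then b else 0 := by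
  simp [diagEntries, Matrix.diagonal_apply]
end

variable [CommRing A] [Algebra ℝ A] {D : Unit ⊕ Fin 2 → Derivation ℝ A A} {a b a' b' : A}
  (ev : A →ₐ[ℝ] ℝ)

/-- The first tangential derivatives of `b` are assumed to vanish only at the point of evaluation,
as happens at the center of a stereographic chart. Its second derivatives remain and carry the
curvature of the sphere. -/
theorem eval_algScal_diag (ha : ∀ m, D m a' = -(a' * a' * D m a))
    (hb : ∀ m, D m b' = -(b' * b' * D m b)) (hcomm : ∀ i j F, D i (D j F) = D j (D i F))
    (hb0 : ∀ k, ev (D (Sum.inr k) b) = 0) :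
    ev (algScal D (diagEntries a b) (diagEntries a' b')) =
      -(ev b' ^ 2 * ∑ k, ev (D (Sum.inr k) (D (Sum.inr k) b))) -
      2 * ev a' * ev b' * ev (D (Sum.inl ()) (D (Sum.inl ()) b)) +
      1 / 2 * ev a' * ev b' ^ 2 * ev (D (Sum.inl ()) b) ^ 2 +
      ev a' ^ 2 * ev b' * ev (D (Sum.inl ()) a) * ev (D (Sum.inl ()) b) -
      ev b' * (ev a' * ∑ k, ev (D (Sum.inr k) (D (Sum.inr k) a)) -
        1 / 2 * ev a' ^ 2 * ∑ k, ev (D (Sum.inr k) a) ^ 2) := by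
  have h01 : (0 : Fin 2) ≠ 1 := by decide
  have h10 : (1 : Fin 2) ≠ 0 := by decide
  have hc1 := fun F => hcomm (Sum.inr 1) (Sum.inr 0) F
  have hc2 := fun k F => hcomm (Sum.inr k) (Sum.inl ()) F
  have hu : ∀ u : Unit, u = () := fun _ => rfl
  simp only [algScal, algRicci, algChristoffel, Fintype.sum_sum_type, Fin.sum_univ_two,
    Finset.univ_unique, Finset.sum_singleton, diagEntries_inl, diagEntries_inl_inr,
    diagEntries_inr_inl, diagEntries_inr, if_true, h01, h10, if_false, map_zero, zero_mul, mul_zero,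
    add_zero, zero_add, sub_zero, zero_sub, smul_zero, neg_zero, map_add, map_sub, map_neg,
    Derivation.leibniz, Derivation.map_smul, map_mul, map_smul, smul_eq_mul, ha, hb, hc1, hc2, hb0]
  ring

theorem eval_algChristoffel_diag (k l : Fin 2) :
    ev (algChristoffel D (diagEntries a b) (diagEntries a' b') (Sum.inl ()) (Sum.inr k)
      (Sum.inr l)) = if k = l then -(1 / 2) * ev a' * ev (D (Sum.inl ()) b) else 0 := by
  simp only [algChristoffel, Fintype.sum_sum_type,
    Finset.univ_unique, Finset.sum_singleton, diagEntries_inl, diagEntries_inl_inr,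
    diagEntries_inr_inl, diagEntries_inr, zero_mul, Finset.sum_const_zero,
    add_zero, map_zero, zero_sub, map_smul, map_mul, map_neg, smul_eq_mul]
  split_ifs
  · change 1 / 2 * (ev a' * -ev (D (Sum.inl ()) b)) = _
    ring
  · simp

end Diagonal

/-! ### Curvature within a domain depends only on the metric there -/

section Congruence

variable {E : Type*} [NormedAddCommGroup E] [NormedSpace ℝ E]
variable {ι : Type*} [Fintype ι] [DecidableEq ι] (b : Basis ι ℝ E) {S : Set E}
  {G G' : E → Matrix ι ι ℝ}

theorem christoffel_congr (h : EqOn G G' S) (k i j : ι) :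
    EqOn (christoffel b S G k i j) (christoffel b S G' k i j) S := by
  intro y hy
  have : ∀ i j m, pd b S m (fun z => G z i j) y = pd b S m (fun z => G' z i j) y := fun i j m =>
    pd_congr b (fun z hz => by simp only [h hz]) m hy
  simp only [christoffel, this, h hy]

theorem scal_congr (h : EqOn G G' S) {y : E} (hy : y ∈ S) : scal b S G y = scal b S G' y := by
  have h1 := fun k i j => christoffel_congr b h k i j
  have h2 : ∀ m k i j, pd b S m (christoffel b S G k i j) y =
      pd b S m (christoffel b S G' k i j) y := fun m k i j => pd_congr b (h1 k i j) m hy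
  simp only [scal, ricci, h2, h1 _ _ _ hy, h hy]

end Congruence

/-! ### The domain `[1, ∞) × ℝ²` -/

section HalfSpace

/-- The coordinate domain `[1, ∞) × ℝ²`. -/
def halfSpace : Set (ℝ × E2) := Ici 1 ×ˢ univ

theorem isRegularDomain_halfSpace : IsRegularDomain halfSpace where
  uniqueDiffOn := (uniqueDiffOn_Ici 1).prod uniqueDiffOn_univ
  isClosed := isClosed_Ici.prod isClosed_univ
  subset_closure_interior := by
    rw [halfSpace, interior_prod_eq, interior_univ, interior_Ici, closure_prod_eq, closure_Ioi,
      closure_univ]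

theorem bN_inl (u : Unit) : bN (Sum.inl u) = ((1, 0) : ℝ × E2) := by
  simp [bN]

theorem bN_inr (k : Fin 2) : bN (Sum.inr k) = ((0, b2 k) : ℝ × E2) := by
  simp [bN]

theorem pd_inr_eq {F : ℝ × E2 → ℝ} (hF : ContDiffOn ℝ ∞ F halfSpace) {t : ℝ} (ht : 1 ≤ t) (y : E2)
    (k : Fin 2) : pd bN halfSpace (Sum.inr k) F (t, y) = pd b2 univ k (fun w => F (t, w)) y := by
  have hz : (t, y) ∈ halfSpace := ⟨ht, mem_univ y⟩
  have h2 : HasFDerivWithinAt (fun w => F (t, w)) ((fderivWithin ℝ F halfSpace (t, y)).comp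
      (ContinuousLinearMap.inr ℝ ℝ E2)) univ y :=
    HasFDerivWithinAt.comp (f := fun y => (t, y)) y
      ((hF _ hz).differentiableWithinAt (by simp)).hasFDerivWithinAt
      (hasFDerivAt_prodMk_right t y).hasFDerivWithinAt fun y _ => ⟨ht, mem_univ y⟩
  rw [pd, pd, h2.fderivWithin uniqueDiffWithinAt_univ, bN_inr]
  simp

theorem hasDerivWithinAt_pd_inl {F : ℝ × E2 → ℝ} (hF : ContDiffOn ℝ ∞ F halfSpace) {t : ℝ}
    (ht : 1 ≤ t) (y : E2) : HasDerivWithinAt (fun s => F (s, y))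
      (pd bN halfSpace (Sum.inl ()) F (t, y)) (Ici 1) t := by
  have hz : (t, y) ∈ halfSpace := ⟨ht, mem_univ y⟩
  have h2 : HasFDerivWithinAt (fun s => F (s, y)) ((fderivWithin ℝ F halfSpace (t, y)).comp
      (ContinuousLinearMap.inl ℝ ℝ E2)) (Ici 1) t :=
    HasFDerivWithinAt.comp (f := fun s => (s, y)) t
      ((hF _ hz).differentiableWithinAt (by simp)).hasFDerivWithinAt
      (hasFDerivAt_prodMk_left t y).hasFDerivWithinAt fun s hs => ⟨hs, mem_univ y⟩
  refine h2.hasDerivWithinAt.congr_deriv ?_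
  rw [pd, bN_inl]
  simp

theorem pd_inl_eq {F : ℝ × E2 → ℝ} (hF : ContDiffOn ℝ ∞ F halfSpace) {t : ℝ}
    (ht : 1 ≤ t) (y : E2) {d : ℝ} (hd : HasDerivWithinAt (fun s => F (s, y)) d (Ici 1) t) :
    pd bN halfSpace (Sum.inl ()) F (t, y) = d :=
  (uniqueDiffOn_Ici 1 t ht).eq_deriv _ (hasDerivWithinAt_pd_inl hF ht y) hd

/-- The factor of the spherical part of the metric `t² σ` in stereographic coordinates. -/
def sphFactor (z : ℝ × E2) : ℝ := z.1 ^ 2 * (16 * ((‖z.2‖ ^ 2 + 4)⁻¹) ^ 2)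

theorem contDiff_sphFactor : ContDiff ℝ ∞ sphFactor :=
  (contDiff_fst.pow 2).mul (contDiff_const.mul ((contDiff_stereoFactor.comp contDiff_snd).pow 2))

theorem sphFactor_pos {z : ℝ × E2} (hz : z ∈ halfSpace) : 0 < sphFactor z := by
  have : 0 < z.1 := lt_of_lt_of_le one_pos hz.1
  simp only [sphFactor]
  positivity

theorem sphFactor_zero (t : ℝ) : sphFactor (t, 0) = t ^ 2 := by
  simp [sphFactor]
  norm_num

theorem pd_inl_sphFactor {z : ℝ × E2} (hz : z ∈ halfSpace) :
    pd bN halfSpace (Sum.inl ()) sphFactor z =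
      2 * z.1 * (16 * ((‖z.2‖ ^ 2 + 4)⁻¹) ^ 2) := by
  refine pd_inl_eq contDiff_sphFactor.contDiffOn hz.1 z.2 ?_
  have := ((hasDerivAt_pow 2 z.1).mul_const (16 * ((‖z.2‖ ^ 2 + 4)⁻¹) ^ 2)).hasDerivWithinAt
    (s := Ici 1)
  simpa [sphFactor] using this

theorem pd_inl_inl_sphFactor {t : ℝ} (ht : 1 ≤ t) :
    pd bN halfSpace (Sum.inl ()) (pd bN halfSpace (Sum.inl ()) sphFactor) (t, 0) = 2 := by
  refine pd_inl_eq (contDiffOn_pd bN isRegularDomain_halfSpace contDiff_sphFactor.contDiffOn _)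
    ht 0 ?_
  have : HasDerivWithinAt (fun s : ℝ => 2 * s) 2 (Ici 1) t := by
    simpa using ((hasDerivAt_id t).const_mul 2).hasDerivWithinAt
  refine this.congr_of_mem (fun s hs => ?_) ht
  rw [pd_inl_sphFactor ⟨hs, mem_univ _⟩]
  norm_num

theorem pd_inr_sphFactor {z : ℝ × E2} (hz : z ∈ halfSpace) (k : Fin 2) :
    pd bN halfSpace (Sum.inr k) sphFactor z =
      z.1 ^ 2 * pd b2 univ k (fun y : E2 => 16 * ((‖y‖ ^ 2 + 4)⁻¹) ^ 2) z.2 := by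
  rw [← Prod.mk.eta (p := z), pd_inr_eq contDiff_sphFactor.contDiffOn hz.1]
  have hd : DifferentiableAt ℝ (fun y : E2 => 16 * ((‖y‖ ^ 2 + 4)⁻¹) ^ 2) z.2 :=
    (contDiff_const.mul (contDiff_stereoFactor.pow 2)).contDiffAt.differentiableAt
      (n := ∞) (by simp)
  simp only [sphFactor]
  rw [pd_mul_univ (differentiableAt_const _) hd]
  simp [pd]

theorem pd_inr_inr_sphFactor {t : ℝ} (ht : 1 ≤ t) (k : Fin 2) :
    pd bN halfSpace (Sum.inr k) (pd bN halfSpace (Sum.inr k) sphFactor) (t, 0) = -t ^ 2 := by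
  rw [pd_inr_eq (contDiffOn_pd bN isRegularDomain_halfSpace contDiff_sphFactor.contDiffOn _) ht]
  have e : (fun w => pd bN halfSpace (Sum.inr k) sphFactor (t, w)) =
      fun w => t ^ 2 * pd b2 univ k (fun y : E2 => 16 * ((‖y‖ ^ 2 + 4)⁻¹) ^ 2) w :=
    funext fun w => pd_inr_sphFactor (z := (t, w)) ⟨ht, mem_univ w⟩ k
  have hd : DifferentiableAt ℝ (pd b2 univ k (fun y : E2 => 16 * ((‖y‖ ^ 2 + 4)⁻¹) ^ 2)) 0 :=
    (contDiff_pd_univ (contDiff_const.mul (contDiff_stereoFactor.pow 2))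
      k).contDiffAt.differentiableAt (by simp)
  rw [e, pd_mul_univ (differentiableAt_const _) hd, pd_pd_roundFactor]
  simp [pd]
  norm_num

/-- The matrix of the metric `α dt² + t² σ` in stereographic coordinates. -/
def warpedMatrix (α : ℝ × E2 → ℝ) (z : ℝ × E2) : Matrix (Unit ⊕ Fin 2) (Unit ⊕ Fin 2) ℝ :=
  Matrix.diagonal (Sum.elim (fun _ => α z) (fun _ => sphFactor z))

variable {α : ℝ × E2 → ℝ}

theorem warpedMatrix_inv {z : ℝ × E2} (hα : α z ≠ 0) (hz : z ∈ halfSpace) :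
    (warpedMatrix α z)⁻¹ =
      Matrix.diagonal (Sum.elim (fun _ => (α z)⁻¹) (fun _ => (sphFactor z)⁻¹)) := by
  refine Matrix.inv_eq_left_inv ?_
  rw [warpedMatrix, Matrix.diagonal_mul_diagonal, ← Matrix.diagonal_one]
  congr 1
  funext i
  rcases i with i | i
  · simp [hα]
  · simp [(sphFactor_pos hz).ne']

theorem exists_represents_warpedMatrix (hα : ContDiffOn ℝ ∞ α halfSpace)
    (hpos : ∀ z ∈ halfSpace, 0 < α z) : ∃ a b a' b' : smoothOn halfSpace,
    (a : ℝ × E2 → ℝ) = α ∧ (b : ℝ × E2 → ℝ) = sphFactor ∧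
    (∀ z ∈ halfSpace, (a' : ℝ × E2 → ℝ) z = (α z)⁻¹) ∧
    (∀ z ∈ halfSpace, (b' : ℝ × E2 → ℝ) z = (sphFactor z)⁻¹) ∧
    Represents (warpedMatrix α) (diagEntries a b) (diagEntries a' b') ∧
    (∀ m, pdDeriv bN isRegularDomain_halfSpace m a' =
      -(a' * a' * pdDeriv bN isRegularDomain_halfSpace m a)) ∧
    (∀ m, pdDeriv bN isRegularDomain_halfSpace m b' =
      -(b' * b' * pdDeriv bN isRegularDomain_halfSpace m b)) := by
  -- `Represents` asks for the actual inverse matrix at every point. Off the half-space a zero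
  -- diagonal entry makes the whole inverse zero, so its entries need not be the reciprocals; `c`
  -- records the true values.
  have hinv : ∀ z, ∃ c : ℝ × ℝ, (warpedMatrix α z)⁻¹ =
      Matrix.diagonal (Sum.elim (fun _ => c.1) (fun _ => c.2)) := by
    intro z
    rw [warpedMatrix, Matrix.inv_diagonal]
    by_cases hu : IsUnit (Sum.elim (fun _ : Unit => α z) (fun _ : Fin 2 => sphFactor z))
    · refine ⟨((α z)⁻¹, (sphFactor z)⁻¹), ?_⟩
      congr 1
      refine left_inv_eq_right_inv (Ring.inverse_mul_cancel _ hu) ?_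
      rw [Pi.isUnit_iff] at hu
      funext i
      rcases i with i | i
      · simpa using mul_inv_cancel₀ (hu (Sum.inl ())).ne_zero
      · simpa using mul_inv_cancel₀ (hu (Sum.inr 0)).ne_zero
    · refine ⟨(0, 0), ?_⟩
      rw [Ring.inverse_non_unit _ hu]
      congr 1
      funext i
      rcases i with i | i <;> rfl
  choose c hc using hinv
  have hunit : ∀ z ∈ halfSpace, IsUnit (warpedMatrix α z).det := by
    intro z hz
    rw [warpedMatrix, Matrix.det_diagonal]
    refine (Finset.prod_ne_zero_iff.2 fun i _ => ?_).isUnit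
    rcases i with i | i
    · exact (hpos z hz).ne'
    · exact (sphFactor_pos hz).ne'
  have hc' : ∀ z ∈ halfSpace, c z = ((α z)⁻¹, (sphFactor z)⁻¹) := by
    intro z hz
    have h1 := (hc z).symm.trans (warpedMatrix_inv (hpos z hz).ne' hz)
    have h2 := Matrix.diagonal_injective h1
    exact Prod.ext (congrFun h2 (Sum.inl ())) (congrFun h2 (Sum.inr 0))
  have hs1 : ContDiffOn ℝ ∞ (fun z => (c z).1) halfSpace :=
    (hα.inv fun z hz => (hpos z hz).ne').congr fun z hz => by rw [hc' z hz]; rfl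
  have hs2 : ContDiffOn ℝ ∞ (fun z => (c z).2) halfSpace :=
    (contDiff_sphFactor.contDiffOn.inv fun z hz => (sphFactor_pos hz).ne').congr
      fun z hz => by rw [hc' z hz]; rfl
  have hrep : Represents (warpedMatrix α)
      (diagEntries (smoothOn.of α hα) (smoothOn.of sphFactor contDiff_sphFactor.contDiffOn))
      (diagEntries (smoothOn.of _ hs1) (smoothOn.of _ hs2)) := by
    refine ⟨fun i j z => ?_, fun i j z => ?_, hunit⟩
    · rcases i with i | i <;> rcases j with j | j <;>
        simp [warpedMatrix, Matrix.diagonal_apply]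
      split_ifs <;> simp
    · rw [hc z]
      rcases i with i | i <;> rcases j with j | j <;>
        simp [Matrix.diagonal_apply]
      split_ifs <;> simp
  refine ⟨_, _, _, _, rfl, rfl, fun z hz => ?_, fun z hz => ?_, hrep, fun m => ?_, fun m => ?_⟩
  · simp [hc' z hz]
  · simp [hc' z hz]
  · have := hrep.pdDeriv_inv bN isRegularDomain_halfSpace m (Sum.inl ()) (Sum.inl ())
    simp only [Fintype.sum_sum_type, Finset.univ_unique, Finset.sum_singleton, diagEntries_inl,
      diagEntries_inl_inr, diagEntries_inr_inl, zero_mul, mul_zero, Finset.sum_const_zero,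
      add_zero] at this
    rw [this]
    ring
  · have := hrep.pdDeriv_inv bN isRegularDomain_halfSpace m (Sum.inr 0) (Sum.inr 0)
    simp only [Fintype.sum_sum_type, Finset.univ_unique, Fin.sum_univ_two,
      diagEntries_inl_inr, diagEntries_inr_inl, diagEntries_inr, zero_mul, mul_zero, if_true,
      Finset.sum_const_zero, add_zero, zero_add, show ((0 : Fin 2) = 1) = False by simp,
      show ((1 : Fin 2) = 0) = False by simp, if_false] at this
    rw [this]
    ring

/-- The scalar curvature of `α dt² + t² σ` at the center of a stereographic chart. -/
theorem scal_warpedMatrix (hα : ContDiffOn ℝ ∞ α halfSpace) (hpos : ∀ z ∈ halfSpace, 0 < α z)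
    {t : ℝ} (ht : 1 ≤ t) :
    scal bN halfSpace (warpedMatrix α) (t, 0) =
      2 / t ^ 2 - 2 / (t ^ 2 * α (t, 0)) +
      2 * pd bN halfSpace (Sum.inl ()) α (t, 0) / (t * α (t, 0) ^ 2) -
      1 / t ^ 2 * ((∑ k, pd b2 univ k (pd b2 univ k (fun w => α (t, w))) 0) / α (t, 0) -
        (∑ k, pd b2 univ k (fun w => α (t, w)) 0 ^ 2) / (2 * α (t, 0) ^ 2)) := by
  obtain ⟨a, b, a', b', ha, hb, ha', hb', hrep, hda, hdb⟩ :=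
    exists_represents_warpedMatrix hα hpos
  have hz : (t, (0 : E2)) ∈ halfSpace := ⟨ht, mem_univ _⟩
  have hb0 : ∀ k, smoothOn.eval (t, (0 : E2))
      (pdDeriv bN isRegularDomain_halfSpace (Sum.inr k) b) = 0 := by
    intro k
    rw [smoothOn.eval_apply, coe_pdDeriv, hb, pd_inr_sphFactor hz, pd_roundFactor]
    simp
  have key := eval_algScal_diag (smoothOn.eval (t, (0 : E2))) hda hdb
    (fun i j F => pdDeriv_comm bN isRegularDomain_halfSpace i j F) hb0
  simp only [smoothOn.eval_apply, hrep.coe_scal, coe_pdDeriv, ha, hb, ha' _ hz, hb' _ hz,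
    sphFactor_zero, pd_inr_inr_sphFactor ht, pd_inl_inl_sphFactor ht, pd_inl_sphFactor hz] at key
  have e1 : ∀ k, pd bN halfSpace (Sum.inr k) α (t, 0) =
      pd b2 univ k (fun w => α (t, w)) 0 := fun k => pd_inr_eq hα ht 0 k
  have e2 : ∀ k, pd bN halfSpace (Sum.inr k) (pd bN halfSpace (Sum.inr k) α) (t, 0) =
      pd b2 univ k (pd b2 univ k (fun w => α (t, w))) 0 := by
    intro k
    rw [pd_inr_eq (contDiffOn_pd bN isRegularDomain_halfSpace hα _) ht]
    congr 1
    funext w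
    exact pd_inr_eq hα ht w k
  simp only [e1, e2] at key
  rw [key]
  have h1 := (hpos _ hz).ne'
  have h2 : t ≠ 0 := by linarith
  simp only [Finset.sum_const, Finset.card_univ, Fintype.card_fin, norm_zero]
  field_simp
  ring

/-- The Christoffel symbols `Γ^t_{kl}` of `α dt² + t² σ`. -/
theorem christoffel_warpedMatrix (hα : ContDiffOn ℝ ∞ α halfSpace)
    (hpos : ∀ z ∈ halfSpace, 0 < α z) {t : ℝ} (ht : 1 ≤ t) (k l : Fin 2) :
    christoffel bN halfSpace (warpedMatrix α) (Sum.inl ()) (Sum.inr k) (Sum.inr l) (t, 0) =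
      if k = l then -t / α (t, 0) else 0 := by
  obtain ⟨a, b, a', b', ha, hb, ha', hb', hrep, -, -⟩ :=
    exists_represents_warpedMatrix hα hpos
  have hz : (t, (0 : E2)) ∈ halfSpace := ⟨ht, mem_univ _⟩
  have key := eval_algChristoffel_diag (D := pdDeriv bN isRegularDomain_halfSpace)
    (a := a) (b := b) (a' := a') (b' := b') (smoothOn.eval (t, (0 : E2))) k l
  simp only [smoothOn.eval_apply, hrep.coe_christoffel, coe_pdDeriv, hb, ha' _ hz,
    pd_inl_sphFactor hz] at key
  rw [key]
  split_ifs
  · norm_num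
    ring
  · rfl

end HalfSpace

/-! ### Coordinates on `N` -/

section Product

theorem extChartAt_N (p q : ℝ × S2) :
    extChartAt IN p q = (q.1, extChartAt (𝓡 2) p.2 q.2) := by
  rw [extChartAt_prod]
  rfl

theorem extChartAt_N_symm (p : ℝ × S2) (z : ℝ × E2) :
    (extChartAt IN p).symm z = (z.1, param p.2 z.2) := by
  rw [extChartAt_prod]
  rfl

theorem target_extChartAt_N (p : ℝ × S2) : (extChartAt IN p).target = univ := by
  rw [extChartAt_prod, PartialEquiv.prod_target, target_extChartAt_S2, extChartAt_model_space_eq_id]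
  simp

theorem chartDomain_N (p : ℝ × S2) : chartDomain IN N p = halfSpace := by
  rw [chartDomain, target_extChartAt_N, univ_inter]
  ext z
  rw [mem_preimage, extChartAt_N_symm]
  exact ⟨fun h => ⟨h.1, mem_univ _⟩, fun h => ⟨h.1, mem_univ _⟩⟩

theorem extChartAt_N_self (p : ℝ × S2) : extChartAt IN p p = (p.1, 0) := by
  rw [extChartAt_N, extChartAt_S2_self]

theorem hasMFDerivAt_extChartAt_N_symm (p : ℝ × S2) (z : ℝ × E2) :
    HasMFDerivAt 𝓘(ℝ, ℝ × E2) IN (extChartAt IN p).symm z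
      ((ContinuousLinearMap.fst ℝ ℝ E2).prod
        ((dparam p.2 z.2).comp (ContinuousLinearMap.snd ℝ ℝ E2)) : ℝ × E2 →L[ℝ] ℝ × E2) := by
  have h1 : HasMFDerivAt 𝓘(ℝ, ℝ × E2) 𝓘(ℝ, ℝ) (Prod.fst : ℝ × E2 → ℝ) z
      (ContinuousLinearMap.fst ℝ ℝ E2) := hasFDerivAt_fst.hasMFDerivAt
  have h2 : HasMFDerivAt 𝓘(ℝ, ℝ × E2) 𝓘(ℝ, E2) (Prod.snd : ℝ × E2 → E2) z
      (ContinuousLinearMap.snd ℝ ℝ E2) := hasFDerivAt_snd.hasMFDerivAt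
  have h3 : HasMFDerivAt 𝓘(ℝ, E2) (𝓡 2) (param p.2) z.2 (dparam p.2 z.2) :=
    ((contMDiff_param p.2).mdifferentiableAt (by simp)).hasMFDerivAt
  have h4 := h1.prodMk (h3.comp z h2)
  have e : ((extChartAt IN p).symm : ℝ × E2 → ℝ × S2) = fun z => (z.1, param p.2 z.2) :=
    funext fun z => extChartAt_N_symm p z
  rw [e]
  exact h4

/-- The coordinate vector fields on `N`, as vectors of the model space. -/
def coordVecN (p : ℝ × S2) (z : ℝ × E2) (i : Unit ⊕ Fin 2) : ℝ × E2 := coordVec IN bN p z i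

theorem coordVecN_inl (p : ℝ × S2) (z : ℝ × E2) (u : Unit) :
    coordVecN p z (Sum.inl u) = (1, 0) := by
  have h := (hasMFDerivAt_extChartAt_N_symm p z).mfderiv
  have hr : range IN = univ := by simp
  simp only [coordVecN, coordVec, hr, mfderivWithin_univ]
  rw [h, bN_inl]
  exact Prod.ext rfl (map_zero (dparam p.2 z.2))

theorem coordVecN_inr (p : ℝ × S2) (z : ℝ × E2) (k : Fin 2) :
    coordVecN p z (Sum.inr k) = (0, coordVecE p.2 z.2 k) := by
  have h := (hasMFDerivAt_extChartAt_N_symm p z).mfderiv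
  have hr : range IN = univ := by simp
  simp only [coordVecN, coordVec, hr, mfderivWithin_univ]
  rw [h, bN_inr, coordVecE_eq]
  rfl

/-- A tensor field on `ℝ × S²`, as a function with values in the bilinear forms on the model
space. -/
def formN (G : Tensor2 IN (ℝ × S2)) (q : ℝ × S2) : LinearMap.BilinForm ℝ (ℝ × E2) := G q

theorem coordMatrix_N (G : Tensor2 IN (ℝ × S2)) (p : ℝ × S2) (z : ℝ × E2) (i j : Unit ⊕ Fin 2) :
    coordMatrix IN bN G p z i j =
      formN G (z.1, param p.2 z.2) (coordVecN p z i) (coordVecN p z j) := by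
  rw [← extChartAt_N_symm p z]
  rfl

theorem formN_foliatedMetric (a : ℝ × S2 → ℝ) (g : ℝ → Tensor2 (𝓡 2) S2) (q : ℝ × S2)
    (v w : ℝ × E2) : formN (foliatedMetric a g) q v w =
      a q * (v.1 * w.1) + q.1 ^ 2 * formE (g q.1) q.2 v.2 w.2 := rfl

theorem coordMatrix_eq_warpedMatrix {G : Tensor2 IN (ℝ × S2)} {a : ℝ × S2 → ℝ}
    {g : ℝ → Tensor2 (𝓡 2) S2} (hg : ∀ t, 1 ≤ t → g t = roundMetric)
    (hG : ∀ p ∈ N, G p = foliatedMetric a g p) (p : ℝ × S2) :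
    EqOn (coordMatrix IN bN G p) (warpedMatrix fun z => a (z.1, param p.2 z.2)) halfSpace := by
  intro z hz
  have hq : (z.1, param p.2 z.2) ∈ N := ⟨hz.1, mem_univ _⟩
  have hG' : formN G (z.1, param p.2 z.2) = formN (foliatedMetric a g) (z.1, param p.2 z.2) :=
    hG _ hq
  ext i j
  rw [coordMatrix_N, hG', formN_foliatedMetric, hg _ hz.1]
  rcases i with i | i <;> rcases j with j | j <;>
    simp only [coordVecN_inl, coordVecN_inr, warpedMatrix]
  · simp
  · simp
  · simp
  · rw [← coordMatrix_S2, coordMatrix_roundMetric]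
    simp [Matrix.diagonal_apply, sphFactor]

variable {G : Tensor2 IN (ℝ × S2)} {a : ℝ × S2 → ℝ} {g : ℝ → Tensor2 (𝓡 2) S2}

theorem contDiffOn_comp_param_N {F : ℝ × S2 → ℝ} (hF : ContMDiffOn IN 𝓘(ℝ, ℝ) ∞ F N) (x : S2) :
    ContDiffOn ℝ ∞ (fun z : ℝ × E2 => F (z.1, param x z.2)) halfSpace := by
  rw [← contMDiffOn_iff_contDiffOn]
  have h1 : ContMDiff 𝓘(ℝ, ℝ × E2) IN ∞ (fun z : ℝ × E2 => (z.1, param x z.2)) :=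
    ContMDiff.prodMk contDiff_fst.contMDiff ((contMDiff_param x).comp contDiff_snd.contMDiff)
  exact hF.comp h1.contMDiffOn fun z hz => ⟨hz.1, mem_univ _⟩

/-- The scalar curvature of a metric of the form `a dt² + t² σ`. -/
theorem scalarCurvature_foliated (hg : ∀ t, 1 ≤ t → g t = roundMetric)
    (hG : ∀ p ∈ N, G p = foliatedMetric a g p) (ha : ContMDiffOn IN 𝓘(ℝ, ℝ) ∞ a N)
    (hpos : ∀ p ∈ N, 0 < a p) {t : ℝ} (ht : 1 ≤ t) (x : S2) :
    scalarCurvature IN bN N G (t, x) =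
      2 / t ^ 2 - 2 / (t ^ 2 * a (t, x)) +
      2 * pd bN halfSpace (Sum.inl ()) (fun z => a (z.1, param x z.2)) (t, 0) /
        (t * a (t, x) ^ 2) -
      1 / t ^ 2 * ((∑ k, pd b2 univ k (pd b2 univ k (fun w => a (t, param x w))) 0) / a (t, x) -
        (∑ k, pd b2 univ k (fun w => a (t, param x w)) 0 ^ 2) / (2 * a (t, x) ^ 2)) := by
  have hz : (t, (0 : E2)) ∈ halfSpace := ⟨ht, mem_univ _⟩
  rw [scalarCurvature, chartDomain_N, extChartAt_N_self]
  change scal bN halfSpace (coordMatrix IN bN G (t, x)) (t, 0) = _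
  rw [scal_congr bN (coordMatrix_eq_warpedMatrix hg hG (t, x)) hz,
    scal_warpedMatrix (contDiffOn_comp_param_N ha x) (fun z hz => hpos _ ⟨hz.1, mem_univ _⟩) ht]
  simp only [param_zero]

/-- The mean curvature of the boundary for a metric of the form `a dt² + t² σ`. -/
theorem meanCurvature_foliated (hg : ∀ t, 1 ≤ t → g t = roundMetric)
    (hG : ∀ p ∈ N, G p = foliatedMetric a g p) (ha : ContMDiffOn IN 𝓘(ℝ, ℝ) ∞ a N)
    (hpos : ∀ p ∈ N, 0 < a p) (x : S2) :
    meanCurvature G (1, x) = 2 / √(a (1, x)) := by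
  have hz : ((1 : ℝ), (0 : E2)) ∈ halfSpace := ⟨le_refl (1 : ℝ), mem_univ _⟩
  have hpos' : ∀ z ∈ halfSpace, 0 < a (z.1, param x z.2) := fun z hz => hpos _ ⟨hz.1, mem_univ _⟩
  have h1 := coordMatrix_eq_warpedMatrix hg hG (1, x)
  have h2 := h1 hz
  have h3 : (warpedMatrix (fun z => a (z.1, param x z.2)) (1, 0)).toBlocks₂₂ = 1 := by
    ext i j
    simp only [warpedMatrix, Matrix.toBlocks₂₂, Matrix.of_apply, Matrix.diagonal_apply,
      Matrix.one_apply, Sum.inr.injEq, Sum.elim_inr, sphFactor_zero, one_pow]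
  have h4 : (warpedMatrix (fun z => a (z.1, param x z.2)) (1, 0))⁻¹ (Sum.inl ()) (Sum.inl ()) =
      (a (1, x))⁻¹ := by
    rw [warpedMatrix_inv (hpos' _ hz).ne' hz]
    simp [param_zero]
  have h5 := fun i j => (christoffel_congr bN h1 (Sum.inl ()) (Sum.inr i) (Sum.inr j) hz).trans
    (christoffel_warpedMatrix (contDiffOn_comp_param_N ha x) hpos' le_rfl i j)
  have ha0 : 0 < a (1, x) := hpos _ ⟨le_refl (1 : ℝ), mem_univ _⟩
  simp only [meanCurvature, chartDomain_N, extChartAt_N_self, h5, h2, h3, h4, inv_one,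
    Fin.sum_univ_two, Matrix.one_apply, param_zero]
  have hs : √(a (1, x)) ≠ 0 := (Real.sqrt_pos.2 ha0).ne'
  have hs2 : √(a (1, x)) ^ 2 = a (1, x) := Real.sq_sqrt ha0.le
  simp only [Real.sqrt_inv]
  simp
  field_simp
  rw [← hs2]
  field_simp
  norm_num

end Product

/-! ### Admissibility -/

/-- Since `R = 2`, the integrand is `(2 + 6 s²) / 4` times a positive exponential, so `KSet` lies in
`(-∞, 0]`. No bound on `|M|` enters, and `√(2K)` is zero because the real square root vanishes on
nonpositive numbers. -/
theorem isAdmissible_of_eq_roundMetric {g : ℝ → Tensor2 (𝓡 2) S2} {f : ℝ → S2 → ℝ}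
    (h : IsModifiedRicciFlow g f) (h1 : g 1 = roundMetric) {c : ℝ} (hc : 0 < c) :
    IsAdmissible g f (fun _ => -6) (fun _ => c) := by
  have hK : ∀ k ∈ KSet g f (fun _ => -6), k ≤ 0 := by
    rintro k ⟨t, ht, rfl⟩
    refine neg_nonpos.2 (intervalIntegral.integral_nonneg ht fun s hs => ?_)
    refine mul_nonneg (div_nonneg (Real.iInf_nonneg fun x => ?_) (by norm_num)) (Real.exp_pos _).le
    rw [h.scalarS2_eq_two h1 hs.1]
    nlinarith [sq_nonneg s]
  refine ⟨⟨0, hK⟩, fun _ => ?_⟩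
  rw [Real.sqrt_eq_zero_of_nonpos (by linarith [Real.sSup_nonpos hK]), mul_zero]
  exact hc

/-! ### The static flow -/

theorem roundMetric_symm (x : S2) (v w : TangentSpace (𝓡 2) x) :
    roundMetric x v w = roundMetric x w v :=
  real_inner_comm (inclDeriv x w) (inclDeriv x v)

theorem roundMetric_pos (x : S2) (v : TangentSpace (𝓡 2) x) (hv : v ≠ 0) :
    0 < roundMetric x v v := by
  refine real_inner_self_pos (x := inclDeriv x v) |>.2 fun h0 => hv ?_
  have := Fact.mk (@finrank_euclideanSpace_fin ℝ _ (2 + 1))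
  exact injective_mvfderiv_subtypeVal_sphere (n := 2) x (h0.trans (map_zero (inclDeriv x)).symm)

theorem scal_roundMetric (p : S2) (y : E2) :
    scal b2 univ (coordMatrix (𝓡 2) b2 roundMetric p) y = 2 := by
  rw [coordMatrix_roundMetric_eq, scal_round]

theorem areaMeasure_roundMetric :
    areaMeasure roundMetric = (volume : Measure (EuclideanSpace ℝ (Fin 3))).toSphere := by
  have : ∀ x : S2, ENNReal.ofReal
      (√((coordMatrix (𝓡 2) b2 roundMetric x (extChartAt (𝓡 2) x x)).det /
        (coordMatrix (𝓡 2) b2 roundMetric x (extChartAt (𝓡 2) x x)).det)) = 1 := by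
    intro x
    rw [div_self, Real.sqrt_one, ENNReal.ofReal_one]
    rw [coordMatrix_roundMetric_eq]
    exact (isMetric_round.det_pos _).ne'
  simp only [areaMeasure, this]
  exact withDensity_one

theorem meanScalar_roundMetric : meanScalar roundMetric = 2 := by
  have h : ∀ x, scalarS2 roundMetric x = 2 := fun x => by
    rw [scalarS2_eq, scal_roundMetric]
  have : NeZero (volume : Measure (EuclideanSpace ℝ (Fin 3))).toSphere :=
    ⟨Measure.toSphere_ne_zero _⟩
  rw [meanScalar, areaMeasure_roundMetric]
  simp only [h]
  exact average_const _ _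

theorem pd_zero (i : Fin 2) : pd b2 univ i (fun _ => (0 : ℝ)) = fun _ => 0 := by
  funext y
  simp [pd]

theorem hess_zero (G : E2 → Matrix (Fin 2) (Fin 2) ℝ) (i j : Fin 2) (y : E2) :
    hess b2 univ G (fun _ => 0) i j y = 0 := by
  simp [hess, pd_zero]

theorem isModifiedRicciFlow_roundMetric :
    IsModifiedRicciFlow (fun _ => roundMetric) (fun _ _ => 0) where
  symm _ _ := roundMetric_symm
  pos _ _ := roundMetric_pos
  smooth p i j := by
    simp only [coordMatrix_roundMetric]
    split_ifs
    · exact (contDiff_const.mul ((contDiff_stereoFactor.comp contDiff_snd).pow 2)).contDiffOn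
    · exact contDiffOn_const
  smooth_potential _ _ := contMDiff_const
  potential t _ p y _ := by
    rw [chartDomain_univ_S2, scal_roundMetric, meanScalar_roundMetric, sub_self]
    change lap b2 univ _ (fun _ => 0) y = 0
    simp only [lap, hess_zero, mul_zero, Finset.sum_const_zero]
  evolution t _ p y _ i j := by
    have h : flowTensor roundMetric (fun _ => 0) p y i j = 0 := by
      simp only [flowTensor, Matrix.of_apply, chartDomain_univ_S2, scal_roundMetric,
        meanScalar_roundMetric]
      change ((2 - 2) * _ + 2 * hess b2 univ _ (fun _ => 0) i j y) / 2 = 0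
      rw [hess_zero]
      ring
    rw [h, mul_zero]
    exact hasDerivWithinAt_const _ _ _

/-! ### The anti-de Sitter Schwarzschild metric -/

theorem contMDiffOn_comp_fst {φ : ℝ → ℝ} (hφ : ContDiffOn ℝ ∞ φ (Ici 1)) :
    ContMDiffOn IN 𝓘(ℝ, ℝ) ∞ (fun p : ℝ × S2 => φ p.1) N :=
  hφ.contMDiffOn.comp contMDiff_fst.contMDiffOn fun _ hp => hp.1

/-- The scalar curvature of a metric of the form `φ(t) dt² + t² σ`. -/
theorem scalarCurvature_of_radial {G : Tensor2 IN (ℝ × S2)} {φ : ℝ → ℝ}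
    (hG : ∀ p ∈ N, G p = foliatedMetric (fun q => φ q.1) (fun _ => roundMetric) p)
    (hφ : ContDiffOn ℝ ∞ φ (Ici 1)) (hpos : ∀ t, 1 ≤ t → 0 < φ t) {t d : ℝ} (ht : 1 ≤ t)
    (hd : HasDerivWithinAt φ d (Ici 1) t) (x : S2) :
    scalarCurvature IN bN N G (t, x) =
      2 / t ^ 2 - 2 / (t ^ 2 * φ t) + 2 * d / (t * φ t ^ 2) := by
  have h := contMDiffOn_comp_fst hφ
  rw [scalarCurvature_foliated (fun _ _ => rfl) hG h (fun p hp => hpos _ hp.1) ht x,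
    pd_inl_eq (contDiffOn_comp_param_N h x) ht 0 hd]
  have hc : ∀ k, pd b2 univ k (fun _ => φ t) = fun _ => 0 := fun k => by
    funext y
    simp [pd]
  simp [hc, pd_zero]

variable {m : ℝ}

/-- The function `1 + t² - 2m/t`. -/
def adsPotential (m t : ℝ) : ℝ := 1 + t ^ 2 - 2 * m / t

theorem adsPotential_pos (hm0 : 0 < m) (hm1 : m < 1) {t : ℝ} (ht : 1 ≤ t) :
    0 < adsPotential m t := by
  have : 2 * m / t ≤ 2 * m := div_le_self (by linarith) ht
  rw [adsPotential]
  nlinarith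

theorem contDiffOn_adsPotential : ContDiffOn ℝ ∞ (adsPotential m) (Ici 1) :=
  (contDiff_const.add (contDiff_id.pow 2)).contDiffOn.sub
    (contDiffOn_const.div contDiffOn_id fun _ ht => (lt_of_lt_of_le one_pos ht).ne')

theorem hasDerivAt_adsPotential {t : ℝ} (ht : t ≠ 0) :
    HasDerivAt (adsPotential m) (2 * t + 2 * m / t ^ 2) t := by
  have h := (((hasDerivAt_id t).pow 2).const_add 1).sub
    ((hasDerivAt_inv ht).const_mul (2 * m))
  refine (h.congr_deriv ?_).congr_of_eventuallyEq (Filter.Eventually.of_forall fun s => ?_)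
  · simp
    field_simp
  · simp [adsPotential, div_eq_mul_inv]

/-- With `V = 1 + t² - 2m/t` and `a = 1 / V` the scalar curvature is `(2 / t²) (1 - (t V)')`. As `t
V = t + t³ - 2m`, this is `-6`. The boundary mean curvature is `2 √V(1) = 2 √(2 (1 - m))`. -/
theorem isRicciFlowExtension_adsSchwarzschild (hm0 : 0 < m) (hm1 : m < 1) :
    IsRicciFlowExtension roundMetric (fun _ => -6) (fun _ => √(8 * (1 - m)))
      (adsSchwarzschild m) := by
  have hpos := fun t (ht : 1 ≤ t) => adsPotential_pos hm0 hm1 ht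
  have hinv : ContDiffOn ℝ ∞ (fun t => (adsPotential m t)⁻¹) (Ici 1) :=
    contDiffOn_adsPotential.inv fun t ht => (hpos t ht).ne'
  have hG : ∀ p ∈ N, adsSchwarzschild m p =
      foliatedMetric (fun q => (adsPotential m q.1)⁻¹) (fun _ => roundMetric) p := fun _ _ => rfl
  have hu : ∀ t, 1 ≤ t → 0 < (1 + t ^ 2) * (adsPotential m t)⁻¹ := fun t ht =>
    mul_pos (by positivity) (inv_pos.2 (hpos t ht))
  refine ⟨fun _ => roundMetric, fun _ _ => 0,
    fun p => √((1 + p.1 ^ 2) * (adsPotential m p.1)⁻¹), isModifiedRicciFlow_roundMetric, rfl,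
    contMDiffOn_comp_fst (φ := fun t => √((1 + t ^ 2) * (adsPotential m t)⁻¹)) ?_,
    fun p hp => Real.sqrt_pos.2 (hu _ hp.1), fun p hp => ?_, fun p hp => ?_, fun x => ?_⟩
  · exact ((contDiff_const.add (contDiff_id.pow 2)).contDiffOn.mul hinv).sqrt
      fun t ht => (hu t ht).ne'
  · have e : √((1 + p.1 ^ 2) * (adsPotential m p.1)⁻¹) ^ 2 / (1 + p.1 ^ 2) =
        (1 + p.1 ^ 2 - 2 * m / p.1)⁻¹ := by
      rw [Real.sq_sqrt (hu _ hp.1).le, mul_div_cancel_left₀ _ (by positivity)]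
      rfl
    simp only [adsSchwarzschild, foliatedMetric, e]
  · obtain ⟨t, x⟩ := p
    have ht : 1 ≤ t := hp.1
    have ht0 : t ≠ 0 := by linarith
    have hd := ((hasDerivAt_adsPotential (m := m) ht0).inv
      (hpos t ht).ne').hasDerivWithinAt (s := Ici 1)
    rw [scalarCurvature_of_radial hG hinv (fun t ht => inv_pos.2 (hpos t ht)) ht hd x]
    have h0 := (hpos t ht).ne'
    have hv : adsPotential m t = 1 + t ^ 2 - 2 * m / t := rfl
    generalize adsPotential m t = v at *
    field_simp
    rw [hv]
    field_simp
    ring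
  · rw [meanCurvature_foliated (fun _ _ => rfl) hG (contMDiffOn_comp_fst hinv)
      (fun p hp => inv_pos.2 (hpos _ hp.1)) x]
    have e : adsPotential m 1 = 2 * (1 - m) := by
      simp [adsPotential]
      ring
    simp only [e]
    rw [Real.sqrt_inv, div_inv_eq_mul, show 8 * (1 - m) = 2 ^ 2 * (2 * (1 - m)) by ring,
      Real.sqrt_mul (x := 2 ^ 2) (by norm_num), Real.sqrt_sq zero_le_two]

/-! ### Uniqueness -/

section Uniqueness

variable {m : ℝ} {G : Tensor2 IN (ℝ × S2)} {a : ℝ × S2 → ℝ} {g : ℝ → Tensor2 (𝓡 2) S2}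

/-- If `a dt² + t² σ` has scalar curvature `-6` and `ς a(t, ·)` has a minimum at `x`, then
`ς (t / a - t - t³)` is nonincreasing in `t` at `(t, x)`. -/
theorem exists_hasDerivAt_of_isMin (hg : ∀ t, 1 ≤ t → g t = roundMetric)
    (hG : ∀ p ∈ N, G p = foliatedMetric a g p) (ha : ContMDiffOn IN 𝓘(ℝ, ℝ) ∞ a N)
    (hpos : ∀ p ∈ N, 0 < a p) (hscal : ∀ p ∈ N, scalarCurvature IN bN N G p = -6) {t : ℝ}
    (ht : 1 < t) {x : S2} {ς : ℝ} (hmin : ∀ z, ς * a (t, x) ≤ ς * a (t, z)) :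
    ∃ d, ς * d ≤ 0 ∧
      HasDerivAt (fun s => s / a (s, x) - (s + s ^ 3 - 2 * m)) d t := by
  have ht1 : 1 ≤ t := ht.le
  have hq : (t, x) ∈ N := ⟨ht1, mem_univ _⟩
  have hA := contDiffOn_comp_param_N ha x
  have hD : HasDerivAt (fun s => a (s, x))
      (pd bN halfSpace (Sum.inl ()) (fun z => a (z.1, param x z.2)) (t, 0)) t := by
    have := (hasDerivWithinAt_pd_inl hA ht1 0).hasDerivAt (Ici_mem_nhds ht)
    simpa only [param_zero] using this
  have hF : ContDiff ℝ ∞ (fun w => a (t, param x w)) := by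
    rw [← contDiffOn_univ]
    exact hA.comp (contDiff_prodMk_right t).contDiffOn fun y _ => ⟨ht1, mem_univ y⟩
  have hcF : ContDiff ℝ ∞ (fun w => -ς * a (t, param x w)) := contDiff_const.mul hF
  -- The sign `ς` treats minima and maxima of `a(t, ·)` together.
  have hmax : IsLocalMax (fun w => -ς * a (t, param x w)) 0 :=
    Filter.Eventually.of_forall fun w => by
      simp only [param_zero]
      linarith [hmin (param x w)]
  have hpdF : ∀ k w, pd b2 univ k (fun w => -ς * a (t, param x w)) w =
      -ς * pd b2 univ k (fun w => a (t, param x w)) w := by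
    intro k w
    rw [pd_mul_univ (differentiableAt_const _) (hF.contDiffAt.differentiableAt (by simp))]
    simp [pd]
  have hpdpdF : ∀ k, pd b2 univ k (pd b2 univ k (fun w => -ς * a (t, param x w))) 0 =
      -ς * pd b2 univ k (pd b2 univ k (fun w => a (t, param x w))) 0 := by
    intro k
    rw [show pd b2 univ k (fun w => -ς * a (t, param x w)) = fun w =>
      -ς * pd b2 univ k (fun w => a (t, param x w)) w from funext (hpdF k),
      pd_mul_univ (differentiableAt_const _)
        ((contDiff_pd_univ hF k).contDiffAt.differentiableAt (by simp))]
    simp [pd]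
  have hgrad : ∀ k, ς * pd b2 univ k (fun w => a (t, param x w)) 0 = 0 := by
    intro k
    have := pd_eq_zero_of_isLocalMax hmax k
    rw [hpdF] at this
    linarith
  have hhess : ∀ k, 0 ≤ ς * pd b2 univ k (pd b2 univ k (fun w => a (t, param x w))) 0 := by
    intro k
    have := hessian_nonpos_of_isLocalMax hcF hmax (Pi.single k 1)
    rw [Finset.sum_eq_single k (fun i _ hi => by simp [hi]) (by simp),
      Finset.sum_eq_single k (fun i _ hi => by simp [hi]) (by simp), hpdpdF] at this
    simp only [Pi.single_eq_same] at this
    linarith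
  have hR := hscal _ hq
  rw [scalarCurvature_foliated hg hG ha hpos ht1 x] at hR
  have ha0 : 0 < a (t, x) := hpos _ hq
  set D := pd bN halfSpace (Sum.inl ()) (fun z => a (z.1, param x z.2)) (t, 0)
  refine ⟨(1 * a (t, x) - t * D) / a (t, x) ^ 2 - (1 + 3 * t ^ 2), ?_, ?_⟩
  · simp only [Fin.sum_univ_two] at hR
    set p0 := pd b2 univ 0 (fun w => a (t, param x w)) 0
    set p1 := pd b2 univ 1 (fun w => a (t, param x w)) 0
    set q0 := pd b2 univ 0 (pd b2 univ 0 (fun w => a (t, param x w))) 0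
    set q1 := pd b2 univ 1 (pd b2 univ 1 (fun w => a (t, param x w))) 0
    generalize a (t, x) = α at *
    have h0 : 0 < t := by linarith
    -- The curvature equation solved for `∂_t (t / a)`: the excess over `1 + 3 t²` consists of
    -- tangential terms only.
    have key : (1 * α - t * D) / α ^ 2 - (1 + 3 * t ^ 2) =
        -((q0 + q1) / (2 * α)) + (p0 ^ 2 + p1 ^ 2) / (4 * α ^ 2) := by
      field_simp at hR ⊢
      linear_combination (-2) * hR
    -- Only the products of `ς` with the tangential derivatives are known to vanish, so the gradient
    -- term is grouped as `(ς p) p`.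
    have e : ς * ((1 * α - t * D) / α ^ 2 - (1 + 3 * t ^ 2)) =
        -((ς * q0 + ς * q1) / (2 * α)) + (ς * p0 * p0 + ς * p1 * p1) / (4 * α ^ 2) := by
      rw [key]
      ring
    rw [e, hgrad 0, hgrad 1]
    have := div_nonneg (add_nonneg (hhess 0) (hhess 1)) (by positivity : 0 ≤ 2 * α)
    simpa using this
  · have h1 : HasDerivAt (fun s : ℝ => s + s ^ 3 - 2 * m) (1 + 3 * t ^ 2) t := by
      have := ((hasDerivAt_id t).add (hasDerivAt_pow 3 t)).sub_const (2 * m)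
      simpa using this
    exact ((hasDerivAt_id t).div hD ha0.ne').sub h1

/-- Comparison with the model solution `t / a = t + t³ - 2m`, which has the same initial value. The
two signs together force equality. -/
theorem mul_sub_nonpos (hg : ∀ t, 1 ≤ t → g t = roundMetric)
    (hG : ∀ p ∈ N, G p = foliatedMetric a g p) (ha : ContMDiffOn IN 𝓘(ℝ, ℝ) ∞ a N)
    (hpos : ∀ p ∈ N, 0 < a p) (hscal : ∀ p ∈ N, scalarCurvature IN bN N G p = -6)
    (hmean : ∀ x, 1 / a (1, x) = 2 - 2 * m) {ς : ℝ} (hς : ς = 1 ∨ ς = -1) {t : ℝ} (ht : 1 ≤ t)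
    (x : S2) : ς * (t / a (t, x) - (t + t ^ 3 - 2 * m)) ≤ 0 := by
  have hcont : ContinuousOn (fun z : ℝ × S2 => z.1 / a z - (z.1 + z.1 ^ 3 - 2 * m)) N :=
    (continuousOn_fst.div ha.continuousOn fun p hp => (hpos p hp).ne').sub
      (by fun_prop)
  refine le_of_forall_pos_le_add fun δ hδ => ?_
  have ht0 : 0 < t := by linarith
  -- The barrier `δ s / t` is positive at the initial time, has positive slope, and equals `δ` at
  -- time `t`. This supplies the strict inequalities, and `δ` is arbitrary.
  have key := neg_of_deriv_neg (X := S2) (T := t)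
    (w := fun s x => ς * (s / a (s, x) - (s + s ^ 3 - 2 * m)) - δ / t * s) ?_ ?_ ?_ t
    ⟨ht, le_rfl⟩ x
  · rw [div_mul_cancel₀ _ ht0.ne'] at key
    linarith
  · exact (continuousOn_const.mul (hcont.mono (prod_mono Icc_subset_Ici_self subset_rfl))).sub
      (by fun_prop)
  · intro x
    simp only [hmean x]
    have : 0 < δ / t := by positivity
    linarith
  · intro s hs _ x hw hmax
    have hs0 : 0 < s := by linarith
    -- As `s / a` decreases in `a`, a spatial maximum of `ς s / a` is a minimum of `ς a`.
    have hmin : ∀ z, ς * a (s, x) ≤ ς * a (s, z) := by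
      intro z
      have hx0 := hpos (s, x) ⟨hs.le, mem_univ _⟩
      have hz0 := hpos (s, z) ⟨hs.le, mem_univ _⟩
      have h1 := (hmax z).trans hw.ge
      rcases hς with rfl | rfl
      · have h2 : s / a (s, z) ≤ s / a (s, x) := by linarith
        rw [div_le_div_iff_of_pos_left hs0 hz0 hx0] at h2
        linarith
      · have h2 : s / a (s, x) ≤ s / a (s, z) := by linarith
        rw [div_le_div_iff_of_pos_left hs0 hx0 hz0] at h2
        linarith
    obtain ⟨d, hd0, hd⟩ := exists_hasDerivAt_of_isMin (m := m) hg hG ha hpos hscal hs hmin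
    refine ⟨ς * d - δ / t * 1, ?_, (hd.const_mul ς).sub ((hasDerivAt_id s).const_mul (δ / t))⟩
    have : 0 < δ / t := by positivity
    linarith

theorem eq_adsSchwarzschild (h : IsRicciFlowExtension roundMetric (fun _ => -6)
    (fun _ => √(8 * (1 - m))) G) (hm1 : m < 1) {p : ℝ × S2} (hp : p ∈ N) :
    G p = adsSchwarzschild m p := by
  obtain ⟨g, f, u, hflow, h1, hu, hupos, hG, hscal, hH⟩ := h
  have hg : ∀ t, 1 ≤ t → g t = roundMetric := fun t ht => hflow.eq_roundMetric h1 ht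
  have hpos : ∀ p ∈ N, 0 < u p ^ 2 / (1 + p.1 ^ 2) := fun p hp =>
    div_pos (pow_pos (hupos p hp) 2) (by positivity)
  have hden : ContMDiffOn IN 𝓘(ℝ, ℝ) ∞ (fun p : ℝ × S2 => (1 + p.1 ^ 2)⁻¹) N :=
    contMDiffOn_comp_fst ((contDiff_const.add (contDiff_id.pow 2)).contDiffOn.inv
      fun t _ => by simp only [id]; positivity)
  have ha : ContMDiffOn IN 𝓘(ℝ, ℝ) ∞ (fun p => u p ^ 2 / (1 + p.1 ^ 2)) N := by
    have := (hu.mul hu).mul hden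
    refine this.congr fun p _ => ?_
    simp [div_eq_mul_inv, pow_two]
  -- Squaring `2 / √a(1, x) = √(8 (1 - m))`.
  have hmean : ∀ x, 1 / (u (1, x) ^ 2 / (1 + (1, x).1 ^ 2)) = 2 - 2 * m := by
    intro x
    have h2 := hH x
    have h3 : 0 < u (1, x) ^ 2 / (1 + (1, x).1 ^ 2) := hpos _ ⟨le_refl (1 : ℝ), mem_univ _⟩
    rw [meanCurvature_foliated hg hG ha hpos x] at h2
    have h4 := congrArg (· ^ 2) h2
    simp only [div_pow] at h4
    rw [Real.sq_sqrt h3.le, Real.sq_sqrt (by linarith)] at h4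
    rw [one_div]
    rw [div_eq_mul_inv] at h4
    linarith
  obtain ⟨t, x⟩ := p
  have ht : 1 ≤ t := hp.1
  have e1 := mul_sub_nonpos hg hG ha hpos hscal hmean (Or.inl rfl) ht x
  have e2 := mul_sub_nonpos hg hG ha hpos hscal hmean (Or.inr rfl) ht x
  have h3 : 0 < u (t, x) ^ 2 / (1 + t ^ 2) := hpos _ hp
  have e3 : u (t, x) ^ 2 / (1 + t ^ 2) = (1 + t ^ 2 - 2 * m / t)⁻¹ := by
    have e4 : t / (u (t, x) ^ 2 / (1 + t ^ 2)) = t + t ^ 3 - 2 * m := by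
      refine le_antisymm ?_ ?_ <;> simp only at e1 e2 <;> linarith
    have ht0 : t ≠ 0 := by linarith
    refine eq_inv_of_mul_eq_one_right ?_
    generalize u (t, x) ^ 2 / (1 + t ^ 2) = α at *
    rw [div_eq_iff h3.ne'] at e4
    field_simp
    linear_combination -e4
  rw [hG _ hp]
  simp only [adsSchwarzschild, foliatedMetric, hg t ht, e3]

end Uniqueness

/-! ### Asymptotics of the anti-de Sitter Schwarzschild metric -/

section Asymptotics

/-- The derivative of a function of `r` in the directions of the frame of hyperbolic space. -/
theorem dirDeriv_hypFrame {U : Set S2} (hU : IsOpen U) {r₀ : ℝ} {F : ℝ × S2 → ℝ} {φ φ' : ℝ → ℝ}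
    (hF : ∀ q ∈ Ioi r₀ ×ˢ U, F q = φ q.1) (hφ : ∀ r, r₀ < r → HasDerivAt φ (φ' r) r)
    (f : Fin 2 → ∀ x : S2, TangentSpace (𝓡 2) x) (k : Unit ⊕ Fin 2) {q : ℝ × S2}
    (hq : q ∈ Ioi r₀ ×ˢ U) :
    dirDeriv (hypFrame f k) F q = Sum.elim (fun _ => 1) (fun _ => 0) k * φ' q.1 := by
  have h1 : HasMFDerivAt IN 𝓘(ℝ, ℝ) (Prod.fst : ℝ × S2 → ℝ) q (ContinuousLinearMap.fst ℝ ℝ E2) :=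
    hasMFDerivAt_fst q
  have h2 : HasMFDerivAt 𝓘(ℝ, ℝ) 𝓘(ℝ, ℝ) φ q.1
      (ContinuousLinearMap.toSpanSingleton ℝ (φ' q.1) : ℝ →L[ℝ] ℝ) :=
    (hφ q.1 hq.1).hasFDerivAt.hasMFDerivAt
  have h3 : F =ᶠ[𝓝 q] φ ∘ Prod.fst := by
    filter_upwards [(isOpen_Ioi.prod hU).mem_nhds hq] with z hz using hF z hz
  have h4 := ((h2.comp q h1).congr_of_eventuallyEq h3).mfderiv
  rw [dirDeriv, h4]
  rcases k with k | k
  · change (1 : ℝ) • φ' q.1 = 1 * φ' q.1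
    simp
  · change (0 : ℝ) • φ' q.1 = 0 * φ' q.1
    simp

/-- The decay estimates for a component of a metric which only depends on `r`. -/
theorem decay_of_radial {U : Set S2} (hU : IsOpen U) {r₀ r₁ A c : ℝ} (h01 : r₀ < r₁)
    {F : ℝ × S2 → ℝ} {φ φ' φ'' : ℝ → ℝ} {δ : ℝ}
    (hF : ∀ q ∈ Ioi r₀ ×ˢ U, F q = φ q.1) (hφ : ∀ r, r₀ < r → HasDerivAt φ (φ' r) r)
    (hφ' : ∀ r, r₀ < r → HasDerivAt φ' (φ'' r) r)
    (hb : ∀ r, r₁ ≤ r → |φ r - δ| ≤ A * Real.exp (c * r) ∧ |φ' r| ≤ A * Real.exp (c * r) ∧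
      |φ'' r| ≤ A * Real.exp (c * r))
    (f : Fin 2 → ∀ x : S2, TangentSpace (𝓡 2) x) {r : ℝ} (hr : r₁ ≤ r) {x : S2} (hx : x ∈ U) :
    |F (r, x) - δ| ≤ A * Real.exp (c * r) ∧
    (∀ k, |dirDeriv (hypFrame f k) F (r, x)| ≤ A * Real.exp (c * r)) ∧
    (∀ k l, |dirDeriv (hypFrame f k) (dirDeriv (hypFrame f l) F) (r, x)| ≤
      A * Real.exp (c * r)) := by
  have hq : (r, x) ∈ Ioi r₀ ×ˢ U := ⟨lt_of_lt_of_le h01 hr, hx⟩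
  obtain ⟨b0, b1, b2⟩ := hb r hr
  have hA : 0 ≤ A * Real.exp (c * r) := (abs_nonneg _).trans b0
  refine ⟨by rwa [hF _ hq], fun k => ?_, fun k l => ?_⟩
  · rw [dirDeriv_hypFrame hU hF hφ f k hq]
    rcases k with k | k <;> simpa
  · rw [dirDeriv_hypFrame (φ := fun r => Sum.elim (fun _ => 1) (fun _ => 0) l * φ' r) hU
      (fun q hq => dirDeriv_hypFrame hU hF hφ f l hq)
      (fun r hr => (hφ' r hr).const_mul _) f k hq]
    rcases k with k | k <;> rcases l with l | l <;> simpa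

variable {m : ℝ}

/-- The function `sinh r cosh² r - 2m`. -/
def massAspect (m r : ℝ) : ℝ := Real.sinh r * Real.cosh r ^ 2 - 2 * m

theorem hasDerivAt_massAspect (r : ℝ) : HasDerivAt (massAspect m)
    (Real.cosh r ^ 3 + 2 * Real.sinh r ^ 2 * Real.cosh r) r := by
  have h := ((Real.hasDerivAt_sinh r).mul ((Real.hasDerivAt_cosh r).pow 2)).sub_const (2 * m)
  refine (h.congr_deriv ?_).congr_of_eventuallyEq (Filter.Eventually.of_forall fun s => rfl)
  simp
  ring

theorem hasDerivAt_deriv_massAspect (r : ℝ) :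
    HasDerivAt (fun r => Real.cosh r ^ 3 + 2 * Real.sinh r ^ 2 * Real.cosh r)
    (7 * Real.cosh r ^ 2 * Real.sinh r + 2 * Real.sinh r ^ 3) r := by
  have h := ((Real.hasDerivAt_cosh r).pow 3).add
    ((((Real.hasDerivAt_sinh r).pow 2).const_mul 2).mul (Real.hasDerivAt_cosh r))
  refine (h.congr_deriv ?_).congr_of_eventuallyEq (Filter.Eventually.of_forall fun s => rfl)
  simp
  ring

theorem massAspect_pos (hm1 : m < 1) {r : ℝ} (hr : Real.arsinh 1 < r) : 0 < massAspect m r := by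
  have h : 1 < Real.sinh r := by
    have := Real.sinh_lt_sinh.2 hr
    rwa [Real.sinh_arsinh] at this
  rw [massAspect, Real.cosh_sq]
  nlinarith [mul_pos (sub_pos.2 h) (sub_pos.2 h)]

theorem hasDerivAt_inv_massAspect (hm1 : m < 1) {r : ℝ} (hr : Real.arsinh 1 < r) :
    HasDerivAt (fun r => 1 + 2 * m * (massAspect m r)⁻¹)
      (2 * m * (-(Real.cosh r ^ 3 + 2 * Real.sinh r ^ 2 * Real.cosh r) / massAspect m r ^ 2)) r :=
  (((hasDerivAt_massAspect r).inv (massAspect_pos hm1 hr).ne').const_mul (2 * m)).const_add 1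

theorem hasDerivAt_deriv_inv_massAspect (hm1 : m < 1) {r : ℝ} (hr : Real.arsinh 1 < r) :
    HasDerivAt (fun r => 2 * m * (-(Real.cosh r ^ 3 + 2 * Real.sinh r ^ 2 * Real.cosh r) /
        massAspect m r ^ 2))
      (2 * m * (2 * (Real.cosh r ^ 3 + 2 * Real.sinh r ^ 2 * Real.cosh r) ^ 2 / massAspect m r ^ 3 -
        (7 * Real.cosh r ^ 2 * Real.sinh r + 2 * Real.sinh r ^ 3) / massAspect m r ^ 2)) r := by
  have h0 := massAspect_pos hm1 hr
  have h := (((hasDerivAt_deriv_massAspect r).neg).div ((hasDerivAt_massAspect (m := m) r).pow 2)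
    (pow_ne_zero 2 h0.ne')).const_mul (2 * m)
  refine (h.congr_deriv ?_).congr_of_eventuallyEq (Filter.Eventually.of_forall fun s => rfl)
  simp only [Pi.pow_apply, Pi.neg_apply, Nat.cast_ofNat, Nat.reduceSub, pow_one]
  field_simp
  ring

theorem exp_bounds {r : ℝ} (hr : 2 ≤ r) :
    6 < Real.exp r ∧ Real.cosh r ≤ Real.exp r ∧ 0 < Real.sinh r ∧ Real.sinh r ≤ Real.exp r ∧
      Real.exp r / 2 ≤ Real.cosh r ∧ Real.exp r / 4 ≤ Real.sinh r := by
  have h1 : 6 < Real.exp r := by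
    have h2 : Real.exp 2 ≤ Real.exp r := Real.exp_le_exp.2 hr
    have h3 : Real.exp 2 = Real.exp 1 ^ 2 := by rw [← Real.exp_nat_mul]; norm_num
    have := Real.exp_one_gt_d9
    nlinarith
  have h4 : 0 < Real.exp (-r) := Real.exp_pos _
  have h5 : Real.exp (-r) ≤ 1 := Real.exp_le_one_iff.2 (by linarith)
  rw [Real.cosh_eq, Real.sinh_eq]
  refine ⟨h1, ?_, ?_, ?_, ?_, ?_⟩ <;> linarith

/-- Let `P` be `massAspect` and `Q`, `T` its first two derivatives. All three have order `e^{3r}`,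
so each expression is `m / P` times a polynomial in the bounded ratios `Q / P` and `T / P`. The
constant is a crude upper bound for `32 · 4 · 96²`. -/
theorem radial_bounds (hm0 : 0 < m) (hm1 : m < 1) {r : ℝ} (hr : 2 ≤ r) :
    |1 + 2 * m * (massAspect m r)⁻¹ - 1| ≤ 2000000 * Real.exp (-3 * r) ∧
    |2 * m * (-(Real.cosh r ^ 3 + 2 * Real.sinh r ^ 2 * Real.cosh r) / massAspect m r ^ 2)| ≤
      2000000 * Real.exp (-3 * r) ∧
    |2 * m * (2 * (Real.cosh r ^ 3 + 2 * Real.sinh r ^ 2 * Real.cosh r) ^ 2 / massAspect m r ^ 3 -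
        (7 * Real.cosh r ^ 2 * Real.sinh r + 2 * Real.sinh r ^ 3) / massAspect m r ^ 2)| ≤
      2000000 * Real.exp (-3 * r) := by
  obtain ⟨h6, hc, hs0, hs, hc', hs'⟩ := exp_bounds hr
  have hE : Real.exp (-3 * r) = (Real.exp r ^ 3)⁻¹ := by
    rw [← Real.exp_nat_mul, ← Real.exp_neg]
    norm_num
  -- The product `sinh r cosh² r` is at least `e^{3r} / 16`. Half of this absorbs `2m`, since `e^r >
  -- 6` and `m < 1`.
  have hP : Real.exp r ^ 3 / 32 ≤ massAspect m r := by
    have h1 : Real.exp r / 4 * (Real.exp r / 2) ^ 2 ≤ Real.sinh r * Real.cosh r ^ 2 :=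
      mul_le_mul hs' (pow_le_pow_left₀ (by positivity) hc' 2) (by positivity) hs0.le
    have h2 : (6 : ℝ) ^ 3 ≤ Real.exp r ^ 3 := pow_le_pow_left₀ (by norm_num) h6.le 3
    rw [massAspect]
    nlinarith
  have hc0 : 0 < Real.cosh r := Real.cosh_pos r
  have e0 : 0 < Real.exp r := Real.exp_pos r
  have hQ0 : 0 ≤ Real.cosh r ^ 3 + 2 * Real.sinh r ^ 2 * Real.cosh r := by positivity
  have hQ : Real.cosh r ^ 3 + 2 * Real.sinh r ^ 2 * Real.cosh r ≤ 3 * Real.exp r ^ 3 :=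
    calc _ ≤ Real.exp r ^ 3 + 2 * Real.exp r ^ 2 * Real.exp r := by gcongr
      _ = _ := by ring
  have hT0 : 0 ≤ 7 * Real.cosh r ^ 2 * Real.sinh r + 2 * Real.sinh r ^ 3 := by positivity
  have hT : 7 * Real.cosh r ^ 2 * Real.sinh r + 2 * Real.sinh r ^ 3 ≤ 9 * Real.exp r ^ 3 :=
    calc _ ≤ 7 * Real.exp r ^ 2 * Real.exp r + 2 * Real.exp r ^ 3 := by gcongr
      _ = _ := by ring
  rw [hE]
  generalize Real.cosh r ^ 3 + 2 * Real.sinh r ^ 2 * Real.cosh r = Q at *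
  generalize 7 * Real.cosh r ^ 2 * Real.sinh r + 2 * Real.sinh r ^ 3 = T at *
  generalize massAspect m r = P at *
  set e := Real.exp r ^ 3 with he
  have e3 : 0 < e := by positivity
  have hP0 : 0 < P := lt_of_lt_of_le (by positivity) hP
  have i1 : P⁻¹ ≤ 32 * e⁻¹ := by
    have := inv_anti₀ (by positivity) hP
    rwa [inv_div, div_eq_mul_inv] at this
  have hPi : 0 < P⁻¹ := inv_pos.2 hP0
  have hei : 0 < e⁻¹ := inv_pos.2 e3
  have hee : e * e⁻¹ = 1 := mul_inv_cancel₀ e3.ne'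
  have hQP : Q * P⁻¹ ≤ 96 :=
    calc Q * P⁻¹ ≤ 3 * e * (32 * e⁻¹) := by gcongr
      _ = 96 * (e * e⁻¹) := by ring
      _ = 96 := by rw [hee, mul_one]
  have hTP : T * P⁻¹ ≤ 288 :=
    calc T * P⁻¹ ≤ 9 * e * (32 * e⁻¹) := by gcongr
      _ = 288 * (e * e⁻¹) := by ring
      _ = 288 := by rw [hee, mul_one]
  have hQP0 : 0 ≤ Q * P⁻¹ := by positivity
  have hTP0 : 0 ≤ T * P⁻¹ := by positivity
  have hmP : m * P⁻¹ ≤ 32 * e⁻¹ := by nlinarith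
  have hmP0 : 0 < m * P⁻¹ := by positivity
  refine ⟨?_, ?_, ?_⟩
  · rw [abs_le]
    constructor <;> linarith
  · have : 2 * m * (-Q / P ^ 2) = -(2 * (m * P⁻¹) * (Q * P⁻¹)) := by
      field_simp
    rw [this, abs_neg, abs_of_nonneg (by positivity)]
    calc 2 * (m * P⁻¹) * (Q * P⁻¹) ≤ 2 * (32 * e⁻¹) * 96 := by gcongr
      _ ≤ 2000000 * e⁻¹ := by linarith
  · have : 2 * m * (2 * Q ^ 2 / P ^ 3 - T / P ^ 2) =
        (m * P⁻¹) * (4 * (Q * P⁻¹) ^ 2 - 2 * (T * P⁻¹)) := by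
      field_simp
      ring
    rw [this, abs_mul, abs_of_pos hmP0]
    have hb : |4 * (Q * P⁻¹) ^ 2 - 2 * (T * P⁻¹)| ≤ 4 * 96 ^ 2 := by
      have : (Q * P⁻¹) ^ 2 ≤ 96 ^ 2 := pow_le_pow_left₀ hQP0 hQP 2
      rw [abs_le]
      constructor <;> nlinarith [sq_nonneg (Q * P⁻¹)]
    calc m * P⁻¹ * |4 * (Q * P⁻¹) ^ 2 - 2 * (T * P⁻¹)| ≤ 32 * e⁻¹ * (4 * 96 ^ 2) := by gcongr
      _ ≤ 2000000 * e⁻¹ := by linarith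

/-- The diffeomorphism `(r, x) ↦ (sinh r, x)` from the exterior of a geodesic sphere of hyperbolic
space to the interior of `N`. -/
def sinhChart : OpenPartialHomeomorph (ℝ × S2) (ℝ × S2) :=
  (Real.sinhHomeomorph.prodCongr (Homeomorph.refl S2)).toOpenPartialHomeomorphOfImageEq
    (Ioi (Real.arsinh 1) ×ˢ univ) (isOpen_Ioi.prod isOpen_univ) (N \ ({1} ×ˢ univ)) (by
      ext ⟨t, x⟩
      constructor
      · rintro ⟨⟨r, y⟩, ⟨hr, -⟩, h⟩
        obtain ⟨rfl, rfl⟩ := Prod.mk.inj h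
        have h1 : 1 < Real.sinh r := by
          have := Real.sinh_lt_sinh.2 (mem_Ioi.1 hr)
          rwa [Real.sinh_arsinh] at this
        exact ⟨⟨h1.le, mem_univ _⟩, fun h => h1.ne' h.1⟩
      · rintro ⟨⟨ht, -⟩, h⟩
        have h1 : 1 < t := lt_of_le_of_ne ht fun h' => h ⟨h'.symm, mem_univ _⟩
        exact ⟨(Real.arsinh t, x), ⟨Real.arsinh_lt_arsinh.2 h1, mem_univ _⟩,
          Prod.ext (Real.sinh_arsinh t) rfl⟩)

theorem coe_sinhChart : (sinhChart : ℝ × S2 → ℝ × S2) = Prod.map Real.sinh id := rfl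

theorem coe_sinhChart_symm : (sinhChart.symm : ℝ × S2 → ℝ × S2) = Prod.map Real.arsinh id := rfl

theorem hasMFDerivAt_sinhChart (q : ℝ × S2) : HasMFDerivAt IN IN sinhChart q
    (((ContinuousLinearMap.toSpanSingleton ℝ (Real.cosh q.1)).comp
      (ContinuousLinearMap.fst ℝ ℝ E2)).prod (ContinuousLinearMap.snd ℝ ℝ E2) :
        ℝ × E2 →L[ℝ] ℝ × E2) := by
  have h1 : HasMFDerivAt IN 𝓘(ℝ, ℝ) (Prod.fst : ℝ × S2 → ℝ) q (ContinuousLinearMap.fst ℝ ℝ E2) :=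
    hasMFDerivAt_fst q
  have h2 : HasMFDerivAt IN (𝓡 2) (Prod.snd : ℝ × S2 → S2) q (ContinuousLinearMap.snd ℝ ℝ E2) :=
    hasMFDerivAt_snd q
  have h3 : HasMFDerivAt 𝓘(ℝ, ℝ) 𝓘(ℝ, ℝ) Real.sinh q.1
      (ContinuousLinearMap.toSpanSingleton ℝ (Real.cosh q.1) : ℝ →L[ℝ] ℝ) :=
    (Real.hasDerivAt_sinh q.1).hasFDerivAt.hasMFDerivAt
  exact (h3.comp q h1).prodMk h2

theorem pullbackTensor_sinhChart (G : Tensor2 IN (ℝ × S2)) (q : ℝ × S2) (v w : ℝ × E2) :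
    pullbackTensor sinhChart G q v w =
      formN G (Real.sinh q.1, q.2) (Real.cosh q.1 * v.1, v.2) (Real.cosh q.1 * w.1, w.2) := by
  simp only [pullbackTensor, (hasMFDerivAt_sinhChart q).mfderiv]
  change formN G (Real.sinh q.1, q.2) (v.1 • Real.cosh q.1, v.2) (w.1 • Real.cosh q.1, w.2) = _
  simp only [smul_eq_mul, mul_comm]

theorem pullbackTensor_adsSchwarzschild (q : ℝ × S2) (v w : ℝ × E2) :
    pullbackTensor sinhChart (adsSchwarzschild m) q v w =
      (1 + Real.sinh q.1 ^ 2 - 2 * m / Real.sinh q.1)⁻¹ *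
        (Real.cosh q.1 * v.1 * (Real.cosh q.1 * w.1)) +
      Real.sinh q.1 ^ 2 * formE roundMetric q.2 v.2 w.2 := by
  rw [pullbackTensor_sinhChart, adsSchwarzschild, formN_foliatedMetric]

/-- The components of the metric in the frame of hyperbolic space, as functions of `r`. -/
def adsComponent (m : ℝ) : Unit ⊕ Fin 2 → Unit ⊕ Fin 2 → ℝ → ℝ
  | Sum.inl _, Sum.inl _, r => 1 + 2 * m * (massAspect m r)⁻¹
  | Sum.inl _, Sum.inr _, _ => 0
  | Sum.inr _, Sum.inl _, _ => 0
  | Sum.inr k, Sum.inr l, _ => if k = l then 1 else 0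

/-- Under `t = sinh r` the hyperbolic metric is `dt² / (1 + t²) + t² σ`, so only the radial
component differs from it: `cosh² r / (1 + sinh² r - 2m / sinh r)` equals `1 + 2m / massAspect m r`.
-/
theorem pullbackTensor_hypFrame (hm1 : m < 1) {f : Fin 2 → ∀ x : S2, TangentSpace (𝓡 2) x}
    {U : Set S2} (hf : IsLocalOrthonormalFrame f U) (i j : Unit ⊕ Fin 2) {q : ℝ × S2}
    (hq : q ∈ Ioi (Real.arsinh 1) ×ˢ U) :
    pullbackTensor sinhChart (adsSchwarzschild m) q (hypFrame f i q) (hypFrame f j q) =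
      adsComponent m i j q.1 := by
  have hs : 0 < Real.sinh q.1 :=
    Real.sinh_pos_iff.2 ((Real.arsinh_pos_iff.2 one_pos).trans hq.1)
  have hP := massAspect_pos hm1 hq.1
  refine (pullbackTensor_adsSchwarzschild q _ _).trans ?_
  rcases i with i | i <;> rcases j with j | j <;> simp only [hypFrame, adsComponent]
  · have h1 : 1 + Real.sinh q.1 ^ 2 - 2 * m / Real.sinh q.1 =
        massAspect m q.1 / Real.sinh q.1 := by
      rw [massAspect, Real.cosh_sq]
      field_simp
      ring
    have h2 : Real.sinh q.1 * Real.cosh q.1 ^ 2 = massAspect m q.1 + 2 * m := by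
      rw [massAspect]
      ring
    rw [h1, map_zero]
    field_simp
    linear_combination h2
  · have h1 : ∀ w : E2, formE roundMetric q.2 0 w = 0 := fun w => by simp
    refine (congrArg (fun z => _ + _ * z) (h1 _)).trans ?_
    simp
  · simp
  · have h1 : formE roundMetric q.2 (f i q.2) (f j q.2) = if i = j then 1 else 0 :=
      hf.orthonormal q.2 hq.2 i j
    have h2 : ∀ (c : ℝ) (v w : E2), formE roundMetric q.2 (c • v) (c • w) =
        c ^ 2 * formE roundMetric q.2 v w := fun c v w => by
      simp
      ring
    refine (congrArg (fun z => _ + _ * z) ((h2 _ _ _).trans (congrArg (_ * ·) h1))).trans ?_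
    split_ifs <;> simp
    field_simp

theorem isAsymptoticallyHyperbolic_adsSchwarzschild (hm0 : 0 < m) (hm1 : m < 1) :
    IsAsymptoticallyHyperbolic (adsSchwarzschild m) := by
  -- The compact set removed is the boundary sphere `t = 1`, that is `r = arsinh 1`; the exponent is
  -- the decay rate of `1 / (sinh r cosh² r)`.
  refine ⟨3, Real.arsinh 1, {1} ×ˢ univ, sinhChart, by norm_num, Real.arsinh_pos_iff.2 one_pos,
    isCompact_singleton.prod isCompact_univ,
    prod_mono (singleton_subset_iff.2 (le_refl (1 : ℝ))) subset_rfl, rfl, rfl, ?_, ?_, ?_⟩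
  · rw [coe_sinhChart]
    exact (Real.contDiff_sinh.contMDiff.prodMap contMDiff_id).contMDiffOn
  · rw [coe_sinhChart_symm]
    exact (Real.contDiff_arsinh.contMDiff.prodMap contMDiff_id).contMDiffOn
  intro f U hf K hK _
  -- The bound `2` is needed for the exponential estimates, the other entry to stay inside the
  -- domain of the chart.
  have h01 : Real.arsinh 1 < max 2 (Real.arsinh 1 + 1) := by simp
  refine ⟨2000000, max 2 (Real.arsinh 1 + 1), h01, fun r hr x hx i j => ?_⟩
  have hF : ∀ q ∈ Ioi (Real.arsinh 1) ×ˢ U, _ := fun q hq =>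
    pullbackTensor_hypFrame hm1 hf i j hq
  rcases i with i | i <;> rcases j with j | j
  · exact decay_of_radial hf.isOpen h01 hF (fun r hr => hasDerivAt_inv_massAspect hm1 hr)
      (fun r hr => hasDerivAt_deriv_inv_massAspect hm1 hr)
      (fun r hr => by
        simp only [adsComponent, if_true]
        exact radial_bounds hm0 hm1 ((le_max_left _ _).trans hr)) f hr (hK hx)
  · exact decay_of_radial hf.isOpen h01 hF (fun r _ => hasDerivAt_const r 0)
      (fun r _ => hasDerivAt_const r 0) (fun r _ => by simp [adsComponent, (Real.exp_pos _).le]) f hr (hK hx)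
  · exact decay_of_radial hf.isOpen h01 hF (fun r _ => hasDerivAt_const r 0)
      (fun r _ => hasDerivAt_const r 0) (fun r _ => by simp [adsComponent, (Real.exp_pos _).le]) f hr (hK hx)
  · exact decay_of_radial hf.isOpen h01 hF (fun r _ => hasDerivAt_const r _)
      (fun r _ => hasDerivAt_const r 0) (fun r _ => by simp [adsComponent, (Real.exp_pos _).le]) f hr (hK hx)

end Asymptotics

end RicciFoliation

end

/-! ### The theorem assembled -/

theorem corollary9 (m : ℝ) (hm0 : 0 < m) (hm1 : m < 1) :
    (∀ (g : ℝ → RicciFoliation.Tensor2 (𝓡 2) RicciFoliation.S2) (f : ℝ → RicciFoliation.S2 → ℝ),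
      RicciFoliation.IsModifiedRicciFlow g f → g 1 = RicciFoliation.roundMetric →
        RicciFoliation.IsAdmissible g f (fun _ => -6) (fun _ => √(8 * (1 - m)))) ∧
    RicciFoliation.IsRicciFlowExtension RicciFoliation.roundMetric (fun _ => -6)
      (fun _ => √(8 * (1 - m))) (RicciFoliation.adsSchwarzschild m) ∧
    RicciFoliation.IsAsymptoticallyHyperbolic (RicciFoliation.adsSchwarzschild m) ∧
    ∀ G : RicciFoliation.Tensor2 RicciFoliation.IN (ℝ × RicciFoliation.S2),
      RicciFoliation.IsRicciFlowExtension RicciFoliation.roundMetric (fun _ => -6)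
        (fun _ => √(8 * (1 - m))) G →
      ∀ p ∈ RicciFoliation.N, G p = RicciFoliation.adsSchwarzschild m p := by
  exact ⟨fun g f h h1 => RicciFoliation.isAdmissible_of_eq_roundMetric h h1
      (Real.sqrt_pos.2 (by linarith)),
    RicciFoliation.isRicciFlowExtension_adsSchwarzschild hm0 hm1,
    RicciFoliation.isAsymptoticallyHyperbolic_adsSchwarzschild hm0 hm1,
    fun G hG p hp => RicciFoliation.eq_adsSchwarzschild hG hm1 hp⟩
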